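/- **Model.** Fix $p_0\in\mathbb R$, $\sigma_v,\sigma_1,\sigma_{1_+},\sigma_2>0$, $\sigma_\varepsilon\ge 0$ and $\gamma\ge 0$. A risky asset with value $v\sim N(p_0,\sigma_v^2)$ is traded by competitive dealers, an informed trader (IT), one high-frequency trader (HFT) with inventory aversion $\gamma$, and noise traders. Let $z\sim N(0,\sigma_z^2)$ (with $\sigma_z\ge0$), $\varepsilon\sim N(0,\sigma_\varepsilon^2)$, $u_1\sim N(0,\sigma_1^2)$, $u_{1_+}\sim N(0,\sigma_{1_+}^2)$, $u_2\sim N(0,\sigma_2^2)$, all independent of each other and of $v$. The IT's orders are $i_1,i_2$; the HFT observes $\tilde i_1=i_1+\varepsilon$ and submits $x_1,x_2$; the order flows are $y_1=i_1+u_1$, $y_{1_+}=x_1+u_{1_+}$, $y_2=i_2+x_2+u_2$. Consider linear strategies $$p_1=p_0+\lambda_1y_1,\quad p_{1_+}=p_1+\lambda_{1_+}y_{1_+},\quad p_2=p_1+\lambda_{21}y_{1_+}+\lambda_{22}y_2,$$ $$i_1=\alpha_1(v-p_0)+z,\quad i_2=\alpha_{21}(v-\mathbb E(v|y_1))+\alpha_{22}(i_1-\mathbb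 E(i_1|y_1)),$$ $$x_1=\beta_{11}(\tilde i_1-\mathbb E(\tilde i_1|y_1)),\quad x_2=\beta_{21}(\tilde i_1-\mathbb E(\tilde i_1|y_1))+\beta_{22}(y_{1_+}-x_1)+\beta_{23}x_1,$$ where $\mathbb E(v|y_1)=p_1$ and $\mathbb E(i_1|y_1)=\mathbb E(\tilde i_1|y_1)=\frac{\alpha_1^2\sigma_v^2+\sigma_z^2}{\alpha_1^2\sigma_v^2+\sigma_z^2+\sigma_1^2}\,y_1$, also as functions of $y_1$ after a deviation. Such a profile is an *equilibrium* if: 1. (dealers) $p_1=\mathbb E(v|y_1)$, $p_{1_+}=\mathbb E(v|y_1,y_{1_+})$, $p_2=\mathbb E(v|y_1,y_{1_+},y_2)$ almost surely; 2. (IT) given the other strategies, (a) whatever order $i_1$, a measurable function of $(v,z)$, she has submitted, the continuation $i_2$ is the maximizer of $\mathbb E((v-p_2)i_2\,|\,v,i_1,y_1)$ over all measurable $i_2=i_2(v,i_1,y_1)$; (b) with continuation $i_2$ as prescribed, in a *mixed-strategy equilibrium* $\sigma_z>0$ and $\mathbb E(i_1(v-p_1)+(v-p_2)i_2\,|\,v)$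 is the same for all measurable $i_1=i_1(v)$, while in a *pure-strategy equilibrium* $\sigma_z=0$ and $i_1=\alpha_1(v-p_0)$ is the maximizer of this quantity over all measurable $i_1=i_1(v)$; 3. (HFT) given the other strategies, (a) whatever order $x_1=x_1(\tilde i_1,y_1)$ she has submitted, the continuation $x_2$ is the maximizer of $\mathbb E((v-p_2)x_2-\gamma(x_1+x_2)^2\,|\,\tilde i_1,y_1,y_{1_+})$ over all measurable $x_2=x_2(\tilde i_1,y_1,y_{1_+})$; (b) with continuation $x_2$ as prescribed, $x_1$ is the maximizer of $\mathbb E((v-p_{1_+})x_1+(v-p_2)x_2-\gamma(x_1+x_2)^2\,|\,\tilde i_1,y_1)$ over all measurable $x_1=x_1(\tilde i_1,y_1)$. Here "the maximizer" means the almost surely unique maximizer, and only orders for which the relevant objective is integrable are compared (and, in 2(a) and 3(a), only first-stage orders after which the prescribed continuation has an integrable objective). **Dimensionless quantities.** Put $\theta_{1_+}=\sigma_{1_+}^2/\sigma_1^2$, $\theta_2=\sigma_2^2/\sigma_1^2$, $\theta_\varepsilon=\sigma_\varepsilon^2/\sigma_1^2$, $\Gamma=\gamma/(\sigma_v/\sigma_1)$,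 $\Lambda_k=\lambda_k/(\sigma_v/\sigma_1)$ for $k\in\{1,1_+,21,22\}$, $A_1=\alpha_1/(\sigma_1/\sigma_v)$, $A_{21}=\alpha_{21}/(\sigma_1/\sigma_v)$, $\theta_z=\sigma_z^2/\sigma_1^2$. **Theorem.** (i) The linear profile is a mixed-strategy equilibrium if and only if $(A_1,\theta_z,\beta_{11})$ solves the following system (in which $\beta_{11}\ne0$, since it divides by $\beta_{11}$) and the remaining coefficients are given by the closed forms after it. With $$\begin{aligned} D&= A_1^{2} + \theta_z + 1 \end{aligned}$$ $$\begin{aligned} E&= \theta_\varepsilon \theta_z + \theta_\varepsilon + \theta_z \end{aligned}$$ $$\begin{aligned} Y&= A_1^{2} (\theta_\varepsilon + 1) + \theta_\varepsilon \theta_z + \theta_\varepsilon + \theta_z \end{aligned}$$ $$\begin{aligned} R&= A_1^{2} \Gamma + A_1 + \Gamma \theta_z + \Gamma \end{aligned}$$ $$\begin{aligned} T&= 2 A_1^{2} \Gamma + A_1 + 2 \Gamma (\theta_z + 1) \end{aligned}$$ $$\begin{aligned} M&= A_1^{2} (\beta_{11}^{2} (\theta_\varepsilon + 1) + \theta_{1_+})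 + \beta_{11}^{2} E + \theta_{1_+} (\theta_z + 1) \end{aligned}$$ $$\begin{aligned} F&= 4 A_1^{5} (\theta_\varepsilon + 1) \Gamma + A_1^{4} (\theta_\varepsilon (8 \beta_{11} \Gamma^{2} + 4) + 8 \beta_{11} \Gamma^{2} + 3)\\ &\quad + 4 A_1^{3} \Gamma (2 \beta_{11} (\theta_\varepsilon + 1) + 2 \theta_\varepsilon (\theta_z + 1) + 2 \theta_z + 1)\\ &\quad + A_1^{2} (4 \theta_\varepsilon (\theta_z + 1) (4 \beta_{11} \Gamma^{2} + 1) + 8 \beta_{11} \Gamma^{2} (2 \theta_z + 1) + 3 \theta_z - 1)\\ &\quad + 4 A_1 \Gamma (2 \beta_{11} + \theta_z + 1) E + 8 \beta_{11} \Gamma^{2} (\theta_z + 1) E \end{aligned}$$ $$\begin{aligned} K&= 4 (\theta_\varepsilon + 1) \Gamma A_1^{4} + (4 \theta_\varepsilon + 3) A_1^{3}\\ &\quad + 4 \Gamma (\theta_\varepsilon \beta_{11} + \beta_{11} + 2 \theta_\varepsilon + 2 \theta_\varepsilon \theta_z + 2 \theta_z + 1) A_1^{2}\\ &\quad + (3 \theta_z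 + 4 \theta_\varepsilon (\theta_z + 1) - 1) A_1 + 4 \Gamma (\beta_{11} + \theta_z + 1) E \end{aligned}$$ $$\begin{aligned} U&= (2 \theta_\varepsilon + 1) A_1^{3} + 4 \beta_{11} (\theta_\varepsilon + 1) \Gamma A_1^{2} + (\theta_z + 2 \theta_\varepsilon (\theta_z + 1) - 1) A_1\\ &\quad + 4 \beta_{11} \Gamma E \end{aligned}$$ $$\begin{aligned} W&= 2 (\theta_\varepsilon + 1) \Gamma A_1^{6} + (3 \theta_\varepsilon + 2) A_1^{5}\\ &\quad + 2 \Gamma (3 \theta_z \theta_\varepsilon + \theta_\varepsilon + 2 \beta_{11} (\theta_\varepsilon + 1) + 3 \theta_z) A_1^{4}\\ &\quad + 2 (3 \theta_z \theta_\varepsilon + \theta_\varepsilon + 2 \theta_z - 1) A_1^{3}\\ &\quad + 2 \Gamma (3 \theta_z^{2} + 4 \beta_{11} \theta_z + \theta_\varepsilon (3 \theta_z^{2} + 4 \beta_{11} \theta_z + 2 \theta_z + 2 \beta_{11} - 1) - 1) A_1^{2}\\ &\quad + (2 (\theta_z - 1) \theta_z + \theta_\varepsilon (3 \theta_z^{2}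 + 2 \theta_z - 1)) A_1 + 2 \Gamma E (\theta_z^{2} + 2 \beta_{11} \theta_z - 1) \end{aligned}$$ $$\begin{aligned} X&= 2 (\theta_\varepsilon + 1) \Gamma A_1^{6} + (3 \theta_\varepsilon + 2) A_1^{5}\\ &\quad + 2 \Gamma (\theta_z \theta_\varepsilon + \theta_\varepsilon + 2 \beta_{11} (\theta_\varepsilon + 1) + \theta_z) A_1^{4}\\ &\quad + (\theta_z + 2 \theta_\varepsilon (\theta_z + 1) - 2) A_1^{3}\\ &\quad + 2 \Gamma (-\theta_z^{2} + 2 (\beta_{11} - 1) \theta_z + \theta_\varepsilon (2 \beta_{11} - \theta_z - 1) (\theta_z + 1) - 1) A_1^{2} - (\theta_z + 1) E A_1\\ &\quad - 2 \Gamma (\theta_z + 1)^{2} E \end{aligned}$$ $$\begin{aligned} N&= 4 \beta_{11}^{2} (\theta_\varepsilon + 1) \Gamma^{2} A_1^{8} + 4 (\theta_\varepsilon + 1) \Gamma ((\theta_\varepsilon + 2) \beta_{11}^{2} + \theta_{1_+}) A_1^{7}\\ &\quad + (8 (\theta_\varepsilon + 1)^{2} \Gamma^{2} \beta_{11}^{3}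 + 4 (\theta_\varepsilon^{2} + 2 (2 \theta_z \Gamma^{2} + \Gamma^{2} + 1) \theta_\varepsilon + \Gamma^{2} + 4 \Gamma^{2} \theta_z + 1) \beta_{11}^{2} + (4 \theta_\varepsilon + 3) \theta_{1_+}) A_1^{6}\\ &\quad + 4 \Gamma (2 (\theta_\varepsilon + 1)^{2} \beta_{11}^{3} + (3 (\theta_z + 1) \theta_\varepsilon^{2} + (9 \theta_z + 4) \theta_\varepsilon + 6 \theta_z) \beta_{11}^{2} + (\theta_\varepsilon + 1) \theta_{1_+} \beta_{11} + \theta_{1_+} (3 \theta_z + 3 \theta_\varepsilon (\theta_z + 1) + 2)) A_1^{5}\\ &\quad + 2 (4 (\theta_\varepsilon + 1) \Gamma^{2} (3 \theta_z + 3 \theta_\varepsilon (\theta_z + 1) + 1) \beta_{11}^{3} + 2 (2 (\theta_z + 1) \theta_\varepsilon^{2} + 6 \Gamma^{2} \theta_z^{2} \theta_\varepsilon + (6 \Gamma^{2} + 4) \theta_z \theta_\varepsilon + \theta_\varepsilon + 2 \theta_z + \Gamma^{2} (6 \theta_z^{2} + 3 \theta_z - 1) - 1) \beta_{11}^{2}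 + \theta_{1_+} (3 \theta_z + 4 \theta_\varepsilon (\theta_z + 1) + 1)) A_1^{4}\\ &\quad + 4 \Gamma (4 (\theta_\varepsilon + 1) E \beta_{11}^{3} + (6 \theta_z^{2} + 3 \theta_\varepsilon^{2} (\theta_z + 1)^{2} + \theta_\varepsilon (9 \theta_z^{2} + 8 \theta_z - 1) - 2) \beta_{11}^{2} + \theta_{1_+} (2 \theta_z + 2 \theta_\varepsilon (\theta_z + 1) + 1) \beta_{11} + \theta_{1_+} (\theta_z + 1) (3 \theta_z + 3 \theta_\varepsilon (\theta_z + 1) + 1)) A_1^{3}\\ &\quad + (8 \Gamma^{2} (3 \theta_\varepsilon^{2} (\theta_z + 1)^{2} + \theta_z (3 \theta_z + 2) + \theta_\varepsilon (6 \theta_z^{2} + 8 \theta_z + 2)) \beta_{11}^{3} + 4 ((4 \theta_z^{3} + 3 \theta_z^{2} - 2 \theta_z - 1) \Gamma^{2} + \theta_\varepsilon^{2} (\theta_z + 1)^{2} + (\theta_z - 1) \theta_z + \theta_\varepsilon (2 \theta_z^{2} + \theta_z - 1) (2 (\theta_z + 1) \Gamma^{2} + 1)) \beta_{11}^{2} +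 \theta_{1_+} (\theta_z + 1) (3 \theta_z + 4 \theta_\varepsilon (\theta_z + 1) - 1)) A_1^{2}\\ &\quad + 4 \Gamma E (2 E \beta_{11}^{3} + (\theta_z + 1) (\theta_z \theta_\varepsilon + \theta_\varepsilon + 2 \theta_z - 2) \beta_{11}^{2} + \theta_{1_+} (\theta_z + 1) \beta_{11} + \theta_{1_+} (\theta_z + 1)^{2}) A_1\\ &\quad + 4 \beta_{11}^{2} \Gamma^{2} (\theta_z + 1) E (\theta_z^{2} + 2 \beta_{11} E - 1) \end{aligned}$$ $$\begin{aligned} P_2&= 4 (\theta_\varepsilon + 1) \Gamma^{2} (\theta_\varepsilon \beta_{11}^{2} + \theta_{1_+}) A_1^{14}\\ &\quad + 4 \Gamma (2 \theta_\varepsilon (\theta_\varepsilon + 1) \beta_{11}^{2} + 2 \theta_\varepsilon \theta_{1_+} + \theta_{1_+}) A_1^{13}\\ &\quad + (4 \theta_\varepsilon ((6 \theta_z + 2) \Gamma^{2} + \theta_\varepsilon (6 \theta_z + 3) \Gamma^{2} + \theta_\varepsilon + 1) \beta_{11}^{2} + 16 (\theta_\varepsilon + 1) \Gamma^{2} \theta_{1_+}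 \beta_{11} + \theta_{1_+} (8 (3 \theta_z + 1) \Gamma^{2} + 4 \theta_\varepsilon ((6 \theta_z + 3) \Gamma^{2} + 1) + 1)) A_1^{12}\\ &\quad + 4 \Gamma (2 \theta_\varepsilon (5 \theta_z + \theta_\varepsilon (5 \theta_z + 2) + 1) \beta_{11}^{2} + 2 (\theta_\varepsilon + 1) \theta_{1_+} \beta_{11} + \theta_{1_+} (5 \theta_z + 2 \theta_\varepsilon (5 \theta_z + 2) - 1)) A_1^{11}\\ &\quad + 4 ((((15 \theta_z^{2} + 16 \theta_z + 4 \theta_{1_+} + 4 \theta_2 + 1) \Gamma^{2} + 4 \theta_z + 1) \theta_\varepsilon^{2} + ((15 \theta_z^{2} + 12 \theta_z + 8 \theta_{1_+} + 8 \theta_2 - 1) \Gamma^{2} + 4 \theta_z) \theta_\varepsilon + \Gamma^{2} (4 \theta_{1_+} + 4 \theta_2 + \theta_z)) \beta_{11}^{2} + 4 \Gamma^{2} \theta_{1_+} (5 \theta_z + \theta_\varepsilon (5 \theta_z + 3) + 2) \beta_{11} + \theta_{1_+} ((15 \theta_z^{2} + 11 \theta_z + 4 \theta_2 - 1) \Gamma^{2}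 + \theta_\varepsilon (15 \theta_z^{2} + 16 \theta_z + 4 \theta_2 + 1) \Gamma^{2} + \theta_\varepsilon + 4 \theta_\varepsilon \theta_z + \theta_z - 1)) A_1^{10}\\ &\quad + 8 \Gamma (((10 \theta_z^{2} + 9 \theta_z + 4 \theta_2 - 1) \theta_\varepsilon^{2} + 2 (5 \theta_z^{2} + 3 \theta_z + 4 \theta_2 - 1) \theta_\varepsilon + 4 \theta_2 + \theta_z) \beta_{11}^{2} + \theta_{1_+} (4 (\theta_\varepsilon + 1) \theta_z - 1) \beta_{11} + \theta_{1_+} (5 \theta_z^{2} - \theta_z + 4 \theta_2 + \theta_\varepsilon (10 \theta_z^{2} + 9 \theta_z + 4 \theta_2 - 1) - 3)) A_1^{9}\\ &\quad + 2 (2 (((\theta_z + 1) (20 \theta_z^{2} + 15 \theta_z + 16 \theta_{1_+} + 16 \theta_2 - 5) \Gamma^{2} + 6 \theta_z^{2} + 4 \theta_2 + 4 \theta_z - 2) \theta_\varepsilon^{2} + 2 ((10 \theta_z^{3} + 15 \theta_z^{2} + 3 \theta_z + 4 \theta_{1_+} (4 \theta_z + 3) + 4 \theta_2 (4 \theta_z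 + 3) - 2) \Gamma^{2} + 3 \theta_z^{2} + 4 \theta_2 + \theta_z - 1) \theta_\varepsilon + 4 \theta_2 + \theta_z + \Gamma^{2} (8 \theta_{1_+} (2 \theta_z + 1) + 8 \theta_2 (2 \theta_z + 1) + \theta_z (5 \theta_z + 4))) \beta_{11}^{2} + 16 \Gamma^{2} \theta_{1_+} (\theta_z (5 \theta_z + 4) + \theta_\varepsilon (5 \theta_z^{2} + 6 \theta_z + 1)) \beta_{11} + \theta_{1_+} (2 (20 \theta_z^{3} + 25 \theta_z^{2} + \theta_z + 4 \theta_2 (4 \theta_z + 3) - 4) \Gamma^{2} + 3 \theta_z^{2} + 8 \theta_2 - 4 \theta_z + 2 \theta_\varepsilon ((\theta_z + 1) (20 \theta_z^{2} + 15 \theta_z + 16 \theta_2 - 5) \Gamma^{2} + 6 \theta_z^{2} + 4 \theta_2 + 4 \theta_z - 2) - 1)) A_1^{8}\\ &\quad + 8 \Gamma ((2 (\theta_z + 1) (5 \theta_z^{2} + 3 \theta_z + 6 \theta_2 - 2) \theta_\varepsilon^{2} + 2 (5 \theta_z^{3} + 7 \theta_z^{2} + \theta_z + 4 \theta_2 (3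 \theta_z + 2) - 1) \theta_\varepsilon + 4 \theta_2 (3 \theta_z + 1) + \theta_z (4 \theta_z + 3)) \beta_{11}^{2} + \theta_{1_+} (6 \theta_z^{2} - 3 \theta_z + 6 \theta_\varepsilon (\theta_z^{2} - 1) - 5) \beta_{11} + \theta_{1_+} (5 \theta_z^{3} + \theta_z^{2} - 5 \theta_z + 4 \theta_2 (3 \theta_z + 2) + 2 \theta_\varepsilon (\theta_z + 1) (5 \theta_z^{2} + 3 \theta_z + 6 \theta_2 - 2) - 1)) A_1^{7}\\ &\quad + 4 (((\theta_z + 1) ((\theta_z + 1) (15 \theta_z^{2} + 10 \theta_z + 24 \theta_{1_+} + 24 \theta_2 - 5) \Gamma^{2} + 2 (2 \theta_z^{2} + \theta_z + 4 \theta_2 - 1)) \theta_\varepsilon^{2} + ((\theta_z + 1) (15 \theta_z^{3} + 25 \theta_z^{2} + 48 \theta_2 \theta_z + 9 \theta_z + 24 \theta_2 + 24 \theta_{1_+} (2 \theta_z + 1) - 1) \Gamma^{2} + 2 (2 \theta_z + 1) (\theta_z^{2} + \theta_z + 4 \theta_2)) \theta_\varepsilon + \theta_z (8 \theta_2 + 3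 \theta_z + 2) + 2 \Gamma^{2} (\theta_z (5 \theta_z^{2} + 8 \theta_z + 3) + 2 \theta_{1_+} (6 \theta_z^{2} + 6 \theta_z + 1) + 2 \theta_2 (6 \theta_z^{2} + 6 \theta_z + 1))) \beta_{11}^{2} + 8 \Gamma^{2} \theta_{1_+} (\theta_z + 1) (5 \theta_z^{2} + \theta_z + \theta_\varepsilon (5 \theta_z^{2} + 4 \theta_z - 1) - 1) \beta_{11} + \theta_{1_+} (\theta_z^{3} + 8 \theta_2 \theta_z + 2 \theta_z + 4 \theta_2 + \Gamma^{2} (\theta_z + 1) (15 \theta_z^{3} + 15 \theta_z^{2} + 24 \theta_2 \theta_z - \theta_z + 12 \theta_2 - 1) + \theta_\varepsilon (\theta_z + 1) ((\theta_z + 1) (15 \theta_z^{2} + 10 \theta_z + 24 \theta_2 - 5) \Gamma^{2} + 2 (2 \theta_z^{2} + \theta_z + 4 \theta_2 - 1)) + 3)) A_1^{6}\\ &\quad + 4 \Gamma (2 (\theta_\varepsilon^{2} (5 \theta_z^{2} + 4 \theta_z + 12 \theta_2 - 1) (\theta_z + 1)^{2} + \theta_\varepsilon ((5 \theta_z + 1)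 (\theta_z + 1)^{2} + 8 \theta_2 (3 \theta_z + 1)) (\theta_z + 1) + \theta_z (6 \theta_z^{2} + 9 \theta_z + 4 \theta_2 (3 \theta_z + 2) + 3)) \beta_{11}^{2} + 2 \theta_{1_+} (\theta_z + 1) (4 \theta_z^{2} - 7 \theta_z + 4 \theta_\varepsilon (\theta_z^{2} - \theta_z - 2) - 3) \beta_{11} + \theta_{1_+} (\theta_z + 1) (5 \theta_z^{3} + 3 \theta_z^{2} + 3 \theta_z + 8 \theta_2 (3 \theta_z + 1) + 2 \theta_\varepsilon (\theta_z + 1) (5 \theta_z^{2} + 4 \theta_z + 12 \theta_2 - 1) + 5)) A_1^{5}\\ &\quad + (4 (\theta_\varepsilon^{2} ((\theta_z + 1) (6 \theta_z^{2} + 7 \theta_z + 16 \theta_{1_+} + 16 \theta_2 + 1) \Gamma^{2} + (\theta_z + 1)^{2} + 4 \theta_2) (\theta_z + 1)^{2} + \theta_\varepsilon (\theta_z^{3} + 5 \theta_z^{2} + (8 \theta_2 + 5) \theta_z + 2 \Gamma^{2} (\theta_z + 1) (3 \theta_z^{3} + 9 \theta_z^{2} + 16 \theta_2 \theta_z + 7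 \theta_z + 4 \theta_2 + 4 \theta_{1_+} (4 \theta_z + 1) + 1) + 1) (\theta_z + 1) + \theta_z (2 (\theta_z + 1) (5 \theta_z^{2} + 7 \theta_z + \theta_{1_+} (8 \theta_z + 4) + \theta_2 (8 \theta_z + 4) + 2) \Gamma^{2} + 3 \theta_z^{2} + 4 (\theta_2 + 1) \theta_z + 1)) \beta_{11}^{2} + 16 \Gamma^{2} \theta_{1_+} (\theta_z + 1)^{2} (5 \theta_z^{2} - 2 \theta_z + \theta_\varepsilon (5 \theta_z^{2} + 2 \theta_z - 3) - 1) \beta_{11} + \theta_{1_+} (\theta_z + 1) (\theta_z^{3} + 7 \theta_z^{2} + 16 \theta_2 \theta_z + 15 \theta_z + 8 \Gamma^{2} (\theta_z + 1) (3 \theta_z^{3} + 4 \theta_z^{2} + 2 \theta_z + \theta_2 (8 \theta_z + 2) + 1) + 4 \theta_\varepsilon (\theta_z + 1) ((\theta_z + 1) (6 \theta_z^{2} + 7 \theta_z + 16 \theta_2 + 1) \Gamma^{2} + (\theta_z + 1)^{2} + 4 \theta_2) + 9)) A_1^{4}\\ &\quad + 4 \Gamma (\theta_z + 1) (2 E (4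 \theta_z^{2} + (4 \theta_2 + 5) \theta_z + \theta_\varepsilon (\theta_z + 1) (\theta_z^{2} + 3 \theta_z + 4 \theta_2 + 2) + 1) \beta_{11}^{2} + 2 \theta_{1_+} E (\theta_z^{2} - 2 \theta_z - 3) \beta_{11} + \theta_{1_+} (\theta_z + 1) (\theta_z^{3} + 5 \theta_z^{2} + (8 \theta_2 + 7) \theta_z + 2 \theta_\varepsilon (\theta_z + 1) (\theta_z^{2} + 3 \theta_z + 4 \theta_2 + 2) + 3)) A_1^{3}\\ &\quad + 4 (\theta_z + 1)^{2} (E ((5 \theta_z^{2} + (4 \theta_{1_+} + 4 \theta_2 + 6) \theta_z + 1) \Gamma^{2} + \theta_z + \theta_\varepsilon (\theta_z + 1) ((\theta_z^{2} + 4 \theta_z + 4 \theta_{1_+} + 4 \theta_2 + 3) \Gamma^{2} + 1)) \beta_{11}^{2} + 4 \Gamma^{2} \theta_{1_+} E (\theta_z^{2} - 1) \beta_{11} + \theta_{1_+} (\theta_z + 1) ((\theta_z^{3} + 4 \theta_z^{2} + 4 (\theta_2 + 1) \theta_z + 1) \Gamma^{2} + \theta_z + \theta_\varepsilon (\theta_z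 + 1) ((\theta_z^{2} + 4 \theta_z + 4 \theta_2 + 3) \Gamma^{2} + 1))) A_1^{2}\\ &\quad + 8 \Gamma (\theta_z + 1)^{3} E (E \beta_{11}^{2} + \theta_{1_+} (\theta_z + 1)) A_1 + 4 \Gamma^{2} (\theta_z + 1)^{4} E (E \beta_{11}^{2} + \theta_{1_+} (\theta_z + 1)) \end{aligned}$$ $$\begin{aligned} P_1&= 4 (\theta_\varepsilon + 1) \Gamma^{2} (\theta_\varepsilon \beta_{11}^{2} + \theta_{1_+}) A_1^{14}\\ &\quad + 4 \Gamma (2 \theta_\varepsilon (\theta_\varepsilon + 1) \beta_{11}^{2} + 2 \theta_\varepsilon \theta_{1_+} + \theta_{1_+}) A_1^{13}\\ &\quad + (4 \theta_\varepsilon ((6 \theta_z + 4) \Gamma^{2} + \theta_\varepsilon (6 \theta_z + 5) \Gamma^{2} + \theta_\varepsilon + 1) \beta_{11}^{2} + 16 (\theta_\varepsilon + 1) \Gamma^{2} \theta_{1_+} \beta_{11} + \theta_{1_+} (8 (3 \theta_z + 2) \Gamma^{2} + 4 \theta_\varepsilon ((6 \theta_z + 5) \Gamma^{2} + 1) + 1))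 A_1^{12}\\ &\quad + 4 \Gamma (2 \theta_\varepsilon (5 \theta_z + \theta_\varepsilon (5 \theta_z + 4) + 3) \beta_{11}^{2} + 2 (\theta_\varepsilon + 1) \theta_{1_+} \beta_{11} + \theta_{1_+} (5 \theta_z + 2 \theta_\varepsilon (5 \theta_z + 4) + 2)) A_1^{11}\\ &\quad + 4 ((((15 \theta_z^{2} + 24 \theta_z + 4 \theta_{1_+} + 4 \theta_2 + 9) \Gamma^{2} + 4 \theta_z + 3) \theta_\varepsilon^{2} + ((15 \theta_z^{2} + 18 \theta_z + 8 \theta_{1_+} + 8 \theta_2 + 5) \Gamma^{2} + 4 \theta_z + 2) \theta_\varepsilon + \Gamma^{2} (4 \theta_{1_+} + 4 \theta_2 - \theta_z)) \beta_{11}^{2} + 4 \Gamma^{2} \theta_{1_+} (5 \theta_z + \theta_\varepsilon (5 \theta_z + 4) + 3) \beta_{11} + \theta_{1_+} ((15 \theta_z^{2} + 19 \theta_z + 4 \theta_2 + 5) \Gamma^{2} + \theta_z + \theta_\varepsilon ((15 \theta_z^{2} + 24 \theta_z + 4 \theta_2 + 9) \Gamma^{2} + 4 \theta_z + 3))) A_1^{10}\\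 &\quad + 8 \Gamma (((10 \theta_z^{2} + 15 \theta_z + 4 \theta_2 + 5) \theta_\varepsilon^{2} + 2 (5 \theta_z^{2} + 5 \theta_z + 4 \theta_2 + 1) \theta_\varepsilon + 4 \theta_2 - \theta_z) \beta_{11}^{2} + \theta_{1_+} (4 \theta_z + \theta_\varepsilon (4 \theta_z + 2) + 1) \beta_{11} + \theta_{1_+} (5 \theta_z^{2} + 3 \theta_z + 4 \theta_2 + \theta_\varepsilon (10 \theta_z^{2} + 15 \theta_z + 4 \theta_2 + 5) - 1)) A_1^{9}\\ &\quad + 2 (2 (((\theta_z + 1) (20 \theta_z^{2} + 25 \theta_z + 16 \theta_{1_+} + 16 \theta_2 + 5) \Gamma^{2} + 6 \theta_z^{2} + 4 \theta_2 + 8 \theta_z + 2) \theta_\varepsilon^{2} + 2 ((4 \theta_{1_+} (4 \theta_z + 3) + 4 \theta_2 (4 \theta_z + 3) + 5 \theta_z (2 \theta_z^{2} + 3 \theta_z + 1)) \Gamma^{2} + 3 \theta_z^{2} + 4 \theta_2 + 2 \theta_z) \theta_\varepsilon + 4 \theta_2 - \theta_z + \Gamma^{2} (8 \theta_{1_+}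 (2 \theta_z + 1) + 8 \theta_2 (2 \theta_z + 1) - \theta_z (5 \theta_z + 4))) \beta_{11}^{2} + 8 \Gamma^{2} \theta_{1_+} (10 \theta_z^{2} + 12 \theta_z + 2 \theta_\varepsilon (5 \theta_z^{2} + 8 \theta_z + 3) + 3) \beta_{11} + \theta_{1_+} (40 \Gamma^{2} \theta_z^{3} + 70 \Gamma^{2} \theta_z^{2} + 3 \theta_z^{2} + 30 \Gamma^{2} \theta_z - 2 \theta_z + 8 \theta_2 ((4 \theta_z + 3) \Gamma^{2} + 1) + 2 \theta_\varepsilon ((\theta_z + 1) (20 \theta_z^{2} + 25 \theta_z + 16 \theta_2 + 5) \Gamma^{2} + 6 \theta_z^{2} + 4 \theta_2 + 8 \theta_z + 2) - 3)) A_1^{8}\\ &\quad + 8 \Gamma ((2 (\theta_z + 1) (6 \theta_2 + 5 \theta_z (\theta_z + 1)) \theta_\varepsilon^{2} + 2 (5 \theta_z^{3} + 5 \theta_z^{2} - \theta_z + 4 \theta_2 (3 \theta_z + 2) - 1) \theta_\varepsilon + 4 \theta_2 (3 \theta_z + 1) - \theta_z (4 \theta_z + 3)) \beta_{11}^{2}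 + \theta_{1_+} (6 (\theta_\varepsilon + 1) \theta_z^{2} + (6 \theta_\varepsilon + 3) \theta_z - 1) \beta_{11} + \theta_{1_+} ((\theta_z + 1) (5 (2 \theta_\varepsilon + 1) \theta_z^{2} + (10 \theta_\varepsilon - 3) \theta_z - 4) + 4 \theta_2 (3 \theta_z + 3 \theta_\varepsilon (\theta_z + 1) + 2))) A_1^{7}\\ &\quad + 4 (((\theta_z + 1) ((\theta_z + 1) (15 \theta_z^{2} + 10 \theta_z + 24 \theta_{1_+} + 24 \theta_2 - 5) \Gamma^{2} + 2 (2 \theta_z^{2} + \theta_z + 4 \theta_2 - 1)) \theta_\varepsilon^{2} + (4 \theta_z^{3} + 16 \theta_2 \theta_z - 6 \theta_z + 8 \theta_2 + \Gamma^{2} (\theta_z + 1) (24 \theta_{1_+} (2 \theta_z + 1) + 24 \theta_2 (2 \theta_z + 1) + 5 (3 \theta_z^{3} + \theta_z^{2} - 3 \theta_z - 1)) - 2) \theta_\varepsilon + \theta_z (8 \theta_2 - 3 \theta_z - 2) + 2 \Gamma^{2} (-\theta_z (5 \theta_z^{2} + 8 \theta_z + 3) + 2 \theta_{1_+} (6 \theta_z^{2}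 + 6 \theta_z + 1) + 2 \theta_2 (6 \theta_z^{2} + 6 \theta_z + 1))) \beta_{11}^{2} + 4 \Gamma^{2} \theta_{1_+} (\theta_z + 1) (10 \theta_z^{2} + 8 \theta_z + 2 \theta_\varepsilon (5 \theta_z^{2} + 7 \theta_z + 2) + 1) \beta_{11} + \theta_{1_+} (\theta_z^{3} - 3 \theta_z^{2} + 8 \theta_2 \theta_z - 6 \theta_z + 4 \theta_2 + \Gamma^{2} (\theta_z + 1) (15 \theta_z^{3} + 15 \theta_z^{2} + 24 \theta_2 \theta_z - 5 \theta_z + 12 \theta_2 - 5) + \theta_\varepsilon (\theta_z + 1) ((\theta_z + 1) (15 \theta_z^{2} + 10 \theta_z + 24 \theta_2 - 5) \Gamma^{2} + 2 (2 \theta_z^{2} + \theta_z + 4 \theta_2 - 1)) - 2)) A_1^{6}\\ &\quad + 4 \Gamma (2 (\theta_\varepsilon^{2} (5 \theta_z^{2} + 12 \theta_2 - 5) (\theta_z + 1)^{2} + \theta_\varepsilon (5 \theta_z^{3} - 5 \theta_z^{2} - 13 \theta_z + 8 \theta_2 (3 \theta_z + 1) - 3) (\theta_z + 1) + \theta_z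 (-6 \theta_z^{2} + 12 \theta_2 \theta_z - 9 \theta_z + 8 \theta_2 - 3)) \beta_{11}^{2} + 2 \theta_{1_+} (\theta_z + 1) (4 \theta_z^{2} - \theta_z + 2 \theta_\varepsilon (2 \theta_z^{2} + \theta_z - 1) - 1) \beta_{11} + \theta_{1_+} (\theta_z + 1) (5 \theta_z^{3} - 9 \theta_z^{2} - 21 \theta_z + 8 \theta_2 (3 \theta_z + 1) + 2 \theta_\varepsilon (\theta_z + 1) (5 \theta_z^{2} + 12 \theta_2 - 5) - 7)) A_1^{5}\\ &\quad + (4 (\theta_\varepsilon^{2} ((\theta_z + 1) (6 \theta_z^{2} - 3 \theta_z + 16 \theta_{1_+} + 16 \theta_2 - 9) \Gamma^{2} + \theta_z^{2} + 4 \theta_2 - 2 \theta_z - 3) (\theta_z + 1)^{2} + \theta_\varepsilon (\theta_z^{3} - 5 \theta_z^{2} + (8 \theta_2 - 7) \theta_z + 2 \Gamma^{2} (\theta_z + 1) (3 \theta_z^{3} - 6 \theta_z^{2} + 16 \theta_2 \theta_z - 11 \theta_z + 4 \theta_2 + 4 \theta_{1_+} (4 \theta_z + 1) - 2) - 1) (\theta_z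 + 1) + \theta_z (2 (\theta_z + 1) (-5 \theta_z^{2} + 8 \theta_2 \theta_z - 7 \theta_z + 4 \theta_2 + \theta_{1_+} (8 \theta_z + 4) - 2) \Gamma^{2} - 3 \theta_z^{2} + 4 (\theta_2 - 1) \theta_z - 1)) \beta_{11}^{2} + 16 \Gamma^{2} \theta_{1_+} (\theta_z + 1)^{2} (\theta_z (5 \theta_z + 2) + \theta_\varepsilon (5 \theta_z^{2} + 6 \theta_z + 1)) \beta_{11} + \theta_{1_+} (\theta_z + 1) (\theta_z^{3} - 13 \theta_z^{2} + 16 \theta_2 \theta_z - 17 \theta_z + 8 \Gamma^{2} (\theta_z + 1) (3 \theta_z^{3} - \theta_z^{2} - 6 \theta_z + \theta_2 (8 \theta_z + 2) - 2) + 4 \theta_\varepsilon (\theta_z + 1) ((\theta_z + 1) (6 \theta_z^{2} - 3 \theta_z + 16 \theta_2 - 9) \Gamma^{2} + \theta_z^{2} + 4 \theta_2 - 2 \theta_z - 3) - 3)) A_1^{4}\\ &\quad + 4 \Gamma (\theta_z + 1) (2 E (-4 \theta_z^{2} + (4 \theta_2 - 5) \theta_z + \theta_\varepsilon (\theta_z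 + 1) (\theta_z^{2} - 3 \theta_z + 4 \theta_2 - 4) - 1) \beta_{11}^{2} + 2 \theta_{1_+} E (\theta_z^{2} - 1) \beta_{11} + \theta_{1_+} (\theta_z + 1) (\theta_z^{3} - 8 \theta_z^{2} + (8 \theta_2 - 11) \theta_z + 2 \theta_\varepsilon (\theta_z + 1) (\theta_z^{2} - 3 \theta_z + 4 \theta_2 - 4) - 2)) A_1^{3}\\ &\quad + 4 (\theta_z + 1)^{2} (E ((-5 \theta_z^{2} + (4 \theta_{1_+} + 4 \theta_2 - 6) \theta_z - 1) \Gamma^{2} - \theta_z + \theta_\varepsilon (\theta_z + 1) (\Gamma^{2} (\theta_z^{2} - 4 \theta_z + 4 \theta_{1_+} + 4 \theta_2 - 5) - 1)) \beta_{11}^{2} + 4 \Gamma^{2} \theta_{1_+} \theta_z (\theta_z + 1) E \beta_{11} + \theta_{1_+} (\theta_z + 1) ((\theta_z^{3} - 4 \theta_z^{2} + 4 \theta_2 \theta_z - 6 \theta_z - 1) \Gamma^{2} - \theta_z + \theta_\varepsilon (\theta_z + 1) (\Gamma^{2} (\theta_z^{2} - 4 \theta_z + 4 \theta_2 - 5)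 - 1))) A_1^{2}\\ &\quad - 8 \Gamma (\theta_z + 1)^{3} E (E \beta_{11}^{2} + \theta_{1_+} (\theta_z + 1)) A_1 - 4 \Gamma^{2} (\theta_z + 1)^{4} E (E \beta_{11}^{2} + \theta_{1_+} (\theta_z + 1)) \end{aligned}$$ the system is $$\beta_{11}\neq 0,\qquad 0 < A_1,\qquad 0 < \theta_z,$$ $$0 < 16 \Gamma + 16 A_1 \beta_{11} / M - D F^{2} / (\beta_{11}^{2} Y^{2} R T^{2}),$$ $$0 = \beta_{11} - A_1 (8 Y - D^{2} F / (\beta_{11} R T)) / (Y^{2} (16 A_1 \beta_{11} / M - D F^{2} / (\beta_{11}^{2} Y^{2} R T^{2}) + 16 \Gamma)),$$ $$0 = P_1,$$ $$0 = -2 (\theta_{1_+} D^{2} K^{2} A_1^{4} + 16 \beta_{11}^{2} \theta_2 Y^{2} R^{2} T^{2} A_1^{2} + 4 \beta_{11}^{2} \theta_\varepsilon D^{2} R^{2} U^{2} A_1^{2} + 4 \beta_{11}^{2} \theta_z R^{2} K^{2} A_1^{2} + 4 \beta_{11}^{2} R^{2} W^{2} A_1^{2} + 4 \beta_{11}^{2}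 R^{2} X^{2}) + 4 D R X N + T K P_2,$$ and the closed forms are $$\Lambda_1=\frac{A_1}{1+A_1^2+\theta_z},\qquad \Lambda_{1_+}=\frac{A_1\beta_{11}}{A_1^2[\beta_{11}^2(\theta_\varepsilon+1)+\theta_{1_+}]+\beta_{11}^2(\theta_\varepsilon\theta_z+\theta_\varepsilon+\theta_z)+\theta_{1_+}(\theta_z+1)},$$ $$\Lambda_{21}=\frac{A_1 \{4 A_1^4 (\theta_\varepsilon+1) \Gamma+A_1^3 (4 \theta_\varepsilon+3)+4 A_1^2 \Gamma (\beta_{11} \theta_\varepsilon+\beta_{11}+2 \theta_\varepsilon \theta_z+2 \theta_\varepsilon+2 \theta_z+1)+A_1 [4 \theta_\varepsilon (\theta_z+1)+3 \theta_z-1]+4 \Gamma (\beta_{11}+\theta_z+1) (\theta_\varepsilon \theta_z+\theta_\varepsilon+\theta_z)\}}{2 \beta_{11} [A_1^2 (\theta_\varepsilon+1)+\theta_\varepsilon \theta_z+\theta_\varepsilon+\theta_z] [2 A_1^2 \Gamma+A_1+2 \Gamma (\theta_z+1)]},$$ $$\Lambda_{22}=\Lambda_1,\qquad A_{21}=\frac1{2\Lambda_{22}},\qquad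 \alpha_{22}=-\frac{1+A_1^2+\theta_z}2,$$ $$\beta_{21}=\frac{A_1(A_1^2+\theta_z+1)^2}{4[A_1^2(\theta_\varepsilon+1)+\theta_\varepsilon\theta_z+\theta_\varepsilon+\theta_z](A_1^2\Gamma+A_1+\Gamma\theta_z+\Gamma)},\qquad \beta_{22}=-\frac{\Lambda_{21}}{2(\Gamma+\Lambda_{22})},\qquad \beta_{23}=-\frac{2\Gamma+\Lambda_{21}}{2(\Gamma+\Lambda_{22})}.$$ (ii) The linear profile is a pure-strategy equilibrium if and only if $\sigma_z=0$, $(\Lambda_{21},\Lambda_{22},A_1,\beta_{11})$ solves the following system, and the remaining coefficients are given by the closed forms after it. With (letters redefined) $$\begin{aligned} D&= A_1^{2} + 1 \end{aligned}$$ $$\begin{aligned} g&= \Gamma + \Lambda_{22} \end{aligned}$$ $$\begin{aligned} Q&= A_1^{2} (4 (\theta_\varepsilon + 1) \Gamma + (4 \theta_\varepsilon + 3) \Lambda_{22}) + 4 \theta_\varepsilon g \end{aligned}$$ $$\begin{aligned} w&= 2 \Gamma (\Lambda_{21} - \Lambda_{22}) + \Lambda_{21} \Lambda_{22} \end{aligned}$$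 $$\begin{aligned} M&= A_1^{2} (\beta_{11}^{2} (\theta_\varepsilon + 1) + \theta_{1_+}) + \beta_{11}^{2} \theta_\varepsilon + \theta_{1_+} \end{aligned}$$ $$\begin{aligned} K&= \beta_{11} ((3 \theta_\varepsilon + 2) \Lambda_{21} \Lambda_{22} + 2 (\theta_\varepsilon + 1) \Gamma (\Lambda_{21} + \Lambda_{22})) A_1^{3}\\ &\quad - 2 (\theta_\varepsilon + 1) g A_1^{2} + \beta_{11} \theta_\varepsilon (3 \Lambda_{21} \Lambda_{22} + 2 \Gamma (\Lambda_{21} + \Lambda_{22})) A_1 - 2 \theta_\varepsilon g \end{aligned}$$ $$\begin{aligned} H&= \beta_{11} (4 (\theta_\varepsilon + 1) \Gamma + 2 \theta_\varepsilon \Lambda_{21} + \Lambda_{21}) A_1^{2} - A_1 + 2 \beta_{11} \theta_\varepsilon (2 \Gamma + \Lambda_{21}) \end{aligned}$$ $$\begin{aligned} N&= 2 \beta_{11} g K A_1^{3} + 2 \beta_{11} g K A_1 + 2 D^{2} \beta_{11} \theta_\varepsilon H \Lambda_{22} g + D^{2} \Lambda_{21} \Lambda_{22} Q \theta_{1_+}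 \end{aligned}$$ $$\begin{aligned} V&= 4 D^{2} \theta_\varepsilon (-H)^{2} \Lambda_{22}^{2} g^{2} + 4 A_1^{2} K^{2} g^{2} + 4 K^{2} g^{2} + 4 D^{2} \Lambda_{22}^{2} Q^{2} \theta_2 g^{2}\\ &\quad + D^{2} \Lambda_{21}^{2} \Lambda_{22}^{2} Q^{2} \theta_{1_+} \end{aligned}$$ $$\begin{aligned} J&= A_1^{3} (4 (\theta_\varepsilon + 1) \Gamma + (4 \theta_\varepsilon + 3) \Lambda_{22}) + 2 A_1^{2} \beta_{11} (\theta_\varepsilon + 1) w\\ &\quad + A_1 (4 \theta_\varepsilon g + \Lambda_{22}) + 2 \beta_{11} \theta_\varepsilon w \end{aligned}$$ the system is $$0 = 2 D g K (-N) + A_1 D \beta_{11} V + \Lambda_{21} (N^{2} - D M V),$$ $$0 = -4 D^{2} Q K M g^{2} - 2 A_1 D \beta_{11} Q (-N) g + N^{2} - D M V,$$ $$0 = A_1 - (-(2 A_1^{2} \beta_{11} (\theta_\varepsilon + 1) w + A_1 \Lambda_{22} + 2 \beta_{11} \theta_\varepsilon w) / (D \Lambda_{22} Q) - A_1 / (A_1^{2}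 \Lambda_{22} + \Lambda_{22}) + 2) / (4 (A_1 / D - J^{2} / (4 D^{2} \Lambda_{22} Q^{2}))),$$ $$0 = A_1 M (A_1^{3} \beta_{11} (\theta_\varepsilon + 1) (2 \Gamma + \Lambda_{21}) w - 2 A_1^{2} g (2 (\theta_\varepsilon + 1) \Gamma - (\theta_\varepsilon + 1) \Lambda_{21} + (4 \theta_\varepsilon + 3) \Lambda_{22}) + A_1 \beta_{11} \theta_\varepsilon (2 \Gamma + \Lambda_{21}) w - 2 \theta_\varepsilon g (2 \Gamma - \Lambda_{21} + 4 \Lambda_{22})) / ((A_1^{2} (\theta_\varepsilon + 1) + \theta_\varepsilon) Q (A_1^{2} (\beta_{11}^{2} (\theta_\varepsilon + 1) + \theta_{1_+}) (-(4 \Gamma (\Lambda_{21} - \Lambda_{22}) + \Lambda_{21}^{2})) + 4 A_1 \beta_{11} g - (\beta_{11}^{2} \theta_\varepsilon + \theta_{1_+}) (4 \Gamma (\Lambda_{21} - \Lambda_{22}) + \Lambda_{21}^{2}))) + \beta_{11},$$ $$0 < \Lambda_{22},$$ $$0 < A_1 / D - J^{2} / (4 D^{2} \Lambda_{22} Q^{2}),$$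 $$0 < 4 A_1 \beta_{11} / M - (2 \Gamma + \Lambda_{21})^{2} / g + 4 \Gamma,$$ and the closed forms are $$\Lambda_1=\frac{A_1}{1+A_1^2},\qquad \Lambda_{1_+}=\frac{A_1\beta_{11}}{A_1^2[\beta_{11}^2(\theta_\varepsilon+1)+\theta_{1_+}]+\beta_{11}^2\theta_\varepsilon+\theta_{1_+}},\qquad A_{21}=\frac1{2\Lambda_{22}},$$ $$\alpha_{22}=-\frac{2A_1^2\beta_{11}(\theta_\varepsilon+1)[2\Gamma(\Lambda_{21}-\Lambda_{22})+\Lambda_{21}\Lambda_{22}]+A_1\Lambda_{22}+2\beta_{11}\theta_\varepsilon[2\Gamma(\Lambda_{21}-\Lambda_{22})+\Lambda_{21}\Lambda_{22}]}{2\Lambda_{22}\{A_1^2[4(\theta_\varepsilon+1)\Gamma+(4\theta_\varepsilon+3)\Lambda_{22}]+4\theta_\varepsilon(\Gamma+\Lambda_{22})\}},$$ $$\beta_{21}=\frac{\frac{A_1^2\beta_{11}[2\Gamma(\Lambda_{21}-\Lambda_{22})+\Lambda_{21}\Lambda_{22}]}{2(\Gamma+\Lambda_{22})}+A_1}{A_1^2[4(\theta_\varepsilon+1)\Gamma+(4\theta_\varepsilon+3)\Lambda_{22}]+4\theta_\varepsilon(\Gamma+\Lambda_{22})},\qquad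 \beta_{22}=-\frac{\Lambda_{21}}{2(\Gamma+\Lambda_{22})},\qquad \beta_{23}=-\frac{2\Gamma+\Lambda_{21}}{2(\Gamma+\Lambda_{22})}.$$ -/

import Mathlib

open MeasureTheory ProbabilityTheory

/-! ### The market -/

/-- Exogenous parameters of the market with one high-frequency trader (HFT): prior mean `p₀` and
standard deviation `σv` of the asset value, standard deviations `σ₁`, `σ₁p`, `σ₂` of the noise
orders at the times `1`, `1₊`, `2`, standard deviation `σε` of the error of the HFT's signal, and the
HFT's inventory aversion `γ`. -/
structure MarketParams where
  p₀ : ℝ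
  σv : ℝ
  σ₁ : ℝ
  σ₁p : ℝ
  σ₂ : ℝ
  σε : ℝ
  γ : ℝ
  σv_pos : 0 < σv
  σ₁_pos : 0 < σ₁
  σ₁p_pos : 0 < σ₁p
  σ₂_pos : 0 < σ₂
  σε_nonneg : 0 ≤ σε
  γ_nonneg : 0 ≤ γ

namespace MarketParams

/-- Relative size of the time-`1₊` market. -/
noncomputable def θp (P : MarketParams) : ℝ := P.σ₁p ^ 2 / P.σ₁ ^ 2

/-- Relative size of the time-`2` market. -/
noncomputable def θ₂ (P : MarketParams) : ℝ := P.σ₂ ^ 2 / P.σ₁ ^ 2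

/-- Relative variance of the signal error. -/
noncomputable def θε (P : MarketParams) : ℝ := P.σε ^ 2 / P.σ₁ ^ 2

/-- Dimensionless inventory aversion. -/
noncomputable def Γ (P : MarketParams) : ℝ := P.γ / (P.σv / P.σ₁)

end MarketParams

/-- The primitive random variables: the asset value `v`, the randomisation `z` of the informed trader
(IT), the error `ε` of the HFT's signal, and the noise orders `u₁`, `u₁p`, `u₂` at the times
`1`, `1₊`, `2`. -/
structure Primitives (Ω : Type*) where
  v : Ω → ℝ
  z : Ω → ℝ
  ε : Ω → ℝ
  u₁ : Ω → ℝ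
  u₁p : Ω → ℝ
  u₂ : Ω → ℝ

/-- The primitives are independent and Gaussian with the prescribed means and variances, where the
randomisation `z` has standard deviation `σz ≥ 0`. -/
structure Primitives.IsMarket {Ω : Type*} [MeasurableSpace Ω] (X : Primitives Ω) (P : MarketParams)
    (σz : ℝ) (μ : Measure Ω) : Prop where
  σz_nonneg : 0 ≤ σz
  measurable_v : Measurable X.v
  measurable_z : Measurable X.z
  measurable_ε : Measurable X.ε
  measurable_u₁ : Measurable X.u₁
  measurable_u₁p : Measurable X.u₁p
  measurable_u₂ : Measurable X.u₂
  law_v : μ.map X.v = gaussianReal P.p₀ (P.σv ^ 2).toNNReal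
  law_z : μ.map X.z = gaussianReal 0 (σz ^ 2).toNNReal
  law_ε : μ.map X.ε = gaussianReal 0 (P.σε ^ 2).toNNReal
  law_u₁ : μ.map X.u₁ = gaussianReal 0 (P.σ₁ ^ 2).toNNReal
  law_u₁p : μ.map X.u₁p = gaussianReal 0 (P.σ₁p ^ 2).toNNReal
  law_u₂ : μ.map X.u₂ = gaussianReal 0 (P.σ₂ ^ 2).toNNReal
  indep : iIndepFun (fun k : Fin 6 => ![X.v, X.z, X.ε, X.u₁, X.u₁p, X.u₂] k) μ

/-! ### Strategies, order flows and profits -/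

/-- Strategies of the dealers (pricing rules `p₁ y₁`, `p₁p y₁ y₁₊`, `p₂ y₁ y₁₊ y₂`), of the IT
(`i₁ v z`, where `z` is her private randomisation, and `i₂ v i₁ y₁`) and of the HFT (`x₁ ĩ₁ y₁` and
`x₂ ĩ₁ y₁ y₁₊ x₁`, where `ĩ₁` is the signal and `x₁` the HFT's own earlier order). -/
structure StrategyProfile where
  p₁ : ℝ → ℝ
  p₁p : ℝ → ℝ → ℝ
  p₂ : ℝ → ℝ → ℝ → ℝ
  i₁ : ℝ → ℝ → ℝ
  i₂ : ℝ → ℝ → ℝ → ℝ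
  x₁ : ℝ → ℝ → ℝ
  x₂ : ℝ → ℝ → ℝ → ℝ → ℝ

/-- The σ-algebra generated by a real random variable. -/
abbrev infoOf {Ω : Type*} (f : Ω → ℝ) : MeasurableSpace Ω :=
  MeasurableSpace.comap f inferInstance

namespace Primitives

variable {Ω : Type*} (X : Primitives Ω)

/-- Order flow at time `1` when the IT submits `i₁`. -/
def y₁ (i₁ : Ω → ℝ) : Ω → ℝ := fun ω => i₁ ω + X.u₁ ω

/-- The HFT's signal when the IT submits `i₁`. -/
def signal (i₁ : Ω → ℝ) : Ω → ℝ := fun ω => i₁ ω + X.ε ω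

/-- Order flow at time `1₊` when the HFT submits `x₁`. -/
def y₁p (x₁ : Ω → ℝ) : Ω → ℝ := fun ω => x₁ ω + X.u₁p ω

/-- Order flow at time `2` when the IT submits `i₂` and the HFT submits `x₂`. -/
def y₂ (i₂ x₂ : Ω → ℝ) : Ω → ℝ := fun ω => i₂ ω + x₂ ω + X.u₂ ω

end Primitives

namespace StrategyProfile

variable {Ω : Type*} (s : StrategyProfile) (X : Primitives Ω)

/-- The IT's order at time `1` prescribed by the profile. -/
def orderI₁ : Ω → ℝ := fun ω => s.i₁ (X.v ω) (X.z ω)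

/-- The IT's order at time `2` prescribed by the profile after she submitted `i₁`. -/
def orderI₂ (i₁ : Ω → ℝ) : Ω → ℝ := fun ω => s.i₂ (X.v ω) (i₁ ω) (X.y₁ i₁ ω)

/-- The HFT's order at time `1₊` prescribed by the profile when the IT submitted `i₁`. -/
def orderX₁ (i₁ : Ω → ℝ) : Ω → ℝ := fun ω => s.x₁ (X.signal i₁ ω) (X.y₁ i₁ ω)

/-- The HFT's order at time `2` prescribed by the profile when the IT submitted `i₁` and the HFT
submitted `x₁`. -/
def orderX₂ (i₁ x₁ : Ω → ℝ) : Ω → ℝ := fun ω =>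
  s.x₂ (X.signal i₁ ω) (X.y₁ i₁ ω) (X.y₁p x₁ ω) (x₁ ω)

/-- Price at time `1`. -/
def price₁ (i₁ : Ω → ℝ) : Ω → ℝ := fun ω => s.p₁ (X.y₁ i₁ ω)

/-- Price at time `1₊`. -/
def price₁p (i₁ x₁ : Ω → ℝ) : Ω → ℝ := fun ω => s.p₁p (X.y₁ i₁ ω) (X.y₁p x₁ ω)

/-- Price at time `2`. -/
def price₂ (i₁ x₁ i₂ x₂ : Ω → ℝ) : Ω → ℝ := fun ω =>
  s.p₂ (X.y₁ i₁ ω) (X.y₁p x₁ ω) (X.y₂ i₂ x₂ ω)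

/-- The IT's first-stage profit from submitting `i₁`. -/
def profitIT₁ (i₁ : Ω → ℝ) : Ω → ℝ := fun ω => i₁ ω * (X.v ω - s.price₁ X i₁ ω)

/-- The IT's second-stage profit from submitting `i₁` and then `i₂`, the dealers and the HFT following
the profile. -/
def profitIT₂ (i₁ i₂ : Ω → ℝ) : Ω → ℝ := fun ω =>
  (X.v ω - s.price₂ X i₁ (s.orderX₁ X i₁) i₂ (s.orderX₂ X i₁ (s.orderX₁ X i₁)) ω) * i₂ ω

/-- The IT's total profit from submitting `i₁` and then following the profile. -/
def profitIT (i₁ : Ω → ℝ) : Ω → ℝ := fun ω =>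
  s.profitIT₁ X i₁ ω + s.profitIT₂ X i₁ (s.orderI₂ X i₁) ω

/-- The HFT's second-stage profit with inventory penalty from submitting `x₁` and then `x₂`, the
dealers and the IT following the profile. -/
def objectiveHFT₂ (γ : ℝ) (x₁ x₂ : Ω → ℝ) : Ω → ℝ := fun ω =>
  (X.v ω - s.price₂ X (s.orderI₁ X) x₁ (s.orderI₂ X (s.orderI₁ X)) x₂ ω) * x₂ ω
    - γ * (x₁ ω + x₂ ω) ^ 2

/-- The HFT's total profit with inventory penalty from submitting `x₁` and then following the
profile. -/
def objectiveHFT (γ : ℝ) (x₁ : Ω → ℝ) : Ω → ℝ := fun ω =>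
  (X.v ω - s.price₁p X (s.orderI₁ X) x₁ ω) * x₁ ω
    + s.objectiveHFT₂ X γ x₁ (s.orderX₂ X (s.orderI₁ X) x₁) ω

end StrategyProfile

/-! ### Equilibrium -/

/-- `x` is *the* (almost surely unique) maximiser of the conditional expected payoff
`E(payoff x' | info)` over all `info`-measurable strategies `x'` for which this expectation exists:
almost surely no such `x'` does better than `x`, and `x'` does equally well only where `x' = x`. -/
def IsArgmax {Ω : Type*} [MeasurableSpace Ω] (μ : Measure Ω) (info : MeasurableSpace Ω)
    (payoff : (Ω → ℝ) → Ω → ℝ) (x : Ω → ℝ) : Prop :=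
  AEStronglyMeasurable[info] x μ ∧ Integrable (payoff x) μ ∧
    ∀ x' : Ω → ℝ, Measurable[info] x' → Integrable (payoff x') μ →
      ∀ᵐ ω ∂μ, (μ[payoff x' | info]) ω ≤ (μ[payoff x | info]) ω ∧
        ((μ[payoff x' | info]) ω = (μ[payoff x | info]) ω → x' ω = x ω)

/-- The equilibrium conditions common to mixed- and pure-strategy equilibria.

* Dealers: prices are conditional expectations of `v` given the order flows observed so far.
* IT, second stage: whatever order `i₁` she submitted, her `i₂` is the maximiser of the second-stage
  expected profit given `(v, i₁, y₁)`.
* HFT, second stage: whatever order `x₁` the HFT submitted, its `x₂` is the maximiser of the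
  second-stage expected penalised profit given `(ĩ₁, y₁, y₁₊)`.
* HFT, first stage: `x₁` is the maximiser of the total expected penalised profit given `(ĩ₁, y₁)`. -/
structure IsContinuationEquilibrium {Ω : Type*} [MeasurableSpace Ω] (μ : Measure Ω)
    (X : Primitives Ω) (γ : ℝ) (s : StrategyProfile) : Prop where
  dealers₁ :
    letI i₁ := s.orderI₁ X
    μ[X.v | infoOf (X.y₁ i₁)] =ᵐ[μ] s.price₁ X i₁
  dealers₁p :
    letI i₁ := s.orderI₁ X
    letI x₁ := s.orderX₁ X i₁
    μ[X.v | infoOf (X.y₁ i₁) ⊔ infoOf (X.y₁p x₁)] =ᵐ[μ] s.price₁p X i₁ x₁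
  dealers₂ :
    letI i₁ := s.orderI₁ X
    letI i₂ := s.orderI₂ X i₁
    letI x₁ := s.orderX₁ X i₁
    letI x₂ := s.orderX₂ X i₁ x₁
    μ[X.v | infoOf (X.y₁ i₁) ⊔ infoOf (X.y₁p x₁) ⊔ infoOf (X.y₂ i₂ x₂)]
      =ᵐ[μ] s.price₂ X i₁ x₁ i₂ x₂
  integrable_IT : Integrable (s.profitIT₂ X (s.orderI₁ X) (s.orderI₂ X (s.orderI₁ X))) μ
  it₂ : ∀ i₁ : Ω → ℝ, Measurable[infoOf X.v ⊔ infoOf X.z] i₁ →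
    Integrable (s.profitIT₂ X i₁ (s.orderI₂ X i₁)) μ →
      IsArgmax μ (infoOf X.v ⊔ infoOf i₁ ⊔ infoOf (X.y₁ i₁)) (s.profitIT₂ X i₁) (s.orderI₂ X i₁)
  integrable_HFT :
    letI i₁ := s.orderI₁ X
    letI x₁ := s.orderX₁ X i₁
    Integrable (s.objectiveHFT₂ X γ x₁ (s.orderX₂ X i₁ x₁)) μ
  hft₂ :
    letI i₁ := s.orderI₁ X
    ∀ x₁ : Ω → ℝ, Measurable[infoOf (X.signal i₁) ⊔ infoOf (X.y₁ i₁)] x₁ →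
      Integrable (s.objectiveHFT₂ X γ x₁ (s.orderX₂ X i₁ x₁)) μ →
        IsArgmax μ (infoOf (X.signal i₁) ⊔ infoOf (X.y₁ i₁) ⊔ infoOf (X.y₁p x₁))
          (s.objectiveHFT₂ X γ x₁) (s.orderX₂ X i₁ x₁)
  hft₁ :
    letI i₁ := s.orderI₁ X
    IsArgmax μ (infoOf (X.signal i₁) ⊔ infoOf (X.y₁ i₁)) (s.objectiveHFT X γ) (s.orderX₁ X i₁)

/-- Mixed-strategy equilibrium: the IT genuinely randomises (`σz > 0`) and, given `v`, all pure
strategies `i₁ = i₁(v)` give her the same total expected profit. -/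
structure IsMixedEquilibrium {Ω : Type*} [MeasurableSpace Ω] (μ : Measure Ω)
    (X : Primitives Ω) (γ σz : ℝ) (s : StrategyProfile) : Prop
    extends IsContinuationEquilibrium μ X γ s where
  σz_pos : 0 < σz
  indifferent : ∀ i₁ i₁' : Ω → ℝ, Measurable[infoOf X.v] i₁ → Measurable[infoOf X.v] i₁' →
    Integrable (s.profitIT X i₁) μ → Integrable (s.profitIT X i₁') μ →
      μ[s.profitIT X i₁ | infoOf X.v] =ᵐ[μ] μ[s.profitIT X i₁' | infoOf X.v]

/-- Pure-strategy equilibrium: there is no randomisation (`σz = 0`) and the IT's `i₁` is the maximiser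
of her total expected profit given `v`, over all strategies `i₁ = i₁(v)`. -/
structure IsPureEquilibrium {Ω : Type*} [MeasurableSpace Ω] (μ : Measure Ω)
    (X : Primitives Ω) (γ σz : ℝ) (s : StrategyProfile) : Prop
    extends IsContinuationEquilibrium μ X γ s where
  σz_eq : σz = 0
  it₁ : IsArgmax μ (infoOf X.v) (s.profitIT X) (s.orderI₁ X)

/-! ### Linear strategies -/

/-- Coefficients of a linear strategy profile; `σz` is the standard deviation of the IT's
randomisation. -/
structure LinearCoeffs where
  lam₁ : ℝ
  lam₁p : ℝ
  lam₂₁ : ℝ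
  lam₂₂ : ℝ
  α₁ : ℝ
  σz : ℝ
  α₂₁ : ℝ
  α₂₂ : ℝ
  β₁₁ : ℝ
  β₂₁ : ℝ
  β₂₂ : ℝ
  β₂₃ : ℝ

namespace LinearCoeffs

variable (c : LinearCoeffs) (P : MarketParams)

/-- The regression coefficient `Cov(i₁, y₁) / Var(y₁)` of `i₁ = α₁ (v - p₀) + z` on `y₁ = i₁ + u₁`:
since these are jointly Gaussian with mean `0`, `E(i₁ | y₁) = c.m P * y₁`. -/
noncomputable def m : ℝ :=
  (c.α₁ ^ 2 * P.σv ^ 2 + c.σz ^ 2) / (c.α₁ ^ 2 * P.σv ^ 2 + c.σz ^ 2 + P.σ₁ ^ 2)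

/-- The linear strategy profile:
`p₁ = p₀ + λ₁ y₁`, `p₁₊ = p₁ + λ₁₊ y₁₊`, `p₂ = p₁ + λ₂₁ y₁₊ + λ₂₂ y₂`,
`i₁ = α₁ (v - p₀) + z`, `i₂ = α₂₁ (v - E(v | y₁)) + α₂₂ (i₁ - E(i₁ | y₁))`,
`x₁ = β₁₁ (ĩ₁ - E(ĩ₁ | y₁))`, `x₂ = β₂₁ (ĩ₁ - E(ĩ₁ | y₁)) + β₂₂ (y₁₊ - x₁) + β₂₃ x₁`,
where `E(v | y₁) = p₁` and `E(ĩ₁ | y₁) = E(i₁ | y₁) = m y₁`; note that `y₁₊ - x₁ = u₁₊`. -/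
noncomputable def profile : StrategyProfile where
  p₁ y₁ := P.p₀ + c.lam₁ * y₁
  p₁p y₁ y₁p := P.p₀ + c.lam₁ * y₁ + c.lam₁p * y₁p
  p₂ y₁ y₁p y₂ := P.p₀ + c.lam₁ * y₁ + c.lam₂₁ * y₁p + c.lam₂₂ * y₂
  i₁ v z := c.α₁ * (v - P.p₀) + z
  i₂ v i₁ y₁ := c.α₂₁ * (v - (P.p₀ + c.lam₁ * y₁)) + c.α₂₂ * (i₁ - c.m P * y₁)
  x₁ sig y₁ := c.β₁₁ * (sig - c.m P * y₁)
  x₂ sig y₁ y₁p x₁ := c.β₂₁ * (sig - c.m P * y₁) + c.β₂₂ * (y₁p - x₁) + c.β₂₃ * x₁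

/-! Dimensionless coefficients. -/

noncomputable def Λ₁ : ℝ := c.lam₁ / (P.σv / P.σ₁)
noncomputable def Λ₁p : ℝ := c.lam₁p / (P.σv / P.σ₁)
noncomputable def Λ₂₁ : ℝ := c.lam₂₁ / (P.σv / P.σ₁)
noncomputable def Λ₂₂ : ℝ := c.lam₂₂ / (P.σv / P.σ₁)
noncomputable def A₁ : ℝ := c.α₁ / (P.σ₁ / P.σv)
noncomputable def θz : ℝ := c.σz ^ 2 / P.σ₁ ^ 2
noncomputable def A₂₁ : ℝ := c.α₂₁ / (P.σ₁ / P.σv)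

end LinearCoeffs

/-! ### The explicit systems

In this part `θp`, `θ₂`, `θε`, `Γ` are the dimensionless market parameters, and `A`, `β` stand for
`A₁`, `β₁₁`. Factors that occur repeatedly are abbreviated by local definitions. -/


/-- Polynomial of degree 14 in `A` whose vanishing is the first polynomial equation of the
mixed-strategy system. -/
noncomputable def mixedPoly₁ (θp θ₂ θε Γ A θz β : ℝ) : ℝ :=
  let E : ℝ := θε * θz + θε + θz
  let t₁ : ℝ := (4 * (θε + 1) * Γ ^ 2 * (θε * β ^ 2 + θp) * A ^ 14 :)
  let t₂ : ℝ := (4 * Γ * (2 * θε * (θε + 1) * β ^ 2 + 2 * θε * θp + θp) * A ^ 13 :)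
  let t₃ : ℝ := ((4 * θε * ((6 * θz + 4) * Γ ^ 2 + θε * (6 * θz + 5) * Γ ^ 2 + θε + 1) * β ^ 2 + 16 * (θε +
    1) * Γ ^ 2 * θp * β + θp * (8 * (3 * θz + 2) * Γ ^ 2 + 4 * θε * ((6 * θz + 5) * Γ ^ 2 + 1) +
    1)) * A ^ 12 :)
  let t₄ : ℝ := (4 * Γ * (2 * θε * (5 * θz + θε * (5 * θz + 4) + 3) * β ^ 2 + 2 * (θε + 1) * θp * β + θp *
    (5 * θz + 2 * θε * (5 * θz + 4) + 2)) * A ^ 11 :)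
  let t₅ : ℝ := (4 * ((((15 * θz ^ 2 + 24 * θz + 4 * θp + 4 * θ₂ + 9) * Γ ^ 2 + 4 * θz + 3) * θε ^ 2 + ((15 *
    θz ^ 2 + 18 * θz + 8 * θp + 8 * θ₂ + 5) * Γ ^ 2 + 4 * θz + 2) * θε + Γ ^ 2 * (4 * θp + 4 *
    θ₂ - θz)) * β ^ 2 + 4 * Γ ^ 2 * θp * (5 * θz + θε * (5 * θz + 4) + 3) * β + θp * ((15 *
    θz ^ 2 + 19 * θz + 4 * θ₂ + 5) * Γ ^ 2 + θz + θε * ((15 * θz ^ 2 + 24 * θz + 4 * θ₂ + 9) *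
    Γ ^ 2 + 4 * θz + 3))) * A ^ 10 :)
  let t₆ : ℝ := (8 * Γ * (((10 * θz ^ 2 + 15 * θz + 4 * θ₂ + 5) * θε ^ 2 + 2 * (5 * θz ^ 2 + 5 * θz + 4 *
    θ₂ + 1) * θε + 4 * θ₂ - θz) * β ^ 2 + θp * (4 * θz + θε * (4 * θz + 2) + 1) * β + θp * (5 *
    θz ^ 2 + 3 * θz + 4 * θ₂ + θε * (10 * θz ^ 2 + 15 * θz + 4 * θ₂ + 5) - 1)) * A ^ 9 :)
  let t₇ : ℝ := (2 * (2 * (((θz + 1) * (20 * θz ^ 2 + 25 * θz + 16 * θp + 16 * θ₂ + 5) * Γ ^ 2 + 6 * θz ^ 2 +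
    4 * θ₂ + 8 * θz + 2) * θε ^ 2 + 2 * ((4 * θp * (4 * θz + 3) + 4 * θ₂ * (4 * θz + 3) + 5 *
    θz * (2 * θz ^ 2 + 3 * θz + 1)) * Γ ^ 2 + 3 * θz ^ 2 + 4 * θ₂ + 2 * θz) * θε + 4 * θ₂ -
    θz + Γ ^ 2 * (8 * θp * (2 * θz + 1) + 8 * θ₂ * (2 * θz + 1) - θz * (5 * θz + 4))) * β ^ 2 +
    8 * Γ ^ 2 * θp * (10 * θz ^ 2 + 12 * θz + 2 * θε * (5 * θz ^ 2 + 8 * θz + 3) + 3) * β +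
    θp * (40 * Γ ^ 2 * θz ^ 3 + 70 * Γ ^ 2 * θz ^ 2 + 3 * θz ^ 2 + 30 * Γ ^ 2 * θz - 2 * θz +
    8 * θ₂ * ((4 * θz + 3) * Γ ^ 2 + 1) + 2 * θε * ((θz + 1) * (20 * θz ^ 2 + 25 * θz + 16 *
    θ₂ + 5) * Γ ^ 2 + 6 * θz ^ 2 + 4 * θ₂ + 8 * θz + 2) - 3)) * A ^ 8 :)
  let t₈ : ℝ := (8 * Γ * ((2 * (θz + 1) * (6 * θ₂ + 5 * θz * (θz + 1)) * θε ^ 2 + 2 * (5 * θz ^ 3 + 5 * θz ^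
    2 - θz + 4 * θ₂ * (3 * θz + 2) - 1) * θε + 4 * θ₂ * (3 * θz + 1) - θz * (4 * θz + 3)) *
    β ^ 2 + θp * (6 * (θε + 1) * θz ^ 2 + (6 * θε + 3) * θz - 1) * β + θp * ((θz + 1) * (5 *
    (2 * θε + 1) * θz ^ 2 + (10 * θε - 3) * θz - 4) + 4 * θ₂ * (3 * θz + 3 * θε * (θz + 1) +
    2))) * A ^ 7 :)
  let t₉ : ℝ := (4 * (((θz + 1) * ((θz + 1) * (15 * θz ^ 2 + 10 * θz + 24 * θp + 24 * θ₂ - 5) * Γ ^ 2 + 2 *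
    (2 * θz ^ 2 + θz + 4 * θ₂ - 1)) * θε ^ 2 + (4 * θz ^ 3 + 16 * θ₂ * θz - 6 * θz + 8 * θ₂ +
    Γ ^ 2 * (θz + 1) * (24 * θp * (2 * θz + 1) + 24 * θ₂ * (2 * θz + 1) + 5 * (3 * θz ^ 3 + θz ^
    2 - 3 * θz - 1)) - 2) * θε + θz * (8 * θ₂ - 3 * θz - 2) + 2 * Γ ^ 2 * (-θz * (5 * θz ^ 2 +
    8 * θz + 3) + 2 * θp * (6 * θz ^ 2 + 6 * θz + 1) + 2 * θ₂ * (6 * θz ^ 2 + 6 * θz + 1))) *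
    β ^ 2 + 4 * Γ ^ 2 * θp * (θz + 1) * (10 * θz ^ 2 + 8 * θz + 2 * θε * (5 * θz ^ 2 + 7 *
    θz + 2) + 1) * β + θp * (θz ^ 3 - 3 * θz ^ 2 + 8 * θ₂ * θz - 6 * θz + 4 * θ₂ + Γ ^ 2 * (θz +
    1) * (15 * θz ^ 3 + 15 * θz ^ 2 + 24 * θ₂ * θz - 5 * θz + 12 * θ₂ - 5) + θε * (θz + 1) *
    ((θz + 1) * (15 * θz ^ 2 + 10 * θz + 24 * θ₂ - 5) * Γ ^ 2 + 2 * (2 * θz ^ 2 + θz + 4 * θ₂ -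
    1)) - 2)) * A ^ 6 :)
  let t₁₀ : ℝ := (4 * Γ * (2 * (θε ^ 2 * (5 * θz ^ 2 + 12 * θ₂ - 5) * (θz + 1) ^ 2 + θε * (5 * θz ^ 3 - 5 *
    θz ^ 2 - 13 * θz + 8 * θ₂ * (3 * θz + 1) - 3) * (θz + 1) + θz * (-6 * θz ^ 2 + 12 * θ₂ *
    θz - 9 * θz + 8 * θ₂ - 3)) * β ^ 2 + 2 * θp * (θz + 1) * (4 * θz ^ 2 - θz + 2 * θε * (2 *
    θz ^ 2 + θz - 1) - 1) * β + θp * (θz + 1) * (5 * θz ^ 3 - 9 * θz ^ 2 - 21 * θz + 8 * θ₂ *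
    (3 * θz + 1) + 2 * θε * (θz + 1) * (5 * θz ^ 2 + 12 * θ₂ - 5) - 7)) * A ^ 5 :)
  let t₁₁ : ℝ := ((4 * (θε ^ 2 * ((θz + 1) * (6 * θz ^ 2 - 3 * θz + 16 * θp + 16 * θ₂ - 9) * Γ ^ 2 + θz ^ 2 +
    4 * θ₂ - 2 * θz - 3) * (θz + 1) ^ 2 + θε * (θz ^ 3 - 5 * θz ^ 2 + (8 * θ₂ - 7) * θz + 2 *
    Γ ^ 2 * (θz + 1) * (3 * θz ^ 3 - 6 * θz ^ 2 + 16 * θ₂ * θz - 11 * θz + 4 * θ₂ + 4 * θp *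
    (4 * θz + 1) - 2) - 1) * (θz + 1) + θz * (2 * (θz + 1) * (-5 * θz ^ 2 + 8 * θ₂ * θz - 7 *
    θz + 4 * θ₂ + θp * (8 * θz + 4) - 2) * Γ ^ 2 - 3 * θz ^ 2 + 4 * (θ₂ - 1) * θz - 1)) * β ^
    2 + 16 * Γ ^ 2 * θp * (θz + 1) ^ 2 * (θz * (5 * θz + 2) + θε * (5 * θz ^ 2 + 6 * θz + 1)) *
    β + θp * (θz + 1) * (θz ^ 3 - 13 * θz ^ 2 + 16 * θ₂ * θz - 17 * θz + 8 * Γ ^ 2 * (θz +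
    1) * (3 * θz ^ 3 - θz ^ 2 - 6 * θz + θ₂ * (8 * θz + 2) - 2) + 4 * θε * (θz + 1) * ((θz +
    1) * (6 * θz ^ 2 - 3 * θz + 16 * θ₂ - 9) * Γ ^ 2 + θz ^ 2 + 4 * θ₂ - 2 * θz - 3) - 3)) * A ^
    4 :)
  let t₁₂ : ℝ := (4 * Γ * (θz + 1) * (2 * E * (-4 * θz ^ 2 + (4 * θ₂ - 5) * θz + θε * (θz + 1) * (θz ^ 2 - 3 *
    θz + 4 * θ₂ - 4) - 1) * β ^ 2 + 2 * θp * E * (θz ^ 2 - 1) * β + θp * (θz + 1) * (θz ^ 3 -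
    8 * θz ^ 2 + (8 * θ₂ - 11) * θz + 2 * θε * (θz + 1) * (θz ^ 2 - 3 * θz + 4 * θ₂ - 4) -
    2)) * A ^ 3 :)
  let t₁₃ : ℝ := (4 * (θz + 1) ^ 2 * (E * ((-5 * θz ^ 2 + (4 * θp + 4 * θ₂ - 6) * θz - 1) * Γ ^ 2 - θz + θε *
    (θz + 1) * (Γ ^ 2 * (θz ^ 2 - 4 * θz + 4 * θp + 4 * θ₂ - 5) - 1)) * β ^ 2 + 4 * Γ ^ 2 *
    θp * θz * (θz + 1) * E * β + θp * (θz + 1) * ((θz ^ 3 - 4 * θz ^ 2 + 4 * θ₂ * θz - 6 * θz -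
    1) * Γ ^ 2 - θz + θε * (θz + 1) * (Γ ^ 2 * (θz ^ 2 - 4 * θz + 4 * θ₂ - 5) - 1))) * A ^ 2 :)
  let t₁₄ : ℝ := (8 * Γ * (θz + 1) ^ 3 * E * (E * β ^ 2 + θp * (θz + 1)) * A :)
  let t₁₅ : ℝ := (4 * Γ ^ 2 * (θz + 1) ^ 4 * E * (E * β ^ 2 + θp * (θz + 1)) :)
  t₁ + t₂ + t₃ + t₄ + t₅ + t₆ + t₇ + t₈ + t₉ + t₁₀ + t₁₁ + t₁₂ + t₁₃ - t₁₄ - t₁₅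

/-- A polynomial factor of the second polynomial equation of the mixed-strategy system. -/
noncomputable def mixedN (θp θε Γ A θz β : ℝ) : ℝ :=
  let E : ℝ := θε * θz + θε + θz
  let t₁ : ℝ := (4 * β ^ 2 * (θε + 1) * Γ ^ 2 * A ^ 8 :)
  let t₂ : ℝ := (4 * (θε + 1) * Γ * ((θε + 2) * β ^ 2 + θp) * A ^ 7 :)
  let t₃ : ℝ := ((8 * (θε + 1) ^ 2 * Γ ^ 2 * β ^ 3 + 4 * (θε ^ 2 + 2 * (2 * θz * Γ ^ 2 + Γ ^ 2 + 1) * θε +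
    Γ ^ 2 + 4 * Γ ^ 2 * θz + 1) * β ^ 2 + (4 * θε + 3) * θp) * A ^ 6 :)
  let t₄ : ℝ := (4 * Γ * (2 * (θε + 1) ^ 2 * β ^ 3 + (3 * (θz + 1) * θε ^ 2 + (9 * θz + 4) * θε + 6 * θz) *
    β ^ 2 + (θε + 1) * θp * β + θp * (3 * θz + 3 * θε * (θz + 1) + 2)) * A ^ 5 :)
  let t₅ : ℝ := (2 * (4 * (θε + 1) * Γ ^ 2 * (3 * θz + 3 * θε * (θz + 1) + 1) * β ^ 3 + 2 * (2 * (θz + 1) *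
    θε ^ 2 + 6 * Γ ^ 2 * θz ^ 2 * θε + (6 * Γ ^ 2 + 4) * θz * θε + θε + 2 * θz + Γ ^ 2 * (6 *
    θz ^ 2 + 3 * θz - 1) - 1) * β ^ 2 + θp * (3 * θz + 4 * θε * (θz + 1) + 1)) * A ^ 4 :)
  let t₆ : ℝ := (4 * Γ * (4 * (θε + 1) * E * β ^ 3 + (6 * θz ^ 2 + 3 * θε ^ 2 * (θz + 1) ^ 2 + θε * (9 * θz ^
    2 + 8 * θz - 1) - 2) * β ^ 2 + θp * (2 * θz + 2 * θε * (θz + 1) + 1) * β + θp * (θz + 1) *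
    (3 * θz + 3 * θε * (θz + 1) + 1)) * A ^ 3 :)
  let t₇ : ℝ := ((8 * Γ ^ 2 * (3 * θε ^ 2 * (θz + 1) ^ 2 + θz * (3 * θz + 2) + θε * (6 * θz ^ 2 + 8 * θz +
    2)) * β ^ 3 + 4 * ((4 * θz ^ 3 + 3 * θz ^ 2 - 2 * θz - 1) * Γ ^ 2 + θε ^ 2 * (θz + 1) ^ 2 +
    (θz - 1) * θz + θε * (2 * θz ^ 2 + θz - 1) * (2 * (θz + 1) * Γ ^ 2 + 1)) * β ^ 2 + θp *
    (θz + 1) * (3 * θz + 4 * θε * (θz + 1) - 1)) * A ^ 2 :)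
  let t₈ : ℝ := (4 * Γ * E * (2 * E * β ^ 3 + (θz + 1) * (θz * θε + θε + 2 * θz - 2) * β ^ 2 + θp * (θz +
    1) * β + θp * (θz + 1) ^ 2) * A :)
  let t₉ : ℝ := (4 * β ^ 2 * Γ ^ 2 * (θz + 1) * E * (θz ^ 2 + 2 * β * E - 1) :)
  t₁ + t₂ + t₃ + t₄ + t₅ + t₆ + t₇ + t₈ + t₉

/-- Polynomial of degree 14 in `A`, a factor of the second polynomial equation of the
mixed-strategy system. -/
noncomputable def mixedP (θp θ₂ θε Γ A θz β : ℝ) : ℝ :=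
  let E : ℝ := θε * θz + θε + θz
  let t₁ : ℝ := (4 * (θε + 1) * Γ ^ 2 * (θε * β ^ 2 + θp) * A ^ 14 :)
  let t₂ : ℝ := (4 * Γ * (2 * θε * (θε + 1) * β ^ 2 + 2 * θε * θp + θp) * A ^ 13 :)
  let t₃ : ℝ := ((4 * θε * ((6 * θz + 2) * Γ ^ 2 + θε * (6 * θz + 3) * Γ ^ 2 + θε + 1) * β ^ 2 + 16 * (θε +
    1) * Γ ^ 2 * θp * β + θp * (8 * (3 * θz + 1) * Γ ^ 2 + 4 * θε * ((6 * θz + 3) * Γ ^ 2 + 1) +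
    1)) * A ^ 12 :)
  let t₄ : ℝ := (4 * Γ * (2 * θε * (5 * θz + θε * (5 * θz + 2) + 1) * β ^ 2 + 2 * (θε + 1) * θp * β + θp *
    (5 * θz + 2 * θε * (5 * θz + 2) - 1)) * A ^ 11 :)
  let t₅ : ℝ := (4 * ((((15 * θz ^ 2 + 16 * θz + 4 * θp + 4 * θ₂ + 1) * Γ ^ 2 + 4 * θz + 1) * θε ^ 2 + ((15 *
    θz ^ 2 + 12 * θz + 8 * θp + 8 * θ₂ - 1) * Γ ^ 2 + 4 * θz) * θε + Γ ^ 2 * (4 * θp + 4 *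
    θ₂ + θz)) * β ^ 2 + 4 * Γ ^ 2 * θp * (5 * θz + θε * (5 * θz + 3) + 2) * β + θp * ((15 * θz ^
    2 + 11 * θz + 4 * θ₂ - 1) * Γ ^ 2 + θε * (15 * θz ^ 2 + 16 * θz + 4 * θ₂ + 1) * Γ ^ 2 +
    θε + 4 * θε * θz + θz - 1)) * A ^ 10 :)
  let t₆ : ℝ := (8 * Γ * (((10 * θz ^ 2 + 9 * θz + 4 * θ₂ - 1) * θε ^ 2 + 2 * (5 * θz ^ 2 + 3 * θz + 4 * θ₂ -
    1) * θε + 4 * θ₂ + θz) * β ^ 2 + θp * (4 * (θε + 1) * θz - 1) * β + θp * (5 * θz ^ 2 -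
    θz + 4 * θ₂ + θε * (10 * θz ^ 2 + 9 * θz + 4 * θ₂ - 1) - 3)) * A ^ 9 :)
  let t₇ : ℝ := (2 * (2 * (((θz + 1) * (20 * θz ^ 2 + 15 * θz + 16 * θp + 16 * θ₂ - 5) * Γ ^ 2 + 6 * θz ^ 2 +
    4 * θ₂ + 4 * θz - 2) * θε ^ 2 + 2 * ((10 * θz ^ 3 + 15 * θz ^ 2 + 3 * θz + 4 * θp * (4 *
    θz + 3) + 4 * θ₂ * (4 * θz + 3) - 2) * Γ ^ 2 + 3 * θz ^ 2 + 4 * θ₂ + θz - 1) * θε + 4 * θ₂ +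
    θz + Γ ^ 2 * (8 * θp * (2 * θz + 1) + 8 * θ₂ * (2 * θz + 1) + θz * (5 * θz + 4))) * β ^
    2 + 16 * Γ ^ 2 * θp * (θz * (5 * θz + 4) + θε * (5 * θz ^ 2 + 6 * θz + 1)) * β + θp * (2 *
    (20 * θz ^ 3 + 25 * θz ^ 2 + θz + 4 * θ₂ * (4 * θz + 3) - 4) * Γ ^ 2 + 3 * θz ^ 2 + 8 * θ₂ -
    4 * θz + 2 * θε * ((θz + 1) * (20 * θz ^ 2 + 15 * θz + 16 * θ₂ - 5) * Γ ^ 2 + 6 * θz ^ 2 +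
    4 * θ₂ + 4 * θz - 2) - 1)) * A ^ 8 :)
  let t₈ : ℝ := (8 * Γ * ((2 * (θz + 1) * (5 * θz ^ 2 + 3 * θz + 6 * θ₂ - 2) * θε ^ 2 + 2 * (5 * θz ^ 3 + 7 *
    θz ^ 2 + θz + 4 * θ₂ * (3 * θz + 2) - 1) * θε + 4 * θ₂ * (3 * θz + 1) + θz * (4 * θz +
    3)) * β ^ 2 + θp * (6 * θz ^ 2 - 3 * θz + 6 * θε * (θz ^ 2 - 1) - 5) * β + θp * (5 * θz ^
    3 + θz ^ 2 - 5 * θz + 4 * θ₂ * (3 * θz + 2) + 2 * θε * (θz + 1) * (5 * θz ^ 2 + 3 * θz + 6 *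
    θ₂ - 2) - 1)) * A ^ 7 :)
  let t₉ : ℝ := (4 * (((θz + 1) * ((θz + 1) * (15 * θz ^ 2 + 10 * θz + 24 * θp + 24 * θ₂ - 5) * Γ ^ 2 + 2 *
    (2 * θz ^ 2 + θz + 4 * θ₂ - 1)) * θε ^ 2 + ((θz + 1) * (15 * θz ^ 3 + 25 * θz ^ 2 + 48 *
    θ₂ * θz + 9 * θz + 24 * θ₂ + 24 * θp * (2 * θz + 1) - 1) * Γ ^ 2 + 2 * (2 * θz + 1) * (θz ^
    2 + θz + 4 * θ₂)) * θε + θz * (8 * θ₂ + 3 * θz + 2) + 2 * Γ ^ 2 * (θz * (5 * θz ^ 2 + 8 *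
    θz + 3) + 2 * θp * (6 * θz ^ 2 + 6 * θz + 1) + 2 * θ₂ * (6 * θz ^ 2 + 6 * θz + 1))) * β ^
    2 + 8 * Γ ^ 2 * θp * (θz + 1) * (5 * θz ^ 2 + θz + θε * (5 * θz ^ 2 + 4 * θz - 1) - 1) *
    β + θp * (θz ^ 3 + 8 * θ₂ * θz + 2 * θz + 4 * θ₂ + Γ ^ 2 * (θz + 1) * (15 * θz ^ 3 + 15 *
    θz ^ 2 + 24 * θ₂ * θz - θz + 12 * θ₂ - 1) + θε * (θz + 1) * ((θz + 1) * (15 * θz ^ 2 + 10 *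
    θz + 24 * θ₂ - 5) * Γ ^ 2 + 2 * (2 * θz ^ 2 + θz + 4 * θ₂ - 1)) + 3)) * A ^ 6 :)
  let t₁₀ : ℝ := (4 * Γ * (2 * (θε ^ 2 * (5 * θz ^ 2 + 4 * θz + 12 * θ₂ - 1) * (θz + 1) ^ 2 + θε * ((5 * θz +
    1) * (θz + 1) ^ 2 + 8 * θ₂ * (3 * θz + 1)) * (θz + 1) + θz * (6 * θz ^ 2 + 9 * θz + 4 *
    θ₂ * (3 * θz + 2) + 3)) * β ^ 2 + 2 * θp * (θz + 1) * (4 * θz ^ 2 - 7 * θz + 4 * θε * (θz ^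
    2 - θz - 2) - 3) * β + θp * (θz + 1) * (5 * θz ^ 3 + 3 * θz ^ 2 + 3 * θz + 8 * θ₂ * (3 *
    θz + 1) + 2 * θε * (θz + 1) * (5 * θz ^ 2 + 4 * θz + 12 * θ₂ - 1) + 5)) * A ^ 5 :)
  let t₁₁ : ℝ := ((4 * (θε ^ 2 * ((θz + 1) * (6 * θz ^ 2 + 7 * θz + 16 * θp + 16 * θ₂ + 1) * Γ ^ 2 + (θz +
    1) ^ 2 + 4 * θ₂) * (θz + 1) ^ 2 + θε * (θz ^ 3 + 5 * θz ^ 2 + (8 * θ₂ + 5) * θz + 2 * Γ ^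
    2 * (θz + 1) * (3 * θz ^ 3 + 9 * θz ^ 2 + 16 * θ₂ * θz + 7 * θz + 4 * θ₂ + 4 * θp * (4 *
    θz + 1) + 1) + 1) * (θz + 1) + θz * (2 * (θz + 1) * (5 * θz ^ 2 + 7 * θz + θp * (8 * θz +
    4) + θ₂ * (8 * θz + 4) + 2) * Γ ^ 2 + 3 * θz ^ 2 + 4 * (θ₂ + 1) * θz + 1)) * β ^ 2 + 16 *
    Γ ^ 2 * θp * (θz + 1) ^ 2 * (5 * θz ^ 2 - 2 * θz + θε * (5 * θz ^ 2 + 2 * θz - 3) - 1) * β +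
    θp * (θz + 1) * (θz ^ 3 + 7 * θz ^ 2 + 16 * θ₂ * θz + 15 * θz + 8 * Γ ^ 2 * (θz + 1) *
    (3 * θz ^ 3 + 4 * θz ^ 2 + 2 * θz + θ₂ * (8 * θz + 2) + 1) + 4 * θε * (θz + 1) * ((θz + 1) *
    (6 * θz ^ 2 + 7 * θz + 16 * θ₂ + 1) * Γ ^ 2 + (θz + 1) ^ 2 + 4 * θ₂) + 9)) * A ^ 4 :)
  let t₁₂ : ℝ := (4 * Γ * (θz + 1) * (2 * E * (4 * θz ^ 2 + (4 * θ₂ + 5) * θz + θε * (θz + 1) * (θz ^ 2 + 3 *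
    θz + 4 * θ₂ + 2) + 1) * β ^ 2 + 2 * θp * E * (θz ^ 2 - 2 * θz - 3) * β + θp * (θz + 1) *
    (θz ^ 3 + 5 * θz ^ 2 + (8 * θ₂ + 7) * θz + 2 * θε * (θz + 1) * (θz ^ 2 + 3 * θz + 4 * θ₂ +
    2) + 3)) * A ^ 3 :)
  let t₁₃ : ℝ := (4 * (θz + 1) ^ 2 * (E * ((5 * θz ^ 2 + (4 * θp + 4 * θ₂ + 6) * θz + 1) * Γ ^ 2 + θz + θε *
    (θz + 1) * ((θz ^ 2 + 4 * θz + 4 * θp + 4 * θ₂ + 3) * Γ ^ 2 + 1)) * β ^ 2 + 4 * Γ ^ 2 * θp *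
    E * (θz ^ 2 - 1) * β + θp * (θz + 1) * ((θz ^ 3 + 4 * θz ^ 2 + 4 * (θ₂ + 1) * θz + 1) *
    Γ ^ 2 + θz + θε * (θz + 1) * ((θz ^ 2 + 4 * θz + 4 * θ₂ + 3) * Γ ^ 2 + 1))) * A ^ 2 :)
  let t₁₄ : ℝ := (8 * Γ * (θz + 1) ^ 3 * E * (E * β ^ 2 + θp * (θz + 1)) * A :)
  let t₁₅ : ℝ := (4 * Γ ^ 2 * (θz + 1) ^ 4 * E * (E * β ^ 2 + θp * (θz + 1)) :)
  t₁ + t₂ + t₃ + t₄ + t₅ + t₆ + t₇ + t₈ + t₉ + t₁₀ + t₁₁ + t₁₂ + t₁₃ + t₁₄ + t₁₅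

/-- The second polynomial equation of the mixed-strategy system is `mixedPoly₂ = 0`. -/
noncomputable def mixedPoly₂ (θp θ₂ θε Γ A θz β : ℝ) : ℝ :=
  let D : ℝ := (A ^ 2 + θz + 1 :)
  let E : ℝ := (θε * θz + θε + θz :)
  let Y : ℝ := (A ^ 2 * (θε + 1) + θε * θz + θε + θz :)
  let R : ℝ := (A ^ 2 * Γ + A + Γ * θz + Γ :)
  let T : ℝ := (2 * A ^ 2 * Γ + A + 2 * Γ * (θz + 1) :)
  let K : ℝ := (4 * (θε + 1) * Γ * A ^ 4 + (4 * θε + 3) * A ^ 3 + 4 * Γ * (θε * β + β + 2 * θε + 2 * θε *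
    θz + 2 * θz + 1) * A ^ 2 + (3 * θz + 4 * θε * (θz + 1) - 1) * A + 4 * Γ * (β + θz + 1) * E :)
  let U : ℝ := ((2 * θε + 1) * A ^ 3 + 4 * β * (θε + 1) * Γ * A ^ 2 + (θz + 2 * θε * (θz + 1) - 1) * A + 4 *
    β * Γ * E :)
  let W : ℝ := (2 * (θε + 1) * Γ * A ^ 6 + (3 * θε + 2) * A ^ 5 + 2 * Γ * (3 * θz * θε + θε + 2 * β * (θε +
    1) + 3 * θz) * A ^ 4 + 2 * (3 * θz * θε + θε + 2 * θz - 1) * A ^ 3 + 2 * Γ * (3 * θz ^ 2 +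
    4 * β * θz + θε * (3 * θz ^ 2 + 4 * β * θz + 2 * θz + 2 * β - 1) - 1) * A ^ 2 + (2 * (θz -
    1) * θz + θε * (3 * θz ^ 2 + 2 * θz - 1)) * A + 2 * Γ * E * (θz ^ 2 + 2 * β * θz - 1) :)
  let X : ℝ := (2 * (θε + 1) * Γ * A ^ 6 + (3 * θε + 2) * A ^ 5 + 2 * Γ * (θz * θε + θε + 2 * β * (θε + 1) +
    θz) * A ^ 4 + (θz + 2 * θε * (θz + 1) - 2) * A ^ 3 + 2 * Γ * (-θz ^ 2 + 2 * (β - 1) * θz +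
    θε * (2 * β - θz - 1) * (θz + 1) - 1) * A ^ 2 - (θz + 1) * E * A - 2 * Γ * (θz + 1) ^ 2 *
    E :)
  let N := mixedN θp θε Γ A θz β
  let P₂ := mixedP θp θ₂ θε Γ A θz β
  let t₁ : ℝ := (2 * (θp * D ^ 2 * K ^ 2 * A ^ 4 + 16 * β ^ 2 * θ₂ * Y ^ 2 * R ^ 2 * T ^ 2 * A ^ 2 + 4 * β ^
    2 * θε * D ^ 2 * R ^ 2 * U ^ 2 * A ^ 2 + 4 * β ^ 2 * θz * R ^ 2 * K ^ 2 * A ^ 2 + 4 * β ^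
    2 * R ^ 2 * W ^ 2 * A ^ 2 + 4 * β ^ 2 * R ^ 2 * X ^ 2) :)
  let t₂ : ℝ := (4 * D * R * X * N :)
  let t₃ : ℝ := (T * K * P₂ :)
  (-t₁) + t₂ + t₃

/-- The system of the mixed-strategy equilibrium in the unknowns `(A, θz, β) = (A₁, θ_z, β₁₁)`.
The system divides by `β₁₁`, so `β₁₁ ≠ 0` is part of it; all its other denominators are positive
when `A, θz > 0` and the first inequality holds. -/
noncomputable def MixedSystem (θp θ₂ θε Γ A θz β : ℝ) : Prop :=
  let D : ℝ := (A ^ 2 + θz + 1 :)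
  let E : ℝ := (θε * θz + θε + θz :)
  let Y : ℝ := (A ^ 2 * (θε + 1) + θε * θz + θε + θz :)
  let R : ℝ := (A ^ 2 * Γ + A + Γ * θz + Γ :)
  let T : ℝ := (2 * A ^ 2 * Γ + A + 2 * Γ * (θz + 1) :)
  let M : ℝ := (A ^ 2 * (β ^ 2 * (θε + 1) + θp) + β ^ 2 * E + θp * (θz + 1) :)
  let F : ℝ := (4 * A ^ 5 * (θε + 1) * Γ + A ^ 4 * (θε * (8 * β * Γ ^ 2 + 4) + 8 * β * Γ ^ 2 + 3) + 4 * A ^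
    3 * Γ * (2 * β * (θε + 1) + 2 * θε * (θz + 1) + 2 * θz + 1) + A ^ 2 * (4 * θε * (θz + 1) *
    (4 * β * Γ ^ 2 + 1) + 8 * β * Γ ^ 2 * (2 * θz + 1) + 3 * θz - 1) + 4 * A * Γ * (2 * β +
    θz + 1) * E + 8 * β * Γ ^ 2 * (θz + 1) * E :)
  β ≠ 0 ∧
  0 < 16 * Γ + 16 * A * β / M - D * F ^ 2 / (β ^ 2 * Y ^ 2 * R * T ^ 2) ∧
  0 < A ∧
  0 < θz ∧
  0 = β - A * (8 * Y - D ^ 2 * F / (β * R * T)) / (Y ^ 2 * (16 * A * β / M - D * F ^ 2 / (β ^ 2 *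
    Y ^ 2 * R * T ^ 2) + 16 * Γ)) ∧
  0 = mixedPoly₁ θp θ₂ θε Γ A θz β ∧
  0 = mixedPoly₂ θp θ₂ θε Γ A θz β

/-- The closed forms of the remaining (dimensionless) coefficients of the mixed-strategy equilibrium
in terms of `(A, θz, β) = (A₁, θ_z, β₁₁)`. -/
noncomputable def MixedClosedForms (θp θε Γ A θz β Λ₁ Λ₁p Λ₂₁ Λ₂₂ A₂₁ α₂₂ β₂₁ β₂₂ β₂₃ : ℝ) : Prop :=
  Λ₁ = A / (1 + A ^ 2 + θz) ∧
  Λ₁p = A * β / (A ^ 2 * (β ^ 2 * (θε + 1) + θp) + β ^ 2 * (θε * θz + θε + θz) +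
    θp * (θz + 1)) ∧
  Λ₂₁ = A * (4 * A ^ 4 * (θε + 1) * Γ + A ^ 3 * (4 * θε + 3) +
      4 * A ^ 2 * Γ * (β * θε + β + 2 * θε * θz + 2 * θε + 2 * θz + 1) +
      A * (4 * θε * (θz + 1) + 3 * θz - 1) + 4 * Γ * (β + θz + 1) * (θε * θz + θε + θz)) /
    (2 * β * (A ^ 2 * (θε + 1) + θε * θz + θε + θz) *
      (2 * A ^ 2 * Γ + A + 2 * Γ * (θz + 1))) ∧
  Λ₂₂ = Λ₁ ∧
  A₂₁ = 1 / (2 * Λ₂₂) ∧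
  α₂₂ = -((1 + A ^ 2 + θz) / 2) ∧
  β₂₁ = A * (A ^ 2 + θz + 1) ^ 2 /
    (4 * (A ^ 2 * (θε + 1) + θε * θz + θε + θz) * (A ^ 2 * Γ + A + Γ * θz + Γ)) ∧
  β₂₂ = -(Λ₂₁ / (2 * (Γ + Λ₂₂))) ∧
  β₂₃ = -((2 * Γ + Λ₂₁) / (2 * (Γ + Λ₂₂)))

/-- The system of the pure-strategy equilibrium in the unknowns
`(Λ₂₁, Λ₂₂, A, β) = (Λ₂₁, Λ₂₂, A₁, β₁₁)`: four equations and three inequalities. -/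
noncomputable def PureSystem (θp θ₂ θε Γ Λ₂₁ Λ₂₂ A β : ℝ) : Prop :=
  let D : ℝ := (A ^ 2 + 1 :)
  let g : ℝ := (Γ + Λ₂₂ :)
  let Q : ℝ := (A ^ 2 * (4 * (θε + 1) * Γ + (4 * θε + 3) * Λ₂₂) + 4 * θε * g :)
  let w : ℝ := (2 * Γ * (Λ₂₁ - Λ₂₂) + Λ₂₁ * Λ₂₂ :)
  let M : ℝ := (A ^ 2 * (β ^ 2 * (θε + 1) + θp) + β ^ 2 * θε + θp :)
  let K : ℝ := (β * ((3 * θε + 2) * Λ₂₁ * Λ₂₂ + 2 * (θε + 1) * Γ * (Λ₂₁ + Λ₂₂)) * A ^ 3 - 2 * (θε + 1) * g *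
    A ^ 2 + β * θε * (3 * Λ₂₁ * Λ₂₂ + 2 * Γ * (Λ₂₁ + Λ₂₂)) * A - 2 * θε * g :)
  let H : ℝ := (β * (4 * (θε + 1) * Γ + 2 * θε * Λ₂₁ + Λ₂₁) * A ^ 2 - A + 2 * β * θε * (2 * Γ + Λ₂₁) :)
  let N : ℝ := (2 * β * g * K * A ^ 3 + 2 * β * g * K * A + 2 * D ^ 2 * β * θε * H * Λ₂₂ * g + D ^ 2 * Λ₂₁ *
    Λ₂₂ * Q * θp :)
  let V : ℝ := (4 * D ^ 2 * θε * (-H) ^ 2 * Λ₂₂ ^ 2 * g ^ 2 + 4 * A ^ 2 * K ^ 2 * g ^ 2 + 4 * K ^ 2 * g ^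
    2 + 4 * D ^ 2 * Λ₂₂ ^ 2 * Q ^ 2 * θ₂ * g ^ 2 + D ^ 2 * Λ₂₁ ^ 2 * Λ₂₂ ^ 2 * Q ^ 2 * θp :)
  let J : ℝ := (A ^ 3 * (4 * (θε + 1) * Γ + (4 * θε + 3) * Λ₂₂) + 2 * A ^ 2 * β * (θε + 1) * w + A * (4 *
    θε * g + Λ₂₂) + 2 * β * θε * w :)
  0 = 2 * D * g * K * (-N) + A * D * β * V + Λ₂₁ * (N ^ 2 - D * M * V) ∧
  0 = -4 * D ^ 2 * Q * K * M * g ^ 2 - 2 * A * D * β * Q * (-N) * g + N ^ 2 - D * M * V ∧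
  0 = A - (-(2 * A ^ 2 * β * (θε + 1) * w + A * Λ₂₂ + 2 * β * θε * w) / (D * Λ₂₂ * Q) - A / (A ^
    2 * Λ₂₂ + Λ₂₂) + 2) / (4 * (A / D - J ^ 2 / (4 * D ^ 2 * Λ₂₂ * Q ^ 2))) ∧
  0 = A * M * (A ^ 3 * β * (θε + 1) * (2 * Γ + Λ₂₁) * w - 2 * A ^ 2 * g * (2 * (θε + 1) * Γ -
    (θε + 1) * Λ₂₁ + (4 * θε + 3) * Λ₂₂) + A * β * θε * (2 * Γ + Λ₂₁) * w - 2 * θε * g * (2 *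
    Γ - Λ₂₁ + 4 * Λ₂₂)) / ((A ^ 2 * (θε + 1) + θε) * Q * (A ^ 2 * (β ^ 2 * (θε + 1) + θp) *
    (-(4 * Γ * (Λ₂₁ - Λ₂₂) + Λ₂₁ ^ 2)) + 4 * A * β * g - (β ^ 2 * θε + θp) * (4 * Γ * (Λ₂₁ -
    Λ₂₂) + Λ₂₁ ^ 2))) + β ∧
  0 < Λ₂₂ ∧
  0 < A / D - J ^ 2 / (4 * D ^ 2 * Λ₂₂ * Q ^ 2) ∧
  0 < 4 * A * β / M - (2 * Γ + Λ₂₁) ^ 2 / g + 4 * Γ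

/-- The closed forms of the remaining (dimensionless) coefficients of the pure-strategy equilibrium
in terms of `(Λ₂₁, Λ₂₂, A, β) = (Λ₂₁, Λ₂₂, A₁, β₁₁)`. -/
noncomputable def PureClosedForms (θp θε Γ Λ₂₁ Λ₂₂ A β Λ₁ Λ₁p A₂₁ α₂₂ β₂₁ β₂₂ β₂₃ : ℝ) : Prop :=
  Λ₁ = A / (1 + A ^ 2) ∧
  Λ₁p = A * β / (A ^ 2 * (β ^ 2 * (θε + 1) + θp) + β ^ 2 * θε + θp) ∧
  A₂₁ = 1 / (2 * Λ₂₂) ∧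
  α₂₂ = -((2 * A ^ 2 * β * (θε + 1) * (2 * Γ * (Λ₂₁ - Λ₂₂) + Λ₂₁ * Λ₂₂) + A * Λ₂₂ +
      2 * β * θε * (2 * Γ * (Λ₂₁ - Λ₂₂) + Λ₂₁ * Λ₂₂)) /
    (2 * Λ₂₂ * (A ^ 2 * (4 * (θε + 1) * Γ + (4 * θε + 3) * Λ₂₂) + 4 * θε * (Γ + Λ₂₂)))) ∧
  β₂₁ = (A ^ 2 * β * (2 * Γ * (Λ₂₁ - Λ₂₂) + Λ₂₁ * Λ₂₂) / (2 * (Γ + Λ₂₂)) + A) /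
    (A ^ 2 * (4 * (θε + 1) * Γ + (4 * θε + 3) * Λ₂₂) + 4 * θε * (Γ + Λ₂₂)) ∧
  β₂₂ = -(Λ₂₁ / (2 * (Γ + Λ₂₂))) ∧
  β₂₃ = -((2 * Γ + Λ₂₁) / (2 * (Γ + Λ₂₂)))

/-! All primitives are independent Gaussians and the profile is linear. On the equilibrium path
every order flow and pricing error is therefore a linear functional of six centred Gaussians, and
every payoff is a quadratic polynomial in the trader's own order with constant leading coefficient
`-κ`. So each equilibrium condition, although it compares arbitrary measurable strategies, is
equivalent to finitely many relations between coefficients.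

For the dealers, uncorrelated jointly Gaussian functionals are independent (`condExp_lin`);
conversely, an affine conditional expectation forces the residual to be uncorrelated with the
conditioning functionals (`covLin_eq_zero_of_condExp`). Prices are thus conditional expectations
exactly when the normal equations of the regressions hold (`dealers_iff`). For the traders, a
quadratic payoff has an almost surely unique maximiser exactly when `κ > 0` and the conditional mean
of the slope vanishes (`isArgmax_of_quadratic`, `IsArgmax.quadratic`). The second-stage conditions,
required after every earlier order, are already forced by the single constant order `1`, and the
resulting coefficient identities suffice after all orders (`it₂_iff`, `hft₂_iff`).

Once the informed trader's second-stage optimum is inserted, her total profit is again quadratic in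
`i₁`, with curvature `λ₁ - λ₂₂ r²`, where `r` is the response of `i₂` to `i₁` (`profitIT_eq`). Given
`v` its slope is `(1 + r)(v - p₀)`. Indifference means that curvature and slope both vanish
(`indifferent_iff`); strict optimality means positive curvature and a first-order condition
(`it₁_iff`).

After a change of units only algebra remains. In the mixed case `r = -1`, hence `Λ₁ = Λ₂₂`, and the
net effect of the surprise order on the time-2 price is `A₁`. The second-stage conditions then give
all other coefficients in terms of `(A₁, θz, β₁₁)`, and the HFT's first-stage condition becomes the
first inequality and the equation for `β₁₁` (`mixed_hft_iff`). Two normal equations are left: `S =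
p₂ - p₁` must satisfy `Cov(y₁₊, S) = Cov(y₁₊, v)` and `Var S = Cov(v, S) = 1/2`. The two large
polynomials are nonzero multiples of two linear combinations of these residuals, whose determinant
is, up to sign, the Gram determinant of `y₁₊` and `S`. It is positive thanks to the time-2 noise
(`mixed_det_pos`), so both polynomials vanish iff both residuals do (`mixedPoly_eq_zero_iff`).
Division by `β₁₁` is legitimate by `mixed_beta_ne_zero`.

In the pure case the second-stage orders of the two traders depend on each other; this linear fixed
point is solved in `pure_beta₂₁_iff`. The system's first two equations are Cramer's rule for the
normal equations of `p₂` (`pure_dealers₂_iff`), with `K`, `N`, `V` being rescaled covariances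
(`pure_auxiliary`). -/

/-! ### Factored forms of the explicit polynomials -/

-- `K` and `q` are one quantity, expanded and factored. At the closed-form coefficients the
-- right-hand side is `-4βYRT · Cov(y₁₊, y₂)`.
set_option maxHeartbeats 4000000 in
theorem mixedN_eq (θp θε Γ A θz β : ℝ) {D E Y R T K M q : ℝ} (hD : D = A ^ 2 + θz + 1)
    (hE : E = θε * θz + θε + θz)
    (hY : Y = A ^ 2 * (θε + 1) + θε * θz + θε + θz) (hR : R = A ^ 2 * Γ + A + Γ * θz + Γ)
    (hT : T = 2 * A ^ 2 * Γ + A + 2 * Γ * (θz + 1))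
    (hK : K = 4 * (θε + 1) * Γ * A ^ 4 + (4 * θε + 3) * A ^ 3 + 4 * Γ * (θε * β + β + 2 * θε +
      2 * θε * θz + 2 * θz + 1) * A ^ 2 + (3 * θz + 4 * θε * (θz + 1) - 1) * A +
      4 * Γ * (β + θz + 1) * E)
    (hM : M = A ^ 2 * (β ^ 2 * (θε + 1) + θp) + β ^ 2 * E + θp * (θz + 1))
    (hq : q = 4 * Y * R - A * D + 4 * Γ * Y * β) :
    mixedN θp θε Γ A θz β =
      2 * R * K * M - 2 * β ^ 2 * Y * R * T * D * (1 + 2 * θε) - T * D * q * θp := by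
  subst hq hM hK hT hR hY hE hD
  simp only [mixedN]
  ring
-- At the closed-form coefficients this is `16R²YD³` times the Gram determinant of `y₁₊` and `p₂ -
-- p₁`.
set_option maxHeartbeats 4000000 in
theorem mixedP_eq (θp θ₂ θε Γ A θz β : ℝ) {D Y R M q : ℝ} (hD : D = A ^ 2 + θz + 1)
    (hY : Y = A ^ 2 * (θε + 1) + θε * θz + θε + θz) (hR : R = A ^ 2 * Γ + A + Γ * θz + Γ)
    (hM : M = β ^ 2 * Y + θp * D)
    (hq : q = 4 * Y * R - A * D + 4 * Γ * Y * β) :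
    mixedP θp θ₂ θε Γ A θz β =
      4 * R ^ 2 * Y * M * (D ^ 2 * (1 + A ^ 2 + 4 * A ^ 2 * θε) + 4 * A ^ 2 * θ₂) +
      D ^ 2 * A ^ 2 * q ^ 2 * θp - 4 * R ^ 2 * Y * D ^ 3 * β ^ 2 * A ^ 2 * (1 + 2 * θε) ^ 2 -
      4 * R * D ^ 3 * A ^ 2 * (1 + 2 * θε) * q * θp := by
  subst hq hM hR hY hD
  simp only [mixedP]
  ring
-- The bracket is the Gram determinant of `mixedP_eq`; the other terms subtract, with the same
-- scaling, the Cramer numerator for the coefficient of `p₂ - p₁` in the regression of the value on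
-- `y₁₊` and `p₂ - p₁`.
set_option maxHeartbeats 4000000 in
theorem mixedPoly₁_eq (θp θ₂ θε Γ A θz β : ℝ) {D Y R M q : ℝ} (hD : D = A ^ 2 + θz + 1)
    (hY : Y = A ^ 2 * (θε + 1) + θε * θz + θε + θz) (hR : R = A ^ 2 * Γ + A + Γ * θz + Γ)
    (hM : M = β ^ 2 * Y + θp * D)
    (hq : q = 4 * Y * R - A * D + 4 * Γ * Y * β) :
    mixedPoly₁ θp θ₂ θε Γ A θz β =
      (4 * R ^ 2 * Y * M * (D ^ 2 * (1 + A ^ 2 + 4 * A ^ 2 * θε) + 4 * A ^ 2 * θ₂) +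
      D ^ 2 * A ^ 2 * q ^ 2 * θp - 4 * R ^ 2 * Y * D ^ 3 * β ^ 2 * A ^ 2 * (1 + 2 * θε) ^ 2 -
      4 * R * D ^ 3 * A ^ 2 * (1 + 2 * θε) * q * θp) - 8 * R ^ 2 * Y * D ^ 2 * M +
      8 * R ^ 2 * Y * D ^ 2 * β ^ 2 * A ^ 2 * (1 + 2 * θε) + 4 * R * D ^ 2 * A ^ 2 * q * θp := by
  subst hq hM hR hY hD
  simp only [mixedPoly₁]
  ring

theorem mixedPoly₂_eq (θp θ₂ θε Γ A θz β : ℝ) {D E Y R T K : ℝ} (hD : D = A ^ 2 + θz + 1)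
    (hE : E = θε * θz + θε + θz)
    (hY : Y = A ^ 2 * (θε + 1) + θε * θz + θε + θz) (hR : R = A ^ 2 * Γ + A + Γ * θz + Γ)
    (hT : T = 2 * A ^ 2 * Γ + A + 2 * Γ * (θz + 1))
    (hK : K = 4 * (θε + 1) * Γ * A ^ 4 + (4 * θε + 3) * A ^ 3 + 4 * Γ * (θε * β + β + 2 * θε +
      2 * θε * θz + 2 * θz + 1) * A ^ 2 + (3 * θz + 4 * θε * (θz + 1) - 1) * A +
      4 * Γ * (β + θz + 1) * E) :
    mixedPoly₂ θp θ₂ θε Γ A θz β =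
      -(2 * (θp * D ^ 2 * K ^ 2 * A ^ 4 + 16 * β ^ 2 * θ₂ * Y ^ 2 * R ^ 2 * T ^ 2 * A ^ 2 +
        4 * β ^ 2 * θε * D ^ 2 * R ^ 2 * (2 * Y * T - K) ^ 2 * A ^ 2 +
        4 * β ^ 2 * θz * R ^ 2 * K ^ 2 * A ^ 2 +
        4 * β ^ 2 * R ^ 2 * (Y * T * D - (D - 1) * K) ^ 2 * A ^ 2 +
        4 * β ^ 2 * R ^ 2 * (A ^ 2 * K - Y * T * D) ^ 2)) +
      4 * D * R * (A ^ 2 * K - Y * T * D) * mixedN θp θε Γ A θz β +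
      T * K * mixedP θp θ₂ θε Γ A θz β := by
  -- At the closed-form coefficients, and up to sign, `y₂` has coefficient `K / (2YT)` on `z`, `D U
  -- / (2YT)` on `ε`, `W / (2YT)` on `u₁` and `X / (2AYT)` on `v`. The sum of squares in the
  -- statement is therefore `(4βYRTA)² Var(y₂)`. The next three identities express `U`, `W`, `X`
  -- through `K`.
  have hU : (2 * θε + 1) * A ^ 3 + 4 * β * (θε + 1) * Γ * A ^ 2 +
      (θz + 2 * θε * (θz + 1) - 1) * A + 4 * β * Γ * E = -(2 * Y * T - K) := by
    subst hK hT hR hY hE hD; ring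
  have hW : 2 * (θε + 1) * Γ * A ^ 6 + (3 * θε + 2) * A ^ 5 + 2 * Γ * (3 * θz * θε + θε + 2 * β * (θε +
    1) + 3 * θz) * A ^ 4 + 2 * (3 * θz * θε + θε + 2 * θz - 1) * A ^ 3 + 2 * Γ * (3 * θz ^ 2 +
    4 * β * θz + θε * (3 * θz ^ 2 + 4 * β * θz + 2 * θz + 2 * β - 1) - 1) * A ^ 2 + (2 * (θz -
    1) * θz + θε * (3 * θz ^ 2 + 2 * θz - 1)) * A + 2 * Γ * E * (θz ^ 2 + 2 * β * θz - 1) =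
      -(Y * T * D - (D - 1) * K) := by
    subst hK hT hR hY hE hD; ring
  have hX : 2 * (θε + 1) * Γ * A ^ 6 + (3 * θε + 2) * A ^ 5 + 2 * Γ * (θz * θε + θε + 2 * β * (θε + 1) +
    θz) * A ^ 4 + (θz + 2 * θε * (θz + 1) - 2) * A ^ 3 + 2 * Γ * (-θz ^ 2 + 2 * (β - 1) * θz +
    θε * (2 * β - θz - 1) * (θz + 1) - 1) * A ^ 2 - (θz + 1) * E * A - 2 * Γ * (θz + 1) ^ 2 *
    E = A ^ 2 * K - Y * T * D := by
    subst hK hT hR hY hE hD; ring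
  simp only [mixedPoly₂]
  rw [← hE, ← hD, ← hY, ← hR, ← hT, ← hK, hU, hW, hX]
  ring

/-! ### Conditional expectations of payoffs that are quadratic in a strategy -/

section Quadratic

variable {Ω : Type*} {m m₀ : MeasurableSpace Ω} {μ : Measure Ω} [IsProbabilityMeasure μ]

/-- Pull-out property for `f * ξ + g` where `f` and `g` are `m`-measurable, assuming only that the
sum and `ξ` are integrable. -/
theorem condExp_mul_add_of_stronglyMeasurable (hm : m ≤ m₀) {f g ξ : Ω → ℝ}
    (hf : StronglyMeasurable[m] f) (hg : StronglyMeasurable[m] g) (hξ : Integrable ξ μ)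
    (hfg : Integrable (fun ω => f ω * ξ ω + g ω) μ) :
    μ[fun ω => f ω * ξ ω + g ω | m] =ᵐ[μ] fun ω => f ω * (μ[ξ | m]) ω + g ω := by
  -- `f * ξ` and `g` need not be integrable separately, so the usual pull-out property does not
  -- apply directly. On `S n` both `f` and `g` are bounded, and these sets exhaust `Ω`.
  set S : ℕ → Set Ω := fun n => f ⁻¹' Set.Icc (-n) n ∩ g ⁻¹' Set.Icc (-n) n with hS
  have hSm : ∀ n, MeasurableSet[m] (S n) := fun n =>
    (hf.measurable measurableSet_Icc).inter (hg.measurable measurableSet_Icc)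
  have key : ∀ n, ∀ᵐ ω ∂μ, ω ∈ S n →
      (μ[fun ω => f ω * ξ ω + g ω | m]) ω = f ω * (μ[ξ | m]) ω + g ω := by
    intro n
    have hf' : StronglyMeasurable[m] ((S n).indicator f) := hf.indicator (hSm n)
    have hg' : StronglyMeasurable[m] ((S n).indicator g) := hg.indicator (hSm n)
    have hbf : ∀ ω, ‖(S n).indicator f ω‖ ≤ n := fun ω => by
      by_cases h : ω ∈ S n
      · simpa [h, abs_le] using h.1
      · simp [h]
    have hbg : ∀ ω, ‖(S n).indicator g ω‖ ≤ n := fun ω => by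
      by_cases h : ω ∈ S n
      · simpa [h, abs_le] using h.2
      · simp [h]
    have hint₁ : Integrable ((S n).indicator f * ξ) μ :=
      hξ.bdd_mul (hf'.mono hm).aestronglyMeasurable (Filter.Eventually.of_forall hbf)
    have hint₂ : Integrable ((S n).indicator g) μ :=
      Integrable.of_bound (hg'.mono hm).aestronglyMeasurable n (Filter.Eventually.of_forall hbg)
    have h₁ := condExp_indicator hfg (hSm n)
    have h₂ : (S n).indicator (fun ω => f ω * ξ ω + g ω) =
        (S n).indicator f * ξ + (S n).indicator g := by
      ext ω
      by_cases h : ω ∈ S n <;> simp [h]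
    rw [h₂] at h₁
    have h₃ := condExp_add hint₁ hint₂ m
    have h₄ := condExp_mul_of_stronglyMeasurable_left hf' hint₁ hξ
    have h₅ := condExp_of_stronglyMeasurable hm hg' hint₂
    filter_upwards [h₁, h₃, h₄] with ω h₁ h₃ h₄ hω
    rw [h₁, Pi.add_apply, h₄, h₅] at h₃
    simpa [hω] using h₃
  filter_upwards [ae_all_iff.2 key] with ω hω
  obtain ⟨n, hn⟩ := exists_nat_ge (max |f ω| |g ω|)
  exact hω n ⟨abs_le.1 ((le_max_left _ _).trans hn), abs_le.1 ((le_max_right _ _).trans hn)⟩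

theorem condExp_mul_add_of_aestronglyMeasurable (hm : m ≤ m₀) {f g ξ : Ω → ℝ}
    (hf : AEStronglyMeasurable[m] f μ) (hg : AEStronglyMeasurable[m] g μ) (hξ : Integrable ξ μ)
    (hfg : Integrable (fun ω => f ω * ξ ω + g ω) μ) :
    μ[fun ω => f ω * ξ ω + g ω | m] =ᵐ[μ] fun ω => f ω * (μ[ξ | m]) ω + g ω := by
  have hae : (fun ω => f ω * ξ ω + g ω) =ᵐ[μ] fun ω => hf.mk f ω * ξ ω + hg.mk g ω := by
    filter_upwards [hf.ae_eq_mk, hg.ae_eq_mk] with ω h₁ h₂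
    rw [h₁, h₂]
  have h := condExp_mul_add_of_stronglyMeasurable hm hf.stronglyMeasurable_mk
    hg.stronglyMeasurable_mk hξ (hfg.congr hae)
  filter_upwards [condExp_congr_ae (m := m) hae, h, hf.ae_eq_mk, hg.ae_eq_mk] with ω h₁ h₂ h₃ h₄
  rw [h₁, h₂, ← h₃, ← h₄]

/-- Conditional expectation of a payoff that is quadratic in the `m`-measurable strategy `x`. -/
theorem condExp_quadratic (hm : m ≤ m₀) {x ξ b C C' : Ω → ℝ} {κ : ℝ}
    (hx : AEStronglyMeasurable[m] x μ) (hb : AEStronglyMeasurable[m] b μ)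
    (hC' : AEStronglyMeasurable[m] C' μ) (hξ : Integrable ξ μ) (hC : Integrable C μ)
    (hint : Integrable (fun ω => x ω * (ξ ω + b ω) - κ * x ω ^ 2 + C' ω + C ω) μ) :
    μ[fun ω => x ω * (ξ ω + b ω) - κ * x ω ^ 2 + C' ω + C ω | m] =ᵐ[μ]
      fun ω => x ω * ((μ[ξ | m]) ω + b ω) - κ * x ω ^ 2 + C' ω + (μ[C | m]) ω := by
  have hg : AEStronglyMeasurable[m] (fun ω => x ω * b ω - κ * x ω ^ 2 + C' ω) μ :=
    ((hx.mul hb).sub ((hx.pow 2).const_mul κ)).add hC'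
  -- Everything measurable for the information is collected in one summand; only `ξ` and `C` are
  -- averaged.
  have heq : (fun ω => x ω * (ξ ω + b ω) - κ * x ω ^ 2 + C' ω + C ω) =
      (fun ω => x ω * ξ ω + (x ω * b ω - κ * x ω ^ 2 + C' ω)) + C := by
    ext ω; simp only [Pi.add_apply]; ring
  have hint' : Integrable (fun ω => x ω * ξ ω + (x ω * b ω - κ * x ω ^ 2 + C' ω)) μ := by
    rw [heq] at hint
    simpa using hint.sub hC
  rw [heq]
  filter_upwards [condExp_add hint' hC m,
    condExp_mul_add_of_aestronglyMeasurable hm hx hg hξ hint'] with ω h₁ h₂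
  rw [h₁, Pi.add_apply, h₂]
  ring

/-- Sufficient condition for a strategy to be the maximiser of a quadratic payoff. -/
theorem isArgmax_of_quadratic (hm : m ≤ m₀) {payoff : (Ω → ℝ) → Ω → ℝ} {x ξ b C C' : Ω → ℝ} {κ : ℝ}
    (hpay : ∀ x', payoff x' = fun ω => x' ω * (ξ ω + b ω) - κ * x' ω ^ 2 + C' ω + C ω)
    (hκ : 0 < κ) (hx : AEStronglyMeasurable[m] x μ) (hb : AEStronglyMeasurable[m] b μ)
    (hC' : AEStronglyMeasurable[m] C' μ) (hξ : Integrable ξ μ) (hC : Integrable C μ)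
    (hint : Integrable (payoff x) μ)
    (hfoc : ∀ᵐ ω ∂μ, (μ[ξ | m]) ω + b ω = 2 * κ * x ω) : IsArgmax μ m payoff x := by
  refine ⟨hx, hint, fun x' hx' hint' => ?_⟩
  rw [hpay] at hint hint'
  rw [hpay, hpay]
  filter_upwards [condExp_quadratic hm hx hb hC' hξ hC hint,
    condExp_quadratic hm hx'.stronglyMeasurable.aestronglyMeasurable hb hC' hξ hC hint',
    hfoc] with ω h₁ h₂ h₃
  rw [h₁, h₂, h₃]
  -- Completing the square: under the first-order condition the loss from deviating is `κ (x' -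
  -- x)²`, which yields both optimality and uniqueness.
  have h : x ω * (2 * κ * x ω) - κ * x ω ^ 2 + C' ω + (μ[C | m]) ω -
      (x' ω * (2 * κ * x ω) - κ * x' ω ^ 2 + C' ω + (μ[C | m]) ω) = κ * (x' ω - x ω) ^ 2 := by ring
  refine ⟨sub_nonneg.1 (h ▸ by positivity), fun h' => ?_⟩
  rw [h', sub_self, eq_comm, mul_eq_zero] at h
  exact sub_eq_zero.1 (pow_eq_zero_iff two_ne_zero |>.1 (h.resolve_left hκ.ne'))

/-- Necessary conditions (second and first order) for a strategy to be the maximiser of a quadratic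
payoff, obtained from constant deviations. -/
theorem IsArgmax.quadratic (hm : m ≤ m₀) {payoff : (Ω → ℝ) → Ω → ℝ} {x x₀ ξ : Ω → ℝ} {κ : ℝ}
    (h : IsArgmax μ m payoff x) (hx₀ : Measurable[m] x₀) (hxx₀ : x =ᵐ[μ] x₀)
    (hpay : ∀ t : ℝ, payoff (fun ω => x₀ ω + t) =ᵐ[μ]
      fun ω => payoff x ω + (t * (ξ ω - 2 * κ * x₀ ω) - κ * t ^ 2))
    (hx₀i : Integrable x₀ μ) (hξ : Integrable ξ μ) :
    0 < κ ∧ μ[ξ | m] =ᵐ[μ] fun ω => 2 * κ * x₀ ω := by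
  obtain ⟨-, hint, hmax⟩ := h
  have hi₁ : Integrable (fun ω => ξ ω - 2 * κ * x₀ ω) μ := hξ.sub (hx₀i.const_mul _)
  have hi₂ : ∀ t : ℝ, Integrable (fun ω => t * (ξ ω - 2 * κ * x₀ ω) - κ * t ^ 2) μ := fun t =>
    (hi₁.const_mul t).sub (integrable_const _)
  have hce : ∀ t : ℝ, μ[fun ω => t * (ξ ω - 2 * κ * x₀ ω) - κ * t ^ 2 | m] =ᵐ[μ]
      fun ω => t * ((μ[ξ | m]) ω - 2 * κ * x₀ ω) - κ * t ^ 2 := by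
    intro t
    have heq : (fun ω => t * (ξ ω - 2 * κ * x₀ ω) - κ * t ^ 2) =
        fun ω => t * ξ ω + (-(2 * t * κ) * x₀ ω - κ * t ^ 2) := by ext ω; ring
    have h' := hi₂ t
    rw [heq] at h' ⊢
    filter_upwards [condExp_mul_add_of_stronglyMeasurable hm (f := fun _ => t)
      (g := fun ω => -(2 * t * κ) * x₀ ω - κ * t ^ 2) stronglyMeasurable_const
      (((measurable_const.mul hx₀).sub measurable_const).stronglyMeasurable) hξ h'] with ω h
    rw [h]; ring
  -- Shifting the order by a nonzero constant changes the order everywhere, so the uniqueness clause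
  -- makes the loss strict.
  have key : ∀ t : ℝ, t ≠ 0 →
      ∀ᵐ ω ∂μ, t * ((μ[ξ | m]) ω - 2 * κ * x₀ ω) - κ * t ^ 2 < 0 := by
    intro t ht
    have hint' : Integrable (payoff (fun ω => x₀ ω + t)) μ :=
      (hint.add (hi₂ t)).congr (hpay t).symm
    filter_upwards [hmax (fun ω => x₀ ω + t) (hx₀.add measurable_const) hint', condExp_congr_ae (m := m) (hpay t),
      condExp_add hint (hi₂ t) m, hce t, hxx₀] with ω h₁ h₂ h₃ h₄ h₅
    have h₆ : (μ[payoff (fun ω => x₀ ω + t) | m]) ω = (μ[payoff x | m]) ω +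
        (t * ((μ[ξ | m]) ω - 2 * κ * x₀ ω) - κ * t ^ 2) := by
      rw [h₂, ← h₄]; exact h₃
    rw [h₆] at h₁
    refine lt_of_le_of_ne (by linarith [h₁.1]) fun h₇ => ht ?_
    have := h₁.2 (by rw [h₇, add_zero])
    rw [h₅] at this
    linarith
  -- Adding the inequalities for `t = 1` and `t = -1` cancels the slope.
  have hκ : 0 < κ := by
    obtain ⟨ω, h₁, h₂⟩ := ((key 1 one_ne_zero).and (key (-1) (by norm_num))).exists
    linarith
  refine ⟨hκ, ?_⟩
  -- Shifts by `±1/(n+1)` bound the slope by `κ/(n+1)`. A sequence of shifts keeps the exceptional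
  -- set null.
  have hall : ∀ᵐ ω ∂μ, ∀ n : ℕ, |(μ[ξ | m]) ω - 2 * κ * x₀ ω| ≤ κ * (1 / ((n : ℝ) + 1)) := by
    rw [ae_all_iff]
    intro n
    have hn : (0 : ℝ) < 1 / ((n : ℝ) + 1) := by positivity
    filter_upwards [key _ hn.ne', key _ (neg_ne_zero.2 hn.ne')] with ω h₁ h₂
    rw [abs_le]
    constructor <;> nlinarith
  filter_upwards [hall] with ω hω
  have hlim : Filter.Tendsto (fun n : ℕ => κ * (1 / ((n : ℝ) + 1))) Filter.atTop (nhds (κ * 0)) :=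
    tendsto_one_div_add_atTop_nhds_zero_nat.const_mul κ
  have := ge_of_tendsto' hlim hω
  rw [mul_zero] at this
  exact sub_eq_zero.1 (abs_nonpos_iff.1 this)

end Quadratic

/-! ### Linear functionals of the primitives -/

namespace Primitives

variable {Ω : Type*} (X : Primitives Ω)

/-- The centred primitives. -/
def noise (p₀ : ℝ) : Fin 6 → Ω → ℝ :=
  ![fun ω => X.v ω - p₀, X.z, X.ε, X.u₁, X.u₁p, X.u₂]

/-- A linear functional of the centred primitives. -/
def lin (p₀ : ℝ) (a : Fin 6 → ℝ) : Ω → ℝ := fun ω => ∑ k, a k * X.noise p₀ k ω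

theorem lin_apply (p₀ : ℝ) (a : Fin 6 → ℝ) (ω : Ω) :
    X.lin p₀ a ω = a 0 * (X.v ω - p₀) + a 1 * X.z ω + a 2 * X.ε ω + a 3 * X.u₁ ω +
      a 4 * X.u₁p ω + a 5 * X.u₂ ω := by
  simp [lin, Fin.sum_univ_six, noise]

end Primitives

/-- The standard deviations of the primitives. -/
def MarketParams.sd (P : MarketParams) (σz : ℝ) : Fin 6 → ℝ := ![P.σv, σz, P.σε, P.σ₁, P.σ₁p, P.σ₂]

/-- Covariance of two linear functionals of the primitives. -/
def MarketParams.covLin (P : MarketParams) (σz : ℝ) (a b : Fin 6 → ℝ) : ℝ :=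
  ∑ k, a k * b k * P.sd σz k ^ 2

theorem MarketParams.covLin_apply (P : MarketParams) (σz : ℝ) (a b : Fin 6 → ℝ) :
    P.covLin σz a b = a 0 * b 0 * P.σv ^ 2 + a 1 * b 1 * σz ^ 2 + a 2 * b 2 * P.σε ^ 2 +
      a 3 * b 3 * P.σ₁ ^ 2 + a 4 * b 4 * P.σ₁p ^ 2 + a 5 * b 5 * P.σ₂ ^ 2 := by
  simp [MarketParams.covLin, Fin.sum_univ_six, MarketParams.sd]

theorem measurable_infoOf {Ω : Type*} (f : Ω → ℝ) : Measurable[infoOf f] f := comap_measurable f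

theorem infoOf_le {Ω : Type*} {m : MeasurableSpace Ω} {f : Ω → ℝ} (hf : Measurable[m] f) :
    infoOf f ≤ m := Measurable.comap_le hf

theorem infoOf_eq_of_comp {Ω : Type*} {f g : Ω → ℝ} {φ ψ : ℝ → ℝ} (hφ : Measurable φ)
    (hψ : Measurable ψ) (hf : f = φ ∘ g) (hg : g = ψ ∘ f) : infoOf f = infoOf g := by
  apply le_antisymm
  · exact infoOf_le (by rw [hf]; exact hφ.comp (measurable_infoOf g))
  · exact infoOf_le (by rw [hg]; exact hψ.comp (measurable_infoOf f))

namespace Primitives.IsMarket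

variable {Ω : Type*} {m m₀ : MeasurableSpace Ω} {μ : Measure Ω}
  {P : MarketParams} {σz : ℝ} {X : Primitives Ω}


theorem measurable_noise (hX : X.IsMarket P σz μ) (k : Fin 6) : Measurable (X.noise P.p₀ k) := by
  fin_cases k
  · exact hX.measurable_v.sub_const _
  · exact hX.measurable_z
  · exact hX.measurable_ε
  · exact hX.measurable_u₁
  · exact hX.measurable_u₁p
  · exact hX.measurable_u₂

theorem map_noise (hX : X.IsMarket P σz μ) (k : Fin 6) :
    μ.map (X.noise P.p₀ k) = gaussianReal 0 (P.sd σz k ^ 2).toNNReal := by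
  fin_cases k
  · have h := gaussianReal_map_sub_const (μ := P.p₀) (v := (P.σv ^ 2).toNNReal) P.p₀
    rw [← hX.law_v, Measure.map_map (by fun_prop) hX.measurable_v, sub_self] at h
    exact h
  · exact hX.law_z
  · exact hX.law_ε
  · exact hX.law_u₁
  · exact hX.law_u₁p
  · exact hX.law_u₂

theorem iIndepFun_noise (hX : X.IsMarket P σz μ) : iIndepFun (X.noise P.p₀) μ := by
  have h := hX.indep.comp (fun k x => if k = 0 then x - P.p₀ else x) fun k => by
    by_cases hk : k = 0
    · simp only [hk, if_true]; fun_prop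
    · simp only [hk, if_false]; fun_prop
  convert h using 1
  ext k ω
  fin_cases k <;> simp [noise]

set_option linter.unusedSectionVars false

variable [IsProbabilityMeasure μ]

theorem hasGaussianLaw_noise (hX : X.IsMarket P σz μ) :
    HasGaussianLaw (fun ω k => X.noise P.p₀ k ω) μ :=
  hX.iIndepFun_noise.hasGaussianLaw fun k => ⟨by rw [hX.map_noise]; infer_instance⟩

theorem memLp_noise (hX : X.IsMarket P σz μ) (k : Fin 6) : MemLp (X.noise P.p₀ k) 2 μ :=
  (hX.hasGaussianLaw_noise.eval k).memLp_two

theorem integral_noise (hX : X.IsMarket P σz μ) (k : Fin 6) : ∫ ω, X.noise P.p₀ k ω ∂μ = 0 := by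
  have h := integral_map (hX.measurable_noise k).aemeasurable (f := fun x : ℝ => x) (μ := μ)
    (by fun_prop)
  rw [hX.map_noise, integral_id_gaussianReal] at h
  exact h.symm

theorem covariance_noise (hX : X.IsMarket P σz μ) (j k : Fin 6) :
    cov[X.noise P.p₀ j, X.noise P.p₀ k; μ] = if j = k then P.sd σz k ^ 2 else 0 := by
  split_ifs with h
  · subst h
    rw [covariance_self (hX.measurable_noise j).aemeasurable,
      ← variance_id_map (hX.measurable_noise j).aemeasurable, hX.map_noise,
      variance_id_gaussianReal, Real.coe_toNNReal _ (sq_nonneg _)]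
  · exact (hX.iIndepFun_noise.indepFun h).covariance_eq_zero (hX.memLp_noise j) (hX.memLp_noise k)

theorem measurable_lin (hX : X.IsMarket P σz μ) (a : Fin 6 → ℝ) : Measurable (X.lin P.p₀ a) :=
  Finset.measurable_fun_sum _ fun k _ => (hX.measurable_noise k).const_mul _

theorem memLp_lin (hX : X.IsMarket P σz μ) (a : Fin 6 → ℝ) : MemLp (X.lin P.p₀ a) 2 μ :=
  memLp_finsetSum _ fun k _ => (hX.memLp_noise k).const_mul _

theorem integrable_lin (hX : X.IsMarket P σz μ) (a : Fin 6 → ℝ) : Integrable (X.lin P.p₀ a) μ :=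
  (hX.memLp_lin a).integrable one_le_two

theorem integral_lin (hX : X.IsMarket P σz μ) (a : Fin 6 → ℝ) :
    ∫ ω, X.lin P.p₀ a ω ∂μ = 0 := by
  unfold Primitives.lin
  rw [integral_finsetSum _ fun k _ => ((hX.memLp_noise k).integrable one_le_two).const_mul _]
  simp [integral_const_mul, hX.integral_noise]

theorem covariance_lin (hX : X.IsMarket P σz μ) (a b : Fin 6 → ℝ) :
    cov[X.lin P.p₀ a, X.lin P.p₀ b; μ] = P.covLin σz a b := by
  unfold Primitives.lin
  rw [covariance_fun_sum_fun_sum (fun k => (hX.memLp_noise k).const_mul _)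
    (fun k => (hX.memLp_noise k).const_mul _)]
  simp only [covariance_const_mul_left, covariance_const_mul_right, hX.covariance_noise,
    mul_ite, mul_zero, Finset.sum_ite_eq, Finset.mem_univ, if_true, MarketParams.covLin]
  exact Finset.sum_congr rfl fun k _ => by ring

theorem integral_lin_mul_lin (hX : X.IsMarket P σz μ) (a b : Fin 6 → ℝ) :
    ∫ ω, X.lin P.p₀ a ω * X.lin P.p₀ b ω ∂μ = P.covLin σz a b := by
  have h := covariance_eq_sub (hX.memLp_lin a) (hX.memLp_lin b)
  rw [hX.covariance_lin, hX.integral_lin, zero_mul, sub_zero] at h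
  exact h.symm

/-- Linear functionals are independent of uncorrelated families of linear functionals. -/
theorem indepFun_lin (hX : X.IsMarket P σz μ) {n : ℕ} (r : Fin 6 → ℝ) (f : Fin n → Fin 6 → ℝ)
    (h : ∀ j, P.covLin σz r (f j) = 0) :
    IndepFun (X.lin P.p₀ r) (fun ω j => X.lin P.p₀ (f j) ω) μ := by
  -- The functional and the family are both images of the same Gaussian vector, hence jointly
  -- Gaussian; the single functional is viewed as a one-component vector so that the covariance
  -- criterion for pairs of Gaussian vectors applies.
  let L : (Fin 6 → ℝ) →L[ℝ] (Fin 1 → ℝ) × (Fin n → ℝ) :=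
    (ContinuousLinearMap.pi fun _ => ∑ k, r k • ContinuousLinearMap.proj k).prod
      (ContinuousLinearMap.pi fun j => ∑ k, f j k • ContinuousLinearMap.proj k)
  have hL := hX.hasGaussianLaw_noise.map_fun L
  have hG : HasGaussianLaw (fun ω => ((fun _ : Fin 1 => X.lin P.p₀ r ω),
      fun j => X.lin P.p₀ (f j) ω)) μ := by
    refine hL.congr (Filter.Eventually.of_forall fun ω => ?_)
    refine Prod.ext (funext fun i => ?_) (funext fun j => ?_) <;> simp [L, Primitives.lin]
  have := hG.indepFun_of_covariance_eval (X := fun _ : Fin 1 => X.lin P.p₀ r)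
    (Y := fun j => X.lin P.p₀ (f j)) fun _ j => by rw [hX.covariance_lin, h j]
  exact this.comp (φ := fun x : Fin 1 → ℝ => x 0) (ψ := id) (measurable_pi_apply 0) measurable_id

/-- Projection of a linear functional on the σ-algebra generated by linear functionals. -/
theorem condExp_lin (hX : X.IsMarket P σz μ) {n : ℕ} (a c : Fin 6 → ℝ)
    (f : Fin n → Fin 6 → ℝ) (hm : m ≤ ⨆ j, infoOf (X.lin P.p₀ (f j)))
    (hc : Measurable[m] (X.lin P.p₀ c)) (h : ∀ j, P.covLin σz (a - c) (f j) = 0) :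
    μ[X.lin P.p₀ a | m] =ᵐ[μ] X.lin P.p₀ c := by
  have hle : ⨆ j, infoOf (X.lin P.p₀ (f j)) ≤ m₀ :=
    iSup_le fun j => infoOf_le (hX.measurable_lin _)
  -- The residual is independent of the whole generated σ-algebra, hence of any `m` inside it. Thus
  -- `m` may be generated by nonlinear functions of the family, as happens after arbitrary
  -- deviations.
  have hind : Indep (infoOf (X.lin P.p₀ (a - c))) m μ := by
    refine indep_of_indep_of_le_right ((IndepFun_iff_Indep _ _ _).1 (hX.indepFun_lin _ f h)) ?_
    refine hm.trans (iSup_le fun j => infoOf_le ?_)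
    exact (measurable_pi_apply j).comp (comap_measurable fun ω j => X.lin P.p₀ (f j) ω)
  have h₀ := condExp_indep_eq (infoOf_le (hX.measurable_lin _)) (hm.trans hle)
    (measurable_infoOf _).stronglyMeasurable hind
  have hadd : X.lin P.p₀ a = X.lin P.p₀ (a - c) + X.lin P.p₀ c := by
    ext ω; simp only [Pi.add_apply, lin_apply, Pi.sub_apply]; ring
  have hc' := condExp_of_stronglyMeasurable (hm.trans hle) hc.stronglyMeasurable
    (hX.integrable_lin c)
  have hs := condExp_add (hX.integrable_lin (a - c)) (hX.integrable_lin c) m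
  rw [hadd]
  filter_upwards [h₀, hs] with ω h₀ hs
  rw [hs, Pi.add_apply, h₀, hc', hX.integral_lin, zero_add]

/-- If the conditional expectation of a linear functional is affine, then the residual has mean zero
and is uncorrelated with the measurable linear functionals. -/
theorem covLin_eq_zero_of_condExp (hX : X.IsMarket P σz μ)
    (hm : m ≤ m₀) (a c : Fin 6 → ℝ) (t : ℝ)
    (h : μ[X.lin P.p₀ a | m] =ᵐ[μ] fun ω => X.lin P.p₀ c ω + t) :
    t = 0 ∧ ∀ f, Measurable[m] (X.lin P.p₀ f) → P.covLin σz (a - c) f = 0 := by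
  -- Taking expectations: all the functionals are centred.
  have ht : t = 0 := by
    have h₁ := integral_congr_ae h
    rw [integral_condExp hm, integral_add (hX.integrable_lin c) (integrable_const _),
      hX.integral_lin, hX.integral_lin] at h₁
    simpa using h₁.symm
  refine ⟨ht, fun f hf => ?_⟩
  subst ht
  have hint : Integrable (X.lin P.p₀ f * X.lin P.p₀ a) μ :=
    (hX.memLp_lin f).integrable_mul (hX.memLp_lin a)
  have h₁ := condExp_mul_of_stronglyMeasurable_left hf.stronglyMeasurable hint (hX.integrable_lin a)
  -- The conditional expectation is tested against the `m`-measurable functional `f`.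
  have h₂ : ∫ ω, X.lin P.p₀ f ω * X.lin P.p₀ a ω ∂μ = ∫ ω, X.lin P.p₀ f ω * X.lin P.p₀ c ω ∂μ := by
    calc ∫ ω, X.lin P.p₀ f ω * X.lin P.p₀ a ω ∂μ
        = ∫ ω, (μ[X.lin P.p₀ f * X.lin P.p₀ a | m]) ω ∂μ := (integral_condExp hm).symm
      _ = _ := by
        refine integral_congr_ae ?_
        filter_upwards [h₁, h] with ω h₁ h
        rw [h₁, Pi.mul_apply, h, add_zero]
  rw [hX.integral_lin_mul_lin, hX.integral_lin_mul_lin] at h₂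
  rw [MarketParams.covLin_apply] at h₂ ⊢
  rw [MarketParams.covLin_apply] at h₂
  simp only [Pi.sub_apply]
  linarith

end Primitives.IsMarket

/-! ### Coefficient conditions -/

/-- The conditions on the coefficients of a linear profile expressing that prices are conditional
expectations, and the first- and second-order conditions of the second-stage problems and of the
problem of the HFT at the time `1₊`. Here `s, τ, e, n₁, n₁p, n₂` are the variances of the
primitives. -/
def ContinuationConditions (s τ e n₁ n₁p n₂ γ lam₁ lam₁p lam₂₁ lam₂₂ α α₂₁ α₂₂ β₁₁ β₂₁ β₂₂ β₂₃ : ℝ) :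
    Prop :=
  let w : ℝ := α ^ 2 * s + τ
  let m : ℝ := w / (w + n₁)
  let C : ℝ := α * s * (1 - m)
  let Vη : ℝ := w * (1 - m)
  let Vξ : ℝ := w * (1 - m) + e
  let Vν : ℝ := s * (1 - lam₁ * α)
  let b : ℝ := β₂₁ + β₂₃ * β₁₁
  let G₁₁ : ℝ := β₁₁ ^ 2 * Vξ + n₁p
  let G₁₂ : ℝ := β₁₁ * (α₂₁ * C + α₂₂ * Vη + b * Vξ) + β₂₂ * n₁p
  let G₂₂ : ℝ := α₂₁ ^ 2 * Vν + α₂₂ ^ 2 * Vη + 2 * α₂₁ * α₂₂ * C + b ^ 2 * Vξ +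
    2 * b * (α₂₁ * C + α₂₂ * Vη) + β₂₂ ^ 2 * n₁p + n₂
  let κ : ℝ := lam₁p + β₂₃ * lam₂₁ + lam₂₂ * β₂₃ ^ 2 + γ * (1 + β₂₃) ^ 2
  (lam₁ * (w + n₁) = α * s ∧ lam₁p * G₁₁ = β₁₁ * C ∧ lam₂₁ * G₁₁ + lam₂₂ * G₁₂ = β₁₁ * C ∧
    lam₂₁ * G₁₂ + lam₂₂ * G₂₂ = α₂₁ * Vν + (α₂₂ + b) * C) ∧
  (0 < lam₂₂ ∧ 2 * lam₂₂ * α₂₁ = 1 ∧ 2 * lam₂₂ * α₂₂ = -(lam₂₁ * β₁₁ + lam₂₂ * b)) ∧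
  (2 * (γ + lam₂₂) * β₂₁ * Vξ = C - lam₂₂ * (α₂₁ * C + α₂₂ * Vη) ∧
    2 * (γ + lam₂₂) * β₂₂ = -lam₂₁ ∧ 2 * (γ + lam₂₂) * β₂₃ = -(lam₂₁ + 2 * γ)) ∧
  (0 < κ ∧ (1 + β₂₃) * C - β₂₃ * lam₂₂ * (α₂₁ * C + α₂₂ * Vη) -
    (lam₂₁ + 2 * lam₂₂ * β₂₃ + 2 * γ * (1 + β₂₃)) * β₂₁ * Vξ = 2 * κ * β₁₁ * Vξ)

namespace LinearCoeffs

variable (c : LinearCoeffs) (P : MarketParams)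

/-- Coordinates refer to `v - p₀`, `z`, `ε`, `u₁`, `u₁₊`, `u₂`, in this order. -/
def vecV : Fin 6 → ℝ := ![1, 0, 0, 0, 0, 0]

def vecU₁p : Fin 6 → ℝ := ![0, 0, 0, 0, 1, 0]

def vecU₂ : Fin 6 → ℝ := ![0, 0, 0, 0, 0, 1]

def vecY₁ : Fin 6 → ℝ := ![c.α₁, 1, 0, 1, 0, 0]

def vecSignal : Fin 6 → ℝ := ![c.α₁, 1, 1, 0, 0, 0]

/-- The surprise in the HFT's signal, `ĩ₁ - m y₁`. -/
noncomputable def vecξ : Fin 6 → ℝ :=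
  ![c.α₁ * (1 - c.m P), 1 - c.m P, 1, -c.m P, 0, 0]

/-- The pricing error `v - p₁`. -/
noncomputable def vecν : Fin 6 → ℝ := ![1 - c.lam₁ * c.α₁, -c.lam₁, 0, -c.lam₁, 0, 0]

/-- The surprise in the informed order, `i₁ - m y₁`. -/
noncomputable def vecη : Fin 6 → ℝ := ![c.α₁ * (1 - c.m P), 1 - c.m P, 0, -c.m P, 0, 0]

noncomputable def vecI₂ : Fin 6 → ℝ := c.α₂₁ • c.vecν + c.α₂₂ • c.vecη P

noncomputable def vecY₁p : Fin 6 → ℝ := c.β₁₁ • c.vecξ P + vecU₁p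

/-- On the path `x₁` is `β₁₁` times the signal surprise, so that surprise enters `y₂` both directly
and through `x₁`. -/
noncomputable def vecY₂ : Fin 6 → ℝ :=
  c.vecI₂ P + (c.β₂₁ + c.β₂₃ * c.β₁₁) • c.vecξ P + c.β₂₂ • vecU₁p + vecU₂

theorem m_mul : c.m P * (c.α₁ ^ 2 * P.σv ^ 2 + c.σz ^ 2 + P.σ₁ ^ 2) =
    c.α₁ ^ 2 * P.σv ^ 2 + c.σz ^ 2 := by
  have := P.σ₁_pos
  rw [m, div_mul_cancel₀]
  positivity

theorem one_sub_m_pos : 0 < 1 - c.m P := by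
  have := P.σ₁_pos
  rw [m, sub_pos, div_lt_one (by positivity)]
  have : 0 < P.σ₁ ^ 2 := by positivity
  linarith

end LinearCoeffs

namespace MarketParams

variable (P : MarketParams) (σz : ℝ)

theorem covLin_add_left (a b c : Fin 6 → ℝ) :
    P.covLin σz (a + b) c = P.covLin σz a c + P.covLin σz b c := by
  simp only [covLin_apply, Pi.add_apply]; ring

theorem covLin_sub_left (a b c : Fin 6 → ℝ) :
    P.covLin σz (a - b) c = P.covLin σz a c - P.covLin σz b c := by
  simp only [covLin_apply, Pi.sub_apply]; ring

theorem covLin_smul_left (r : ℝ) (a c : Fin 6 → ℝ) :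
    P.covLin σz (r • a) c = r * P.covLin σz a c := by
  simp only [covLin_apply, Pi.smul_apply, smul_eq_mul]; ring

theorem covLin_comm (a b : Fin 6 → ℝ) : P.covLin σz a b = P.covLin σz b a := by
  simp only [covLin_apply]; ring

theorem covLin_add_right (a b c : Fin 6 → ℝ) :
    P.covLin σz a (b + c) = P.covLin σz a b + P.covLin σz a c := by
  simp only [covLin_apply, Pi.add_apply]; ring

theorem covLin_smul_right (r : ℝ) (a c : Fin 6 → ℝ) :
    P.covLin σz a (r • c) = r * P.covLin σz a c := by
  simp only [covLin_apply, Pi.smul_apply, smul_eq_mul]; ring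

end MarketParams

namespace Primitives

variable {Ω : Type*} (X : Primitives Ω) (p₀ : ℝ)

theorem lin_add (a b : Fin 6 → ℝ) (ω : Ω) : X.lin p₀ (a + b) ω = X.lin p₀ a ω + X.lin p₀ b ω := by
  simp only [lin_apply, Pi.add_apply]; ring

theorem lin_sub (a b : Fin 6 → ℝ) (ω : Ω) : X.lin p₀ (a - b) ω = X.lin p₀ a ω - X.lin p₀ b ω := by
  simp only [lin_apply, Pi.sub_apply]; ring

theorem lin_smul (r : ℝ) (a : Fin 6 → ℝ) (ω : Ω) : X.lin p₀ (r • a) ω = r * X.lin p₀ a ω := by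
  simp only [lin_apply, Pi.smul_apply, smul_eq_mul]; ring

end Primitives

/-! ### The orders prescribed by a linear profile -/

namespace LinearCoeffs

variable {Ω : Type*} (c : LinearCoeffs) (P : MarketParams) (X : Primitives Ω)

theorem v_eq (ω : Ω) : X.v ω = P.p₀ + X.lin P.p₀ vecV ω := by
  simp [Primitives.lin_apply, vecV]

theorem u₁p_eq : X.u₁p = X.lin P.p₀ vecU₁p := by
  ext ω; simp [Primitives.lin_apply, vecU₁p]

theorem orderI₁_eq : (c.profile P).orderI₁ X = X.lin P.p₀ ![c.α₁, 1, 0, 0, 0, 0] := by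
  ext ω; simp [StrategyProfile.orderI₁, profile, Primitives.lin_apply]

theorem y₁_eq : X.y₁ ((c.profile P).orderI₁ X) = X.lin P.p₀ c.vecY₁ := by
  ext ω
  simp [Primitives.y₁, StrategyProfile.orderI₁, profile, Primitives.lin_apply, vecY₁]

theorem signal_eq : X.signal ((c.profile P).orderI₁ X) = X.lin P.p₀ c.vecSignal := by
  ext ω
  simp [Primitives.signal, StrategyProfile.orderI₁, profile, Primitives.lin_apply, vecSignal]

theorem ξ_eq (ω : Ω) :
    X.lin P.p₀ (c.vecξ P) ω = X.lin P.p₀ c.vecSignal ω - c.m P * X.lin P.p₀ c.vecY₁ ω := by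
  simp [Primitives.lin_apply, vecξ, vecSignal, vecY₁]; ring

theorem ν_eq (ω : Ω) :
    X.lin P.p₀ c.vecν ω = X.lin P.p₀ vecV ω - c.lam₁ * X.lin P.p₀ c.vecY₁ ω := by
  simp [Primitives.lin_apply, vecν, vecV, vecY₁]; ring

theorem η_eq (ω : Ω) : X.lin P.p₀ (c.vecη P) ω =
    X.lin P.p₀ ![c.α₁, 1, 0, 0, 0, 0] ω - c.m P * X.lin P.p₀ c.vecY₁ ω := by
  simp [Primitives.lin_apply, vecη, vecY₁]; ring

theorem orderI₂_eq :
    (c.profile P).orderI₂ X ((c.profile P).orderI₁ X) = X.lin P.p₀ (c.vecI₂ P) := by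
  ext ω
  rw [vecI₂, Primitives.lin_add, Primitives.lin_smul, Primitives.lin_smul, ν_eq, η_eq]
  simp only [StrategyProfile.orderI₂, y₁_eq, v_eq P X]
  simp only [orderI₁_eq]
  simp only [profile]
  ring

theorem orderX₁_eq :
    (c.profile P).orderX₁ X ((c.profile P).orderI₁ X) = X.lin P.p₀ (c.β₁₁ • c.vecξ P) := by
  ext ω
  rw [Primitives.lin_smul, ξ_eq]
  simp only [StrategyProfile.orderX₁, y₁_eq, signal_eq]
  simp only [profile]

/-- The HFT's order at time `2` after an arbitrary order `x₁`. -/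
theorem orderX₂_eq (x₁ : Ω → ℝ) (ω : Ω) :
    (c.profile P).orderX₂ X ((c.profile P).orderI₁ X) x₁ ω =
      X.lin P.p₀ (c.β₂₁ • c.vecξ P + c.β₂₂ • vecU₁p) ω + c.β₂₃ * x₁ ω := by
  rw [Primitives.lin_add, Primitives.lin_smul, Primitives.lin_smul, ξ_eq]
  simp only [StrategyProfile.orderX₂, y₁_eq, signal_eq, Primitives.y₁p, u₁p_eq P X]
  simp only [profile]
  ring

theorem y₁p_eq : X.y₁p ((c.profile P).orderX₁ X ((c.profile P).orderI₁ X)) =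
    X.lin P.p₀ (c.vecY₁p P) := by
  ext ω
  rw [vecY₁p, Primitives.lin_add, orderX₁_eq, Primitives.y₁p, u₁p_eq P X]

theorem y₂_eq : X.y₂ ((c.profile P).orderI₂ X ((c.profile P).orderI₁ X))
    ((c.profile P).orderX₂ X ((c.profile P).orderI₁ X)
      ((c.profile P).orderX₁ X ((c.profile P).orderI₁ X))) = X.lin P.p₀ (c.vecY₂ P) := by
  ext ω
  have hu : X.lin P.p₀ vecU₂ ω = X.u₂ ω := by simp [Primitives.lin_apply, vecU₂]
  simp only [Primitives.y₂, orderX₂_eq, orderI₂_eq, orderX₁_eq, vecY₂, Primitives.lin_add,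
    Primitives.lin_smul, hu]
  ring

/-- The HFT's second-stage payoff is quadratic in its order. -/
theorem objectiveHFT₂_eq (x₁ x : Ω → ℝ) : (c.profile P).objectiveHFT₂ X P.γ x₁ x = fun ω =>
    x ω * (X.lin P.p₀ (c.vecν - c.lam₂₁ • vecU₁p - c.lam₂₂ • c.vecI₂ P -
      c.lam₂₂ • vecU₂) ω + -(c.lam₂₁ + 2 * P.γ) * x₁ ω) -
      (P.γ + c.lam₂₂) * x ω ^ 2 + -P.γ * x₁ ω ^ 2 + 0 := by
  ext ω
  have hu : X.lin P.p₀ vecU₂ ω = X.u₂ ω := by simp [Primitives.lin_apply, vecU₂]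
  simp only [StrategyProfile.objectiveHFT₂, StrategyProfile.price₂, y₁_eq, orderI₂_eq,
    Primitives.y₂, Primitives.y₁p, Primitives.lin_sub, Primitives.lin_smul, hu, ν_eq,
    v_eq P X ω, u₁p_eq P X]
  simp only [profile]
  ring

/-- The HFT's total payoff is quadratic in its order at time `1₊`. -/
theorem objectiveHFT_eq (x : Ω → ℝ) : (c.profile P).objectiveHFT X P.γ x = fun ω =>
    x ω * (X.lin P.p₀ ((1 + c.β₂₃) • c.vecν - (c.lam₁p + c.β₂₃ * c.lam₂₁) • vecU₁p -
      (c.β₂₃ * c.lam₂₂) • (c.vecI₂ P + vecU₂) -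
      (c.lam₂₁ + 2 * c.lam₂₂ * c.β₂₃ + 2 * P.γ * (1 + c.β₂₃)) •
        (c.β₂₁ • c.vecξ P + c.β₂₂ • vecU₁p)) ω + 0) -
      (c.lam₁p + c.β₂₃ * c.lam₂₁ + c.lam₂₂ * c.β₂₃ ^ 2 + P.γ * (1 + c.β₂₃) ^ 2) * x ω ^ 2 + 0 +
      X.lin P.p₀ (c.vecν - c.lam₂₁ • vecU₁p - c.lam₂₂ • c.vecI₂ P -
        c.lam₂₂ • vecU₂ - (P.γ + c.lam₂₂) • (c.β₂₁ • c.vecξ P + c.β₂₂ • vecU₁p)) ω *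
      X.lin P.p₀ (c.β₂₁ • c.vecξ P + c.β₂₂ • vecU₁p) ω := by
  ext ω
  simp only [StrategyProfile.objectiveHFT, objectiveHFT₂_eq, orderX₂_eq, StrategyProfile.price₁p,
    y₁_eq, Primitives.y₁p, v_eq P X ω, u₁p_eq P X]
  simp only [profile, Primitives.lin_add, Primitives.lin_sub, Primitives.lin_smul, ν_eq]
  ring

/-- The net demand effect of the IT's surprise order on the price at time `2`. -/
noncomputable def q : ℝ := c.lam₂₁ * c.β₁₁ + c.lam₂₂ * (c.β₂₁ + c.β₂₃ * c.β₁₁)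

/-- The noise in the price at time `2`, as seen by the IT. -/
noncomputable def vecNoise : Fin 6 → ℝ :=
  ![0, 0, -c.q, 0, -(c.lam₂₁ + c.lam₂₂ * c.β₂₂), -c.lam₂₂]

/-- The IT's second-stage payoff is quadratic in her order. -/
theorem profitIT₂_eq (i₁ x : Ω → ℝ) : (c.profile P).profitIT₂ X i₁ x = fun ω =>
    x ω * (X.lin P.p₀ c.vecNoise ω + (X.lin P.p₀ vecV ω - c.lam₁ * (i₁ ω + X.u₁ ω) -
      c.q * (i₁ ω - c.m P * (i₁ ω + X.u₁ ω)))) - c.lam₂₂ * x ω ^ 2 + 0 + 0 := by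
  ext ω
  have hn : X.lin P.p₀ c.vecNoise ω = -c.q * X.ε ω - (c.lam₂₁ + c.lam₂₂ * c.β₂₂) * X.u₁p ω -
      c.lam₂₂ * X.u₂ ω := by
    simp [Primitives.lin_apply, vecNoise]; ring
  simp only [StrategyProfile.profitIT₂, StrategyProfile.price₂, StrategyProfile.orderX₁,
    StrategyProfile.orderX₂, Primitives.y₁, Primitives.y₂, Primitives.y₁p, Primitives.signal,
    v_eq P X ω, hn]
  simp only [profile, q]
  ring

theorem orderI₂_apply (i₁ : Ω → ℝ) (ω : Ω) : (c.profile P).orderI₂ X i₁ ω =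
    c.α₂₁ * (X.lin P.p₀ vecV ω - c.lam₁ * (i₁ ω + X.u₁ ω)) +
      c.α₂₂ * (i₁ ω - c.m P * (i₁ ω + X.u₁ ω)) := by
  simp only [StrategyProfile.orderI₂, profile, Primitives.y₁, v_eq P X ω]
  ring

end LinearCoeffs

namespace Primitives

variable {Ω : Type*} {m : MeasurableSpace Ω} {X : Primitives Ω} {p₀ : ℝ} {a b : Fin 6 → ℝ}

theorem measurable_lin_add (ha : Measurable[m] (X.lin p₀ a)) (hb : Measurable[m] (X.lin p₀ b)) :
    Measurable[m] (X.lin p₀ (a + b)) := by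
  have : X.lin p₀ (a + b) = fun ω => X.lin p₀ a ω + X.lin p₀ b ω := funext (X.lin_add p₀ a b)
  rw [this]; exact ha.add hb

theorem measurable_lin_smul (r : ℝ) (ha : Measurable[m] (X.lin p₀ a)) :
    Measurable[m] (X.lin p₀ (r • a)) := by
  have : X.lin p₀ (r • a) = fun ω => r * X.lin p₀ a ω := funext (X.lin_smul p₀ r a)
  rw [this]; exact ha.const_mul r

end Primitives

namespace LinearCoeffs

variable (c : LinearCoeffs) (P : MarketParams)

/-! Covariances of the basic linear functionals. -/

theorem cov_y₁_ξ : P.covLin c.σz c.vecY₁ (c.vecξ P) = 0 := by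
  have := c.m_mul P
  simp [MarketParams.covLin_apply, vecY₁, vecξ]; linear_combination -this

theorem cov_y₁_η : P.covLin c.σz c.vecY₁ (c.vecη P) = 0 := by
  have := c.m_mul P
  simp [MarketParams.covLin_apply, vecY₁, vecη]; linear_combination -this

theorem cov_y₁_u₁p : P.covLin c.σz c.vecY₁ vecU₁p = 0 := by
  simp [MarketParams.covLin_apply, vecY₁, vecU₁p]

theorem cov_y₁_u₂ : P.covLin c.σz c.vecY₁ vecU₂ = 0 := by
  simp [MarketParams.covLin_apply, vecU₂, vecY₁]

theorem cov_y₁_y₁ : P.covLin c.σz c.vecY₁ c.vecY₁ =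
    c.α₁ ^ 2 * P.σv ^ 2 + c.σz ^ 2 + P.σ₁ ^ 2 := by
  rw [MarketParams.covLin_apply]
  change c.α₁ * c.α₁ * P.σv ^ 2 + 1 * 1 * c.σz ^ 2 + 0 * 0 * P.σε ^ 2 + 1 * 1 * P.σ₁ ^ 2 +
    0 * 0 * P.σ₁p ^ 2 + 0 * 0 * P.σ₂ ^ 2 = _
  ring

theorem cov_v_y₁ : P.covLin c.σz vecV c.vecY₁ = c.α₁ * P.σv ^ 2 := by
  simp [MarketParams.covLin_apply, vecV, vecY₁]

theorem cov_v_ξ : P.covLin c.σz vecV (c.vecξ P) = c.α₁ * P.σv ^ 2 * (1 - c.m P) := by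
  simp [MarketParams.covLin_apply, vecV, vecξ, mul_right_comm]

theorem cov_v_η : P.covLin c.σz vecV (c.vecη P) = c.α₁ * P.σv ^ 2 * (1 - c.m P) := by
  simp [MarketParams.covLin_apply, vecV, vecη, mul_right_comm]

theorem cov_v_u₁p : P.covLin c.σz vecV vecU₁p = 0 := by
  simp [MarketParams.covLin_apply, vecV, vecU₁p]

theorem cov_v_u₂ : P.covLin c.σz vecV vecU₂ = 0 := by
  simp [MarketParams.covLin_apply, vecU₂, vecV]

theorem cov_v_ν : P.covLin c.σz vecV c.vecν = P.σv ^ 2 * (1 - c.lam₁ * c.α₁) := by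
  simp [MarketParams.covLin_apply, vecV, vecν, mul_comm]

theorem cov_ν_y₁ : P.covLin c.σz c.vecν c.vecY₁ =
    c.α₁ * P.σv ^ 2 - c.lam₁ * (c.α₁ ^ 2 * P.σv ^ 2 + c.σz ^ 2 + P.σ₁ ^ 2) := by
  simp [MarketParams.covLin_apply, vecY₁, vecν]; ring

theorem cov_ν_ξ : P.covLin c.σz c.vecν (c.vecξ P) = c.α₁ * P.σv ^ 2 * (1 - c.m P) := by
  have := c.m_mul P
  simp [MarketParams.covLin_apply, vecν, vecξ]; linear_combination c.lam₁ * this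

theorem cov_ν_η : P.covLin c.σz c.vecν (c.vecη P) = c.α₁ * P.σv ^ 2 * (1 - c.m P) := by
  have := c.m_mul P
  simp [MarketParams.covLin_apply, vecν, vecη]; linear_combination c.lam₁ * this

theorem cov_η_η : P.covLin c.σz (c.vecη P) (c.vecη P) =
    (c.α₁ ^ 2 * P.σv ^ 2 + c.σz ^ 2) * (1 - c.m P) := by
  have := c.m_mul P
  simp [MarketParams.covLin_apply, vecη]; linear_combination c.m P * this

theorem cov_η_ξ : P.covLin c.σz (c.vecη P) (c.vecξ P) =
    (c.α₁ ^ 2 * P.σv ^ 2 + c.σz ^ 2) * (1 - c.m P) := by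
  have := c.m_mul P
  simp [MarketParams.covLin_apply, vecη, vecξ]; linear_combination c.m P * this

theorem cov_ξ_ξ : P.covLin c.σz (c.vecξ P) (c.vecξ P) =
    (c.α₁ ^ 2 * P.σv ^ 2 + c.σz ^ 2) * (1 - c.m P) + P.σε ^ 2 := by
  have := c.m_mul P
  simp [MarketParams.covLin_apply, vecξ]; linear_combination c.m P * this

theorem cov_ν_u₁p : P.covLin c.σz c.vecν vecU₁p = 0 := by
  simp [MarketParams.covLin_apply, vecν, vecU₁p]

theorem cov_η_u₁p : P.covLin c.σz (c.vecη P) vecU₁p = 0 := by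
  simp [MarketParams.covLin_apply, vecη, vecU₁p]

theorem cov_ξ_u₁p : P.covLin c.σz (c.vecξ P) vecU₁p = 0 := by
  simp [MarketParams.covLin_apply, vecξ, vecU₁p]

theorem cov_u₁p_u₁p : P.covLin c.σz vecU₁p vecU₁p = P.σ₁p ^ 2 := by
  simp [MarketParams.covLin_apply, vecU₁p]

theorem cov_u₂_u₂ : P.covLin c.σz vecU₂ vecU₂ = P.σ₂ ^ 2 := by
  simp [MarketParams.covLin_apply, vecU₂]

theorem cov_ν_u₂ : P.covLin c.σz c.vecν vecU₂ = 0 := by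
  simp [MarketParams.covLin_apply, vecU₂, vecν]

theorem cov_η_u₂ : P.covLin c.σz (c.vecη P) vecU₂ = 0 := by
  simp [MarketParams.covLin_apply, vecU₂, vecη]

theorem cov_ξ_u₂ : P.covLin c.σz (c.vecξ P) vecU₂ = 0 := by
  simp [MarketParams.covLin_apply, vecU₂, vecξ]

theorem cov_u₁p_u₂ : P.covLin c.σz vecU₁p vecU₂ = 0 := by
  simp [MarketParams.covLin_apply, vecU₂, vecU₁p]

theorem cov_ν_ν (h : c.lam₁ * (c.α₁ ^ 2 * P.σv ^ 2 + c.σz ^ 2 + P.σ₁ ^ 2) = c.α₁ * P.σv ^ 2) :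
    P.covLin c.σz c.vecν c.vecν = P.σv ^ 2 * (1 - c.lam₁ * c.α₁) := by
  simp [MarketParams.covLin_apply, vecν]; linear_combination c.lam₁ * h

end LinearCoeffs

/-! ### Prices as conditional expectations: the normal equations -/

namespace Primitives.IsMarket

variable {Ω : Type*} {m m₀ : MeasurableSpace Ω} {μ : Measure Ω} [IsProbabilityMeasure μ]
  {P : MarketParams} {σz : ℝ} {X : Primitives Ω}

theorem condExp_v (hX : X.IsMarket P σz μ) (hm : m ≤ m₀) :
    μ[X.v | m] =ᵐ[μ] fun ω => P.p₀ + (μ[X.lin P.p₀ LinearCoeffs.vecV | m]) ω := by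
  have h : X.v = (fun _ => P.p₀) + X.lin P.p₀ LinearCoeffs.vecV :=
    funext fun ω => LinearCoeffs.v_eq P X ω
  rw [h]
  filter_upwards [condExp_add (integrable_const P.p₀) (hX.integrable_lin LinearCoeffs.vecV) m]
    with ω h
  rw [h, Pi.add_apply, condExp_const hm]

/-- A linear price is the conditional expectation of the value if and only if the pricing error is
uncorrelated with the order flows. -/
theorem condExp_v_eq_iff (hX : X.IsMarket P σz μ) {n : ℕ} (f : Fin n → Fin 6 → ℝ) (a : Fin 6 → ℝ)
    {p : Ω → ℝ} (hp : ∀ ω, p ω = P.p₀ + X.lin P.p₀ a ω)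
    (hm : m = ⨆ j, infoOf (X.lin P.p₀ (f j))) (ha : Measurable[m] (X.lin P.p₀ a)) :
    μ[X.v | m] =ᵐ[μ] p ↔ ∀ j, P.covLin σz (LinearCoeffs.vecV - a) (f j) = 0 := by
  have hle : m ≤ m₀ := hm ▸ iSup_le fun j => infoOf_le (hX.measurable_lin _)
  constructor
  · intro h j
    refine (hX.covLin_eq_zero_of_condExp hle LinearCoeffs.vecV a 0 ?_).2 (f j) ?_
    · filter_upwards [h, hX.condExp_v hle] with ω h₁ h₂
      rw [h₂, hp] at h₁
      linarith
    · exact (measurable_infoOf _).mono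
        (hm ▸ le_iSup (fun j => infoOf (X.lin P.p₀ (f j))) j) le_rfl
  · intro h
    filter_upwards [hX.condExp_lin LinearCoeffs.vecV a f hm.le ha h, hX.condExp_v hle] with ω h₁ h₂
    rw [h₂, h₁, hp]

end Primitives.IsMarket

theorem infoOf_sup_eq_iSup {Ω : Type*} (f g : Ω → ℝ) (F : Fin 2 → Ω → ℝ) (hf : F 0 = f)
    (hg : F 1 = g) : infoOf f ⊔ infoOf g = ⨆ j, infoOf (F j) := by
  subst hf hg
  exact le_antisymm (sup_le (le_iSup (fun j => infoOf (F j)) 0) (le_iSup (fun j => infoOf (F j)) 1))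
    (iSup_le fun j => by fin_cases j; exacts [le_sup_left, le_sup_right])

theorem infoOf_sup_sup_eq_iSup {Ω : Type*} (f g h : Ω → ℝ) (F : Fin 3 → Ω → ℝ) (hf : F 0 = f)
    (hg : F 1 = g) (hh : F 2 = h) : infoOf f ⊔ infoOf g ⊔ infoOf h = ⨆ j, infoOf (F j) := by
  subst hf hg hh
  exact le_antisymm (sup_le (sup_le (le_iSup (fun j => infoOf (F j)) 0)
      (le_iSup (fun j => infoOf (F j)) 1)) (le_iSup (fun j => infoOf (F j)) 2))
    (iSup_le fun j => by
      fin_cases j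
      exacts [le_sup_left.trans le_sup_left, le_sup_right.trans le_sup_left, le_sup_right])

namespace LinearCoeffs

open Primitives

variable {Ω : Type*} {m₀ : MeasurableSpace Ω} {μ : Measure Ω} [IsProbabilityMeasure μ]
  {P : MarketParams} {X : Primitives Ω} (c : LinearCoeffs)

/-- The dealers' conditions are equivalent to the normal equations of the regressions of the value on
the order flows. -/
theorem dealers_iff (hX : X.IsMarket P c.σz μ) {w C Vη Vξ Vν b G₁₁ G₁₂ G₂₂ : ℝ}
    (hw : w = c.α₁ ^ 2 * P.σv ^ 2 + c.σz ^ 2) (hC : C = c.α₁ * P.σv ^ 2 * (1 - c.m P))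
    (hVη : Vη = w * (1 - c.m P)) (hVξ : Vξ = w * (1 - c.m P) + P.σε ^ 2)
    (hVν : Vν = P.σv ^ 2 * (1 - c.lam₁ * c.α₁)) (hb : b = c.β₂₁ + c.β₂₃ * c.β₁₁)
    (hG₁₁ : G₁₁ = c.β₁₁ ^ 2 * Vξ + P.σ₁p ^ 2)
    (hG₁₂ : G₁₂ = c.β₁₁ * (c.α₂₁ * C + c.α₂₂ * Vη + b * Vξ) + c.β₂₂ * P.σ₁p ^ 2)
    (hG₂₂ : G₂₂ = c.α₂₁ ^ 2 * Vν + c.α₂₂ ^ 2 * Vη + 2 * c.α₂₁ * c.α₂₂ * C + b ^ 2 * Vξ +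
      2 * b * (c.α₂₁ * C + c.α₂₂ * Vη) + c.β₂₂ ^ 2 * P.σ₁p ^ 2 + P.σ₂ ^ 2) :
    (letI s := c.profile P
     letI i₁ := s.orderI₁ X
     letI i₂ := s.orderI₂ X i₁
     letI x₁ := s.orderX₁ X i₁
     letI x₂ := s.orderX₂ X i₁ x₁
     μ[X.v | infoOf (X.y₁ i₁)] =ᵐ[μ] s.price₁ X i₁ ∧
     μ[X.v | infoOf (X.y₁ i₁) ⊔ infoOf (X.y₁p x₁)] =ᵐ[μ] s.price₁p X i₁ x₁ ∧
     μ[X.v | infoOf (X.y₁ i₁) ⊔ infoOf (X.y₁p x₁) ⊔ infoOf (X.y₂ i₂ x₂)]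
      =ᵐ[μ] s.price₂ X i₁ x₁ i₂ x₂) ↔
    c.lam₁ * (w + P.σ₁ ^ 2) = c.α₁ * P.σv ^ 2 ∧ c.lam₁p * G₁₁ = c.β₁₁ * C ∧
      c.lam₂₁ * G₁₁ + c.lam₂₂ * G₁₂ = c.β₁₁ * C ∧
      c.lam₂₁ * G₁₂ + c.lam₂₂ * G₂₂ = c.α₂₁ * Vν + (c.α₂₂ + b) * C := by
  have hy₁ : Measurable[infoOf (X.lin P.p₀ c.vecY₁)] (X.lin P.p₀ c.vecY₁) := measurable_infoOf _
  have hy₁p : Measurable[infoOf (X.lin P.p₀ (c.vecY₁p P))] (X.lin P.p₀ (c.vecY₁p P)) :=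
    measurable_infoOf _
  have hy₂ : Measurable[infoOf (X.lin P.p₀ (c.vecY₂ P))] (X.lin P.p₀ (c.vecY₂ P)) :=
    measurable_infoOf _
  simp only [y₁_eq, y₁p_eq, y₂_eq]
  rw [hX.condExp_v_eq_iff ![c.vecY₁] (c.lam₁ • c.vecY₁) (fun ω => by
      simp only [StrategyProfile.price₁, y₁_eq, lin_smul]; rfl) (by simp)
      (measurable_lin_smul _ hy₁),
    hX.condExp_v_eq_iff (m := infoOf (X.lin P.p₀ c.vecY₁) ⊔ infoOf (X.lin P.p₀ (c.vecY₁p P)))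
      ![c.vecY₁, c.vecY₁p P] (c.lam₁ • c.vecY₁ + c.lam₁p • c.vecY₁p P)
      (fun ω => by
        simp only [StrategyProfile.price₁p, y₁_eq, y₁p_eq, lin_add, lin_smul]
        simp only [profile]; ring)
      (infoOf_sup_eq_iSup _ _ _ rfl rfl)
      (measurable_lin_add (measurable_lin_smul _ (hy₁.mono le_sup_left le_rfl))
        (measurable_lin_smul _ (hy₁p.mono le_sup_right le_rfl))),
    hX.condExp_v_eq_iff (m := infoOf (X.lin P.p₀ c.vecY₁) ⊔ infoOf (X.lin P.p₀ (c.vecY₁p P)) ⊔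
        infoOf (X.lin P.p₀ (c.vecY₂ P))) ![c.vecY₁, c.vecY₁p P, c.vecY₂ P]
      (c.lam₁ • c.vecY₁ + c.lam₂₁ • c.vecY₁p P + c.lam₂₂ • c.vecY₂ P)
      (fun ω => by
        simp only [StrategyProfile.price₂, y₁_eq, y₁p_eq, y₂_eq, lin_add, lin_smul]
        simp only [profile]; ring)
      (infoOf_sup_sup_eq_iSup _ _ _ _ rfl rfl rfl)
      (measurable_lin_add (measurable_lin_add
        (measurable_lin_smul _ (hy₁.mono (le_sup_left.trans le_sup_left) le_rfl))
        (measurable_lin_smul _ (hy₁p.mono (le_sup_right.trans le_sup_left) le_rfl)))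
        (measurable_lin_smul _ (hy₂.mono le_sup_right le_rfl)))]
  have k₁ : P.covLin c.σz c.vecY₁ (c.vecY₁p P) = 0 := by
    simp [vecY₁p, MarketParams.covLin_add_right, MarketParams.covLin_smul_right, cov_y₁_ξ,
      cov_y₁_u₁p]
  -- Only the pricing error in `i₂` can correlate with `y₁`, and it stops doing so once `λ₁`
  -- satisfies its normal equation.
  have k₂ : P.covLin c.σz c.vecY₁ (c.vecY₂ P) =
      c.α₂₁ * (c.α₁ * P.σv ^ 2 - c.lam₁ * (w + P.σ₁ ^ 2)) := by
    simp [vecY₂, vecI₂, MarketParams.covLin_add_right, MarketParams.covLin_smul_right, cov_y₁_ξ,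
      cov_y₁_η, cov_y₁_u₁p, cov_y₁_u₂, P.covLin_comm c.σz c.vecY₁ c.vecν, cov_ν_y₁, hw]
  have k₃ : P.covLin c.σz vecV (c.vecY₁p P) = c.β₁₁ * C := by
    simp [vecY₁p, MarketParams.covLin_add_right, MarketParams.covLin_smul_right, cov_v_ξ,
      cov_v_u₁p, hC]
  have k₄ : P.covLin c.σz vecV (c.vecY₂ P) = c.α₂₁ * Vν + (c.α₂₂ + b) * C := by
    simp [vecY₂, vecI₂, MarketParams.covLin_add_right, MarketParams.covLin_smul_right, cov_v_ξ,
      cov_v_η, cov_v_u₁p, cov_v_u₂, cov_v_ν, hC, hVν, hb]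
    ring
  have k₅ : P.covLin c.σz (c.vecY₁p P) (c.vecY₁p P) = G₁₁ := by
    simp [vecY₁p, MarketParams.covLin_add_right, MarketParams.covLin_smul_right,
      MarketParams.covLin_add_left, MarketParams.covLin_smul_left, cov_ξ_ξ, cov_u₁p_u₁p,
      cov_ξ_u₁p, P.covLin_comm c.σz vecU₁p (c.vecξ P), hG₁₁, hVξ, hw]
    ring
  have k₆ : P.covLin c.σz (c.vecY₂ P) (c.vecY₁p P) = G₁₂ := by
    simp [vecY₁p, vecY₂, vecI₂, MarketParams.covLin_add_right, MarketParams.covLin_smul_right,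
      MarketParams.covLin_add_left, MarketParams.covLin_smul_left, cov_ξ_ξ, cov_u₁p_u₁p, cov_ν_ξ,
      cov_η_ξ, cov_ν_u₁p, cov_η_u₁p, cov_ξ_u₁p, P.covLin_comm c.σz vecU₁p (c.vecξ P),
      P.covLin_comm c.σz vecU₂ (c.vecξ P), cov_ξ_u₂,
      P.covLin_comm c.σz vecU₂ vecU₁p, cov_u₁p_u₂, hG₁₂, hVξ, hVη, hC, hb, hw]
  -- The short formula for the variance of `v - p₁` needs `p₁` to be the regression on `y₁`, hence
  -- the premise.
  have k₇ : c.lam₁ * (w + P.σ₁ ^ 2) = c.α₁ * P.σv ^ 2 →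
      P.covLin c.σz (c.vecY₂ P) (c.vecY₂ P) = G₂₂ := by
    intro h
    rw [hw] at h
    simp [vecY₂, vecI₂, MarketParams.covLin_add_right, MarketParams.covLin_smul_right,
      MarketParams.covLin_add_left, MarketParams.covLin_smul_left, cov_ξ_ξ, cov_u₁p_u₁p, cov_ν_ξ,
      cov_η_ξ, cov_ν_u₁p, cov_η_u₁p, cov_ξ_u₁p, P.covLin_comm c.σz vecU₁p (c.vecξ P),
      P.covLin_comm c.σz vecU₁p c.vecν, P.covLin_comm c.σz vecU₁p (c.vecη P),
      P.covLin_comm c.σz (c.vecξ P) c.vecν, P.covLin_comm c.σz (c.vecξ P) (c.vecη P),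
      P.covLin_comm c.σz (c.vecη P) c.vecν, cov_ν_ν c P h, cov_η_η, cov_ν_η,
      P.covLin_comm c.σz vecU₂ (c.vecξ P), cov_ξ_u₂,
      P.covLin_comm c.σz vecU₂ (c.vecη P), cov_η_u₂,
      P.covLin_comm c.σz vecU₂ c.vecν, cov_ν_u₂, cov_u₂_u₂,
      P.covLin_comm c.σz vecU₂ vecU₁p, cov_u₁p_u₂, hG₂₂, hVξ, hVη, hVν, hC, hb, hw]
    ring
  have k₈ : P.covLin c.σz c.vecY₁ c.vecY₁ = w + P.σ₁ ^ 2 := by rw [cov_y₁_y₁, hw]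
  simp only [Fin.forall_fin_succ, IsEmpty.forall_iff, and_true,
    Matrix.cons_val_zero, Matrix.cons_val_succ, Matrix.cons_val_fin_one,
    MarketParams.covLin_sub_left, MarketParams.covLin_add_left, MarketParams.covLin_smul_left,
    cov_v_y₁, k₁, k₃, k₄, k₅, k₆, k₈, P.covLin_comm c.σz (c.vecY₁p P) c.vecY₁,
    P.covLin_comm c.σz (c.vecY₂ P) c.vecY₁, P.covLin_comm c.σz (c.vecY₁p P) (c.vecY₂ P), k₂]
  constructor
  · rintro ⟨h₁, ⟨-, h₂⟩, -, h₃, h₄⟩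
    have h₁' : c.lam₁ * (w + P.σ₁ ^ 2) = c.α₁ * P.σv ^ 2 := by linarith
    rw [k₇ h₁'] at h₄
    refine ⟨h₁', by linarith, by linarith, ?_⟩
    linear_combination -h₄ - c.lam₁ * c.α₂₁ * h₁
  · rintro ⟨h₁, h₂, h₃, h₄⟩
    rw [k₇ h₁]
    refine ⟨by linarith, ⟨by linarith, by linarith⟩, ?_, by linarith, ?_⟩
    · linear_combination (-1 + c.lam₂₂ * c.α₂₁) * h₁
    · linear_combination -h₄ + c.lam₁ * c.α₂₁ * h₁

end LinearCoeffs

/-! ### The informed trader's second-stage optimum -/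

theorem integrable_quadratic {Ω : Type*} {m₀ : MeasurableSpace Ω} {μ : Measure Ω}
    {x ξ b C C' : Ω → ℝ} (κ : ℝ) (hx : MemLp x 2 μ) (hξ : MemLp ξ 2 μ) (hb : MemLp b 2 μ)
    (hC' : Integrable C' μ) (hC : Integrable C μ) :
    Integrable (fun ω => x ω * (ξ ω + b ω) - κ * x ω ^ 2 + C' ω + C ω) μ :=
  (((hx.integrable_mul (hξ.add hb)).sub (hx.integrable_sq.const_mul κ)).add hC').add hC

namespace Primitives.IsMarket

variable {Ω : Type*} {m m₀ : MeasurableSpace Ω} {μ : Measure Ω} [IsProbabilityMeasure μ]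
  {P : MarketParams} {σz : ℝ} {X : Primitives Ω}

theorem memLp_affine (hX : X.IsMarket P σz μ) (a : Fin 6 → ℝ) (t : ℝ) :
    MemLp (fun ω => X.lin P.p₀ a ω + t) 2 μ := (hX.memLp_lin a).add (memLp_const t)

theorem covLin_eq_zero_of_condExp_affine (hX : X.IsMarket P σz μ) (hm : m ≤ m₀)
    (a c : Fin 6 → ℝ) (s t : ℝ)
    (h : μ[fun ω => X.lin P.p₀ a ω + s | m] =ᵐ[μ] fun ω => X.lin P.p₀ c ω + t) :
    s = t ∧ ∀ f, Measurable[m] (X.lin P.p₀ f) → P.covLin σz (a - c) f = 0 := by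
  have h' : μ[X.lin P.p₀ a | m] =ᵐ[μ] fun ω => X.lin P.p₀ c ω + (t - s) := by
    filter_upwards [h, condExp_add (hX.integrable_lin a) (integrable_const s) m] with ω h₁ h₂
    change (μ[fun ω => X.lin P.p₀ a ω + s | m]) ω = _ at h₂
    rw [h₁, Pi.add_apply, condExp_const hm] at h₂
    linarith
  have := hX.covLin_eq_zero_of_condExp hm a c (t - s) h'
  exact ⟨by linarith [this.1], this.2⟩

end Primitives.IsMarket

namespace LinearCoeffs

open Primitives

variable {Ω : Type*} {m₀ : MeasurableSpace Ω} {μ : Measure Ω} [IsProbabilityMeasure μ]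
  {P : MarketParams} {X : Primitives Ω} (c : LinearCoeffs)

theorem measurable_orderI₂ (P : MarketParams) {m : MeasurableSpace Ω} {i₁ : Ω → ℝ}
    (hv : Measurable[m] X.v) (hi : Measurable[m] i₁) (hy : Measurable[m] (X.y₁ i₁)) :
    Measurable[m] ((c.profile P).orderI₂ X i₁) := by
  have : (c.profile P).orderI₂ X i₁ = fun ω => c.α₂₁ * (X.v ω - (P.p₀ + c.lam₁ * X.y₁ i₁ ω)) +
    c.α₂₂ * (i₁ ω - c.m P * X.y₁ i₁ ω) := rfl
  rw [this]
  exact ((hv.sub ((hy.const_mul _).const_add _)).const_mul _).add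
    ((hi.sub (hy.const_mul _)).const_mul _)

/-- Even if `i₁` is a nonlinear function of `(v, z)`, the information is contained in that of `v`,
`z`, `u₁`. This lets Gaussian projection handle arbitrary deviations. -/
theorem infoOf_IT_le {i₁ : Ω → ℝ}
    (hi : Measurable[infoOf X.v ⊔ infoOf X.z] i₁) :
    infoOf X.v ⊔ infoOf i₁ ⊔ infoOf (X.y₁ i₁) ≤ ⨆ j, infoOf (X.lin P.p₀
      ((![![1, 0, 0, 0, 0, 0], ![0, 1, 0, 0, 0, 0], ![0, 0, 0, 1, 0, 0]] :
        Fin 3 → Fin 6 → ℝ) j)) := by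
  set f : Fin 3 → Fin 6 → ℝ := ![![1, 0, 0, 0, 0, 0], ![0, 1, 0, 0, 0, 0], ![0, 0, 0, 1, 0, 0]]
  have hf : ∀ j, Measurable[⨆ j, infoOf (X.lin P.p₀ (f j))] (X.lin P.p₀ (f j)) := fun j =>
    (measurable_infoOf _).mono (le_iSup (fun j => infoOf (X.lin P.p₀ (f j))) j) le_rfl
  have hv : Measurable[⨆ j, infoOf (X.lin P.p₀ (f j))] X.v := by
    have : X.v = fun ω => X.lin P.p₀ (f 0) ω + P.p₀ := by
      ext ω; simp [f, lin_apply]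
    rw [this]; exact (hf 0).add_const _
  have hz : Measurable[⨆ j, infoOf (X.lin P.p₀ (f j))] X.z := by
    have : X.z = X.lin P.p₀ (f 1) := by
      ext ω; simp [f, lin_apply]
    rw [this]; exact hf 1
  have hu : Measurable[⨆ j, infoOf (X.lin P.p₀ (f j))] X.u₁ := by
    have : X.u₁ = X.lin P.p₀ (f 2) := by
      ext ω; simp [f, lin_apply]
    rw [this]; exact hf 2
  have hi' := hi.mono (sup_le (infoOf_le hv) (infoOf_le hz)) le_rfl
  exact sup_le (sup_le (infoOf_le hv) (infoOf_le hi')) (infoOf_le (hi'.add hu))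

/-- The noise involves only `ε`, `u₁₊` and `u₂`, which are uncorrelated with the generators `v`,
`z`, `u₁` of the larger σ-algebra. -/
theorem condExp_vecNoise (hX : X.IsMarket P c.σz μ) {m : MeasurableSpace Ω} {i₁ : Ω → ℝ}
    (hi : Measurable[infoOf X.v ⊔ infoOf X.z] i₁)
    (hm : m ≤ infoOf X.v ⊔ infoOf i₁ ⊔ infoOf (X.y₁ i₁)) :
    μ[X.lin P.p₀ c.vecNoise | m] =ᵐ[μ] 0 := by
  have h0 : X.lin P.p₀ 0 = 0 := by ext ω; simp [lin_apply]
  have := hX.condExp_lin c.vecNoise 0 _ (hm.trans (infoOf_IT_le hi))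
    (by rw [h0]; exact measurable_const) (by
      intro j
      fin_cases j <;> simp [MarketParams.covLin_apply, vecNoise])
  rwa [h0] at this

theorem memLp_u₁ (hX : X.IsMarket P c.σz μ) : MemLp X.u₁ 2 μ := by
  have : X.u₁ = X.lin P.p₀ ![0, 0, 0, 1, 0, 0] := by ext ω; simp [lin_apply]
  rw [this]; exact hX.memLp_lin _

theorem memLp_orderI₂ (hX : X.IsMarket P c.σz μ) {i₁ : Ω → ℝ} (hi : MemLp i₁ 2 μ) :
    MemLp ((c.profile P).orderI₂ X i₁) 2 μ := by
  rw [funext (c.orderI₂_apply P X i₁)]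
  have hu := c.memLp_u₁ hX
  exact (((hX.memLp_lin vecV).sub ((hi.add hu).const_mul _)).const_mul _).add
    ((hi.sub ((hi.add hu).const_mul _)).const_mul _)

theorem integrable_profitIT₂ (hX : X.IsMarket P c.σz μ) {i₁ x : Ω → ℝ} (hi : MemLp i₁ 2 μ)
    (hx : MemLp x 2 μ) : Integrable ((c.profile P).profitIT₂ X i₁ x) μ := by
  rw [profitIT₂_eq]
  have hu := c.memLp_u₁ hX
  exact integrable_quadratic _ hx (hX.memLp_lin _)
    (((hX.memLp_lin vecV).sub ((hi.add hu).const_mul _)).sub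
      ((hi.sub ((hi.add hu).const_mul _)).const_mul _)) (integrable_const 0) (integrable_const 0)

/-- The IT's second-stage conditions. -/
theorem it₂_iff (hX : X.IsMarket P c.σz μ) :
    (∀ i₁ : Ω → ℝ, Measurable[infoOf X.v ⊔ infoOf X.z] i₁ →
      Integrable ((c.profile P).profitIT₂ X i₁ ((c.profile P).orderI₂ X i₁)) μ →
      IsArgmax μ (infoOf X.v ⊔ infoOf i₁ ⊔ infoOf (X.y₁ i₁)) ((c.profile P).profitIT₂ X i₁)
        ((c.profile P).orderI₂ X i₁)) ↔
    0 < c.lam₂₂ ∧ 2 * c.lam₂₂ * c.α₂₁ = 1 ∧ 2 * c.lam₂₂ * c.α₂₂ = -c.q := by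
  constructor
  · intro h
    -- The constant order `1` identifies both coefficients: it is not tied to `v`, so `α₂₁` and
    -- `α₂₂` can be separated, and being nonzero it leaves a constant term involving `α₂₂`.
    have hi : MemLp (fun _ : Ω => (1 : ℝ)) 2 μ := memLp_const 1
    have h₁ := h (fun _ => 1) measurable_const
      (c.integrable_profitIT₂ hX hi (c.memLp_orderI₂ hX hi))
    -- The random part of the intercept of the marginal second-stage payoff after `i₁ = 1`; its
    -- constant part is `-λ₁ - q (1 - m)`.
    set a : Fin 6 → ℝ := ![1, 0, -c.q, -c.lam₁ + c.q * c.m P, -(c.lam₂₁ + c.lam₂₂ * c.β₂₂),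
      -c.lam₂₂] with ha
    have hix := (c.memLp_orderI₂ hX hi).integrable one_le_two
    have hia := (hX.memLp_affine a (-c.lam₁ - c.q * (1 - c.m P))).integrable one_le_two
    have hle : infoOf X.v ⊔ infoOf (fun _ : Ω => (1 : ℝ)) ⊔ infoOf (X.y₁ fun _ => 1) ≤ m₀ :=
      sup_le (sup_le (infoOf_le hX.measurable_v) (infoOf_le measurable_const))
        (infoOf_le (measurable_const.add hX.measurable_u₁))
    set m := infoOf X.v ⊔ infoOf (fun _ : Ω => (1 : ℝ)) ⊔ infoOf (X.y₁ fun _ => 1) with hm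
    have hv : Measurable[m] X.v := (measurable_infoOf _).mono (le_sup_left.trans le_sup_left) le_rfl
    have hx₀ : Measurable[m] ((c.profile P).orderI₂ X fun _ => 1) :=
      c.measurable_orderI₂ P hv measurable_const ((measurable_infoOf _).mono le_sup_right le_rfl)
    have h₂ := h₁.quadratic hle hx₀ (ae_eq_refl _) (κ := c.lam₂₂)
      (ξ := fun ω => X.lin P.p₀ a ω + (-c.lam₁ - c.q * (1 - c.m P))) (fun t => by
        refine Filter.Eventually.of_forall fun ω => ?_
        simp only [profitIT₂_eq, ha, vecNoise, lin_apply, vecV]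
        simp; ring)
      hix hia
    obtain ⟨hκ, h₂⟩ := h₂
    have h₃ := hX.covLin_eq_zero_of_condExp_affine hle a
      ((2 * c.lam₂₂) • ![c.α₂₁, 0, 0, -c.α₂₁ * c.lam₁ - c.α₂₂ * c.m P, 0, 0]) _
      (2 * c.lam₂₂ * (-c.α₂₁ * c.lam₁ + c.α₂₂ * (1 - c.m P))) (h₂.trans (by
        refine Filter.Eventually.of_forall fun ω => ?_
        simp only [orderI₂_apply, lin_apply, vecV]
        simp; ring))
    obtain ⟨h₄, h₅⟩ := h₃
    have h₆ := h₅ vecV (by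
      have : X.lin P.p₀ vecV = fun ω => X.v ω - P.p₀ := by ext ω; simp [v_eq P X ω]
      rw [this]; exact hv.sub_const _)
    have hs := P.σv_pos
    simp [MarketParams.covLin_apply, vecV, ha, hs.ne'] at h₆
    have h₇ := c.one_sub_m_pos P
    -- Testing against `v` has given `α₂₁`; the constant terms then give `α₂₂` after division by `1
    -- - m > 0`.
    refine ⟨hκ, by linarith, mul_right_cancel₀ h₇.ne' ?_⟩
    linear_combination -h₄ - c.lam₁ * h₆
  · rintro ⟨h₁, h₂, h₃⟩ i₁ hi hint
    set m := infoOf X.v ⊔ infoOf i₁ ⊔ infoOf (X.y₁ i₁) with hm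
    have hv : Measurable[m] X.v := (measurable_infoOf _).mono (le_sup_left.trans le_sup_left) le_rfl
    have hi' : Measurable[m] i₁ :=
      (measurable_infoOf _).mono (le_sup_right.trans le_sup_left) le_rfl
    have hy : Measurable[m] (X.y₁ i₁) := (measurable_infoOf _).mono le_sup_right le_rfl
    have hle : m ≤ m₀ := (infoOf_IT_le hi).trans
      (iSup_le fun j => infoOf_le (hX.measurable_lin _))
    have hb : Measurable[m] fun ω => X.lin P.p₀ vecV ω - c.lam₁ * (i₁ ω + X.u₁ ω) -
        c.q * (i₁ ω - c.m P * (i₁ ω + X.u₁ ω)) := by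
      have : X.lin P.p₀ vecV = fun ω => X.v ω - P.p₀ := by ext ω; simp [v_eq P X ω]
      rw [this]
      exact ((hv.sub_const _).sub (hy.const_mul _)).sub ((hi'.sub (hy.const_mul _)).const_mul _)
    refine isArgmax_of_quadratic hle (fun x' => c.profitIT₂_eq P X i₁ x') h₁
      (c.measurable_orderI₂ P hv hi' hy).stronglyMeasurable.aestronglyMeasurable
      hb.stronglyMeasurable.aestronglyMeasurable
      (measurable_const (a := (0 : ℝ))).stronglyMeasurable.aestronglyMeasurable
      (hX.integrable_lin _) (integrable_const 0) hint ?_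
    filter_upwards [c.condExp_vecNoise hX hi le_rfl] with ω h
    rw [h, orderI₂_apply]
    simp only [Pi.zero_apply]
    linear_combination -(X.lin P.p₀ vecV ω - c.lam₁ * (i₁ ω + X.u₁ ω)) * h₂ -
      (i₁ ω - c.m P * (i₁ ω + X.u₁ ω)) * h₃

end LinearCoeffs

/-! ### The HFT's optimality conditions at times 2 and 1₊ -/

namespace LinearCoeffs

open Primitives

section

variable (c : LinearCoeffs) (P : MarketParams)

/-- The value minus the price at time `2`, as seen by the HFT, up to her own orders. -/
noncomputable def vecζ : Fin 6 → ℝ :=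
  c.vecν - c.lam₂₁ • vecU₁p - c.lam₂₂ • c.vecI₂ P - c.lam₂₂ • vecU₂

theorem cov_ζ_y₁ (h : c.lam₁ * (c.α₁ ^ 2 * P.σv ^ 2 + c.σz ^ 2 + P.σ₁ ^ 2) = c.α₁ * P.σv ^ 2) :
    P.covLin c.σz (c.vecζ P) c.vecY₁ = 0 := by
  simp only [vecζ, vecI₂, MarketParams.covLin_sub_left, MarketParams.covLin_add_left,
    MarketParams.covLin_smul_left, cov_ν_y₁, P.covLin_comm c.σz (c.vecη P) c.vecY₁,
    P.covLin_comm c.σz vecU₁p c.vecY₁, P.covLin_comm c.σz vecU₂ c.vecY₁, cov_y₁_η, cov_y₁_u₁p,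
    cov_y₁_u₂]
  linear_combination (-1 + c.lam₂₂ * c.α₂₁) * h

theorem cov_ζ_ξ : P.covLin c.σz (c.vecζ P) (c.vecξ P) =
    c.α₁ * P.σv ^ 2 * (1 - c.m P) - c.lam₂₂ * (c.α₂₁ * (c.α₁ * P.σv ^ 2 * (1 - c.m P)) +
      c.α₂₂ * ((c.α₁ ^ 2 * P.σv ^ 2 + c.σz ^ 2) * (1 - c.m P))) := by
  simp only [vecζ, vecI₂, MarketParams.covLin_sub_left, MarketParams.covLin_add_left,
    MarketParams.covLin_smul_left, cov_ν_ξ, cov_η_ξ, P.covLin_comm c.σz vecU₁p (c.vecξ P),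
    P.covLin_comm c.σz vecU₂ (c.vecξ P), cov_ξ_u₁p, cov_ξ_u₂]
  ring

theorem cov_ζ_u₁p : P.covLin c.σz (c.vecζ P) vecU₁p = -c.lam₂₁ * P.σ₁p ^ 2 := by
  simp only [vecζ, vecI₂, MarketParams.covLin_sub_left, MarketParams.covLin_add_left,
    MarketParams.covLin_smul_left, cov_ν_u₁p, cov_η_u₁p, cov_u₁p_u₁p,
    P.covLin_comm c.σz vecU₂ vecU₁p, cov_u₁p_u₂]
  ring

end

variable {Ω : Type*} {m₀ : MeasurableSpace Ω} {μ : Measure Ω} [IsProbabilityMeasure μ]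
  {P : MarketParams} {X : Primitives Ω} (c : LinearCoeffs)

theorem measurable_ξ (P : MarketParams) {m : MeasurableSpace Ω}
    (hs : Measurable[m] (X.lin P.p₀ c.vecSignal)) (hy : Measurable[m] (X.lin P.p₀ c.vecY₁)) :
    Measurable[m] (X.lin P.p₀ (c.vecξ P)) := by
  rw [funext (c.ξ_eq P X)]; exact hs.sub (hy.const_mul _)

/-- Given `y₁`, the signal and its surprise determine each other, so the surprise, uncorrelated with
`y₁`, can serve as generator in its place. -/
theorem measurable_signal (P : MarketParams) {m : MeasurableSpace Ω}
    (hs : Measurable[m] (X.lin P.p₀ (c.vecξ P))) (hy : Measurable[m] (X.lin P.p₀ c.vecY₁)) :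
    Measurable[m] (X.lin P.p₀ c.vecSignal) := by
  have : X.lin P.p₀ c.vecSignal =
      fun ω => X.lin P.p₀ (c.vecξ P) ω + c.m P * X.lin P.p₀ c.vecY₁ ω := by
    ext ω; rw [ξ_eq]; ring
  rw [this]; exact hs.add (hy.const_mul _)

/-- Whatever measurable `x₁` was submitted, no information is gained beyond the mutually
uncorrelated functionals of the signal surprise, `y₁` and `u₁₊`. -/
theorem infoOf_HFT_le (P : MarketParams) {x₁ : Ω → ℝ}
    (hx₁ : Measurable[infoOf (X.lin P.p₀ c.vecSignal) ⊔ infoOf (X.lin P.p₀ c.vecY₁)] x₁) :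
    infoOf (X.lin P.p₀ c.vecSignal) ⊔ infoOf (X.lin P.p₀ c.vecY₁) ⊔ infoOf (X.y₁p x₁) ≤
      ⨆ j, infoOf (X.lin P.p₀ ((![c.vecξ P, c.vecY₁, vecU₁p] : Fin 3 → Fin 6 → ℝ) j)) := by
  set f : Fin 3 → Fin 6 → ℝ := ![c.vecξ P, c.vecY₁, vecU₁p]
  have hf : ∀ j, Measurable[⨆ j, infoOf (X.lin P.p₀ (f j))] (X.lin P.p₀ (f j)) := fun j =>
    (measurable_infoOf _).mono (le_iSup (fun j => infoOf (X.lin P.p₀ (f j))) j) le_rfl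
  have hle := sup_le (infoOf_le (c.measurable_signal P (hf 0) (hf 1))) (infoOf_le (hf 1))
  have hu := hf 2
  change Measurable[⨆ j, infoOf (X.lin P.p₀ (f j))] (X.lin P.p₀ vecU₁p) at hu
  rw [← u₁p_eq P X] at hu
  exact sup_le hle (infoOf_le ((hx₁.mono hle le_rfl).add hu))

theorem memLp_orderX₂ (hX : X.IsMarket P c.σz μ) {x₁ : Ω → ℝ} (hx₁ : MemLp x₁ 2 μ) :
    MemLp ((c.profile P).orderX₂ X ((c.profile P).orderI₁ X) x₁) 2 μ := by
  rw [funext (c.orderX₂_eq P X x₁)]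
  exact (hX.memLp_lin _).add (hx₁.const_mul _)

theorem integrable_objectiveHFT₂ (hX : X.IsMarket P c.σz μ) {x₁ x : Ω → ℝ} (hx₁ : MemLp x₁ 2 μ)
    (hx : MemLp x 2 μ) : Integrable ((c.profile P).objectiveHFT₂ X P.γ x₁ x) μ := by
  rw [objectiveHFT₂_eq]
  exact integrable_quadratic _ hx (hX.memLp_lin _) (hx₁.const_mul _)
    (hx₁.integrable_sq.const_mul _) (integrable_const 0)

/-- The HFT's conditions at time `2`. -/
theorem hft₂_iff (hX : X.IsMarket P c.σz μ)
    (hd : c.lam₁ * (c.α₁ ^ 2 * P.σv ^ 2 + c.σz ^ 2 + P.σ₁ ^ 2) = c.α₁ * P.σv ^ 2)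
    (hlam : 0 < c.lam₂₂) {C Vη Vξ : ℝ} (hC : C = c.α₁ * P.σv ^ 2 * (1 - c.m P))
    (hVη : Vη = (c.α₁ ^ 2 * P.σv ^ 2 + c.σz ^ 2) * (1 - c.m P)) (hVξ : Vξ = Vη + P.σε ^ 2) :
    (letI i₁ := (c.profile P).orderI₁ X;
      ∀ x₁ : Ω → ℝ, Measurable[infoOf (X.signal i₁) ⊔ infoOf (X.y₁ i₁)] x₁ →
      Integrable ((c.profile P).objectiveHFT₂ X P.γ x₁ ((c.profile P).orderX₂ X i₁ x₁)) μ →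
        IsArgmax μ (infoOf (X.signal i₁) ⊔ infoOf (X.y₁ i₁) ⊔ infoOf (X.y₁p x₁))
          ((c.profile P).objectiveHFT₂ X P.γ x₁) ((c.profile P).orderX₂ X i₁ x₁)) ↔
    2 * (P.γ + c.lam₂₂) * c.β₂₁ * Vξ = C - c.lam₂₂ * (c.α₂₁ * C + c.α₂₂ * Vη) ∧
    2 * (P.γ + c.lam₂₂) * c.β₂₂ = -c.lam₂₁ ∧
    2 * (P.γ + c.lam₂₂) * c.β₂₃ = -(c.lam₂₁ + 2 * P.γ) := by
  simp only [y₁_eq, signal_eq]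
  -- The HFT knows her own order and therefore recovers the noise `u₁₊` from the order flow.
  have hu' : ∀ {m : MeasurableSpace Ω} {x₁ : Ω → ℝ}, Measurable[m] x₁ → Measurable[m] (X.y₁p x₁) →
      Measurable[m] (X.lin P.p₀ vecU₁p) := by
    intro m x₁ h₁ h₂
    have : X.lin P.p₀ vecU₁p = fun ω => X.y₁p x₁ ω - x₁ ω := by
      ext ω; rw [← u₁p_eq P X]; simp [Primitives.y₁p]
    rw [this]; exact h₂.sub h₁
  have hs := P.σ₁p_pos
  constructor
  · intro h
    -- After the constant order `1` the three coefficients separate: the constant term gives `β₂₃`,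
    -- the covariance with the signal surprise the equation for `β₂₁`, and the covariance with `u₁₊`
    -- gives `β₂₂`.
    have hx₁ : MemLp (fun _ : Ω => (1 : ℝ)) 2 μ := memLp_const 1
    have hx₂ := c.memLp_orderX₂ hX hx₁
    have h₁ := h (fun _ => 1) measurable_const (c.integrable_objectiveHFT₂ hX hx₁ hx₂)
    have hix := hx₂.integrable one_le_two
    have hia := (hX.memLp_affine (c.vecζ P) (-(c.lam₂₁ + 2 * P.γ))).integrable one_le_two
    have hle : infoOf (X.lin P.p₀ c.vecSignal) ⊔ infoOf (X.lin P.p₀ c.vecY₁) ⊔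
        infoOf (X.y₁p fun _ => 1) ≤ m₀ := sup_le (sup_le (infoOf_le (hX.measurable_lin _))
          (infoOf_le (hX.measurable_lin _))) (infoOf_le (measurable_const.add hX.measurable_u₁p))
    set m := infoOf (X.lin P.p₀ c.vecSignal) ⊔ infoOf (X.lin P.p₀ c.vecY₁) ⊔
        infoOf (X.y₁p fun _ => 1) with hm
    have hξ : Measurable[m] (X.lin P.p₀ (c.vecξ P)) := c.measurable_ξ P
      ((measurable_infoOf _).mono (le_sup_left.trans le_sup_left) le_rfl)
      ((measurable_infoOf _).mono (le_sup_right.trans le_sup_left) le_rfl)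
    have hu : Measurable[m] (X.lin P.p₀ vecU₁p) := hu' (x₁ := fun _ => 1) measurable_const
      ((measurable_infoOf _).mono le_sup_right le_rfl)
    have hx₀ : Measurable[m]
        ((c.profile P).orderX₂ X ((c.profile P).orderI₁ X) fun _ => 1) := by
      rw [funext (c.orderX₂_eq P X _)]
      exact (measurable_lin_add (measurable_lin_smul _ hξ) (measurable_lin_smul _ hu)).add
        measurable_const
    obtain ⟨-, h₂⟩ := h₁.quadratic hle hx₀ (ae_eq_refl _) (κ := P.γ + c.lam₂₂)
      (ξ := fun ω => X.lin P.p₀ (c.vecζ P) ω + -(c.lam₂₁ + 2 * P.γ)) (fun t => by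
        refine Filter.Eventually.of_forall fun ω => ?_
        simp only [objectiveHFT₂_eq, vecζ]
        ring) hix hia
    obtain ⟨h₄, h₅⟩ := hX.covLin_eq_zero_of_condExp_affine hle (c.vecζ P)
      ((2 * (P.γ + c.lam₂₂)) • (c.β₂₁ • c.vecξ P + c.β₂₂ • vecU₁p)) _
      (2 * (P.γ + c.lam₂₂) * c.β₂₃) (h₂.trans (by
        refine Filter.Eventually.of_forall fun ω => ?_
        simp only [lin_smul, orderX₂_eq, lin_add]
        ring))
    have h₆ := h₅ _ hξ
    have h₇ := h₅ _ hu
    simp only [MarketParams.covLin_sub_left, cov_ζ_ξ, cov_ζ_u₁p, MarketParams.covLin_smul_left,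
      MarketParams.covLin_add_left, cov_ξ_ξ, cov_ξ_u₁p, P.covLin_comm c.σz vecU₁p (c.vecξ P),
      cov_u₁p_u₁p] at h₆ h₇
    refine ⟨?_, ?_, h₄.symm⟩
    · rw [hVξ, hVη, hC]; linear_combination -h₆
    · have : P.σ₁p ^ 2 ≠ 0 := by positivity
      refine mul_right_cancel₀ this ?_
      linear_combination -h₇
  · rintro ⟨h₁, h₂, h₃⟩ x₁ hx₁ hint
    rw [y₁_eq, signal_eq] at hx₁
    have hle : infoOf (X.lin P.p₀ c.vecSignal) ⊔ infoOf (X.lin P.p₀ c.vecY₁) ⊔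
        infoOf (X.y₁p x₁) ≤ m₀ := (c.infoOf_HFT_le P hx₁).trans
      (iSup_le fun j => infoOf_le (hX.measurable_lin _))
    have hle' := c.infoOf_HFT_le P hx₁
    set m := infoOf (X.lin P.p₀ c.vecSignal) ⊔ infoOf (X.lin P.p₀ c.vecY₁) ⊔
        infoOf (X.y₁p x₁) with hm
    have hξ : Measurable[m] (X.lin P.p₀ (c.vecξ P)) := c.measurable_ξ P
      ((measurable_infoOf _).mono (le_sup_left.trans le_sup_left) le_rfl)
      ((measurable_infoOf _).mono (le_sup_right.trans le_sup_left) le_rfl)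
    have hx₁' : Measurable[m] x₁ := hx₁.mono le_sup_left le_rfl
    have hu : Measurable[m] (X.lin P.p₀ vecU₁p) := hu' hx₁'
      ((measurable_infoOf _).mono le_sup_right le_rfl)
    have hlin := measurable_lin_add (measurable_lin_smul c.β₂₁ hξ) (measurable_lin_smul c.β₂₂ hu)
    -- Strict concavity is inherited from the informed trader's condition `λ₂₂ > 0`, so the HFT's
    -- second stage adds no inequality of its own.
    have hκ : 0 < P.γ + c.lam₂₂ := by linarith [P.γ_nonneg]
    have hx₂ : Measurable[m] ((c.profile P).orderX₂ X ((c.profile P).orderI₁ X) x₁) := by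
      rw [funext (c.orderX₂_eq P X _)]
      exact hlin.add (hx₁'.const_mul _)
    refine isArgmax_of_quadratic hle (fun x' => c.objectiveHFT₂_eq P X x₁ x') hκ
      hx₂.stronglyMeasurable.aestronglyMeasurable
      (hx₁'.const_mul _).stronglyMeasurable.aestronglyMeasurable
      ((hx₁'.pow_const 2).const_mul (-P.γ)).stronglyMeasurable.aestronglyMeasurable
      (hX.integrable_lin _) (integrable_const 0) hint ?_
    have hce := hX.condExp_lin (c.vecζ P)
      ((2 * (P.γ + c.lam₂₂)) • (c.β₂₁ • c.vecξ P + c.β₂₂ • vecU₁p)) _ hle'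
      (measurable_lin_smul _ hlin) (by
        simp only [Fin.forall_fin_succ, IsEmpty.forall_iff, and_true,
          Matrix.cons_val_zero, Matrix.cons_val_succ, MarketParams.covLin_sub_left, cov_ζ_ξ,
          cov_ζ_u₁p, cov_ζ_y₁ c P hd, MarketParams.covLin_smul_left, MarketParams.covLin_add_left,
          cov_ξ_ξ, cov_ξ_u₁p, P.covLin_comm c.σz vecU₁p (c.vecξ P), cov_u₁p_u₁p,
          P.covLin_comm c.σz vecU₁p c.vecY₁,
          P.covLin_comm c.σz (c.vecξ P) c.vecY₁, cov_y₁_ξ, cov_y₁_u₁p]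
        refine ⟨?_, by ring, ?_⟩
        · rw [hVξ, hVη, hC] at h₁; linear_combination -h₁
        · linear_combination -P.σ₁p ^ 2 * h₂)
    filter_upwards [hce] with ω h
    rw [← vecζ, h, orderX₂_eq, lin_smul]
    linear_combination -x₁ ω * h₃

/-- The HFT's conditions at time `1₊`. -/
theorem hft₁_iff (hX : X.IsMarket P c.σz μ)
    (hd : c.lam₁ * (c.α₁ ^ 2 * P.σv ^ 2 + c.σz ^ 2 + P.σ₁ ^ 2) = c.α₁ * P.σv ^ 2)
    {C Vη Vξ κ : ℝ} (hC : C = c.α₁ * P.σv ^ 2 * (1 - c.m P))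
    (hVη : Vη = (c.α₁ ^ 2 * P.σv ^ 2 + c.σz ^ 2) * (1 - c.m P)) (hVξ : Vξ = Vη + P.σε ^ 2)
    (hκ : κ = c.lam₁p + c.β₂₃ * c.lam₂₁ + c.lam₂₂ * c.β₂₃ ^ 2 + P.γ * (1 + c.β₂₃) ^ 2) :
    (letI i₁ := (c.profile P).orderI₁ X;
      IsArgmax μ (infoOf (X.signal i₁) ⊔ infoOf (X.y₁ i₁)) ((c.profile P).objectiveHFT X P.γ)
        ((c.profile P).orderX₁ X i₁)) ↔
    0 < κ ∧ (1 + c.β₂₃) * C - c.β₂₃ * c.lam₂₂ * (c.α₂₁ * C + c.α₂₂ * Vη) -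
      (c.lam₂₁ + 2 * c.lam₂₂ * c.β₂₃ + 2 * P.γ * (1 + c.β₂₃)) * c.β₂₁ * Vξ =
        2 * κ * c.β₁₁ * Vξ := by
  simp only [y₁_eq, signal_eq, orderX₁_eq]
  have hle : infoOf (X.lin P.p₀ c.vecSignal) ⊔ infoOf (X.lin P.p₀ c.vecY₁) ≤ m₀ :=
    sup_le (infoOf_le (hX.measurable_lin _)) (infoOf_le (hX.measurable_lin _))
  set a : Fin 6 → ℝ := (1 + c.β₂₃) • c.vecν - (c.lam₁p + c.β₂₃ * c.lam₂₁) • vecU₁p -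
      (c.β₂₃ * c.lam₂₂) • (c.vecI₂ P + vecU₂) -
      (c.lam₂₁ + 2 * c.lam₂₂ * c.β₂₃ + 2 * P.γ * (1 + c.β₂₃)) •
        (c.β₂₁ • c.vecξ P + c.β₂₂ • vecU₁p) with ha
  -- By the normal equation for `λ₁`, the marginal payoff at `1₊` is uncorrelated with `y₁`, so its
  -- projection on the HFT's information is a multiple of the signal surprise alone.
  have hay : P.covLin c.σz a c.vecY₁ = 0 := by
    simp only [ha, vecI₂, MarketParams.covLin_sub_left, MarketParams.covLin_add_left,
      MarketParams.covLin_smul_left, P.covLin_comm c.σz (c.vecη P) c.vecY₁,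
    P.covLin_comm c.σz vecU₁p c.vecY₁, P.covLin_comm c.σz vecU₂ c.vecY₁,
    P.covLin_comm c.σz (c.vecξ P) c.vecY₁, cov_y₁_η, cov_y₁_u₁p,
      cov_y₁_u₂, cov_y₁_ξ]
    rw [cov_ν_y₁]
    linear_combination (-(1 + c.β₂₃) + c.β₂₃ * c.lam₂₂ * c.α₂₁) * hd
  have haξ : P.covLin c.σz a (c.vecξ P) =
      (1 + c.β₂₃) * C - c.β₂₃ * c.lam₂₂ * (c.α₂₁ * C + c.α₂₂ * Vη) -
      (c.lam₂₁ + 2 * c.lam₂₂ * c.β₂₃ + 2 * P.γ * (1 + c.β₂₃)) * c.β₂₁ * Vξ := by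
    simp only [ha, vecI₂, MarketParams.covLin_sub_left, MarketParams.covLin_add_left,
      MarketParams.covLin_smul_left, cov_ν_ξ, cov_η_ξ, P.covLin_comm c.σz vecU₁p (c.vecξ P),
      P.covLin_comm c.σz vecU₂ (c.vecξ P), cov_ξ_u₁p, cov_ξ_u₂, cov_ξ_ξ]
    rw [hVξ, hVη, hC]
    ring
  rw [← haξ]
  have hVξ' : P.covLin c.σz (c.vecξ P) (c.vecξ P) = Vξ := by rw [cov_ξ_ξ, hVξ, hVη]
  -- The part of the payoff that does not depend on `x₁`.
  have hCi : Integrable (fun ω => X.lin P.p₀ (c.vecν - c.lam₂₁ • vecU₁p - c.lam₂₂ • c.vecI₂ P -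
        c.lam₂₂ • vecU₂ - (P.γ + c.lam₂₂) • (c.β₂₁ • c.vecξ P + c.β₂₂ • vecU₁p)) ω *
      X.lin P.p₀ (c.β₂₁ • c.vecξ P + c.β₂₂ • vecU₁p) ω) μ :=
    (hX.memLp_lin _).integrable_mul (hX.memLp_lin _)
  have hint : Integrable ((c.profile P).objectiveHFT X P.γ (X.lin P.p₀ (c.β₁₁ • c.vecξ P))) μ := by
    rw [objectiveHFT_eq]
    exact integrable_quadratic _ (hX.memLp_lin _) (hX.memLp_lin _) (memLp_const 0)
      (integrable_const 0) hCi
  have hix := hX.integrable_lin (c.β₁₁ • c.vecξ P)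
  have hia := hX.integrable_lin a
  set m := infoOf (X.lin P.p₀ c.vecSignal) ⊔ infoOf (X.lin P.p₀ c.vecY₁) with hm
  have hy : Measurable[m] (X.lin P.p₀ c.vecY₁) := (measurable_infoOf _).mono le_sup_right le_rfl
  have hξ : Measurable[m] (X.lin P.p₀ (c.vecξ P)) :=
    c.measurable_ξ P ((measurable_infoOf _).mono le_sup_left le_rfl) hy
  constructor
  · intro h
    obtain ⟨h₁, h₂⟩ := h.quadratic hle (measurable_lin_smul _ hξ) (ae_eq_refl _) (κ := κ)
      (ξ := X.lin P.p₀ a) (fun t => by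
        refine Filter.Eventually.of_forall fun ω => ?_
        simp only [objectiveHFT_eq, hκ, ← ha]
        ring) hix hia
    refine ⟨h₁, ?_⟩
    have h₃ := (hX.covLin_eq_zero_of_condExp hle a ((2 * κ) • c.β₁₁ • c.vecξ P) 0 (h₂.trans (by
        refine Filter.Eventually.of_forall fun ω => ?_
        simp only [lin_smul]
        ring))).2 _ hξ
    simp only [MarketParams.covLin_sub_left, MarketParams.covLin_smul_left, hVξ'] at h₃
    linarith
  · rintro ⟨h₁, h₂⟩
    refine isArgmax_of_quadratic hle (fun x' => c.objectiveHFT_eq P X x') (hκ ▸ h₁)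
      (measurable_lin_smul _ hξ).stronglyMeasurable.aestronglyMeasurable
      (measurable_const (a := (0 : ℝ))).stronglyMeasurable.aestronglyMeasurable
      (measurable_const (a := (0 : ℝ))).stronglyMeasurable.aestronglyMeasurable
      (hX.integrable_lin _) hCi hint ?_
    have hce : μ[X.lin P.p₀ a | m] =ᵐ[μ] X.lin P.p₀ ((2 * κ) • c.β₁₁ • c.vecξ P) :=
      hX.condExp_lin a ((2 * κ) • c.β₁₁ • c.vecξ P) ![c.vecξ P, c.vecY₁]
      (sup_le (infoOf_le (c.measurable_signal P
        ((measurable_infoOf _).mono (le_iSup (fun j => infoOf (X.lin P.p₀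
          ((![c.vecξ P, c.vecY₁] : Fin 2 → Fin 6 → ℝ) j))) 0) le_rfl)
        ((measurable_infoOf _).mono (le_iSup (fun j => infoOf (X.lin P.p₀
          ((![c.vecξ P, c.vecY₁] : Fin 2 → Fin 6 → ℝ) j))) 1) le_rfl)))
        (le_iSup (fun j => infoOf (X.lin P.p₀
          ((![c.vecξ P, c.vecY₁] : Fin 2 → Fin 6 → ℝ) j))) 1))
      (measurable_lin_smul _ (measurable_lin_smul _ hξ)) (by
        simp only [Fin.forall_fin_succ, IsEmpty.forall_iff, and_true,
          Matrix.cons_val_zero, Matrix.cons_val_succ, MarketParams.covLin_sub_left, hay,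
          MarketParams.covLin_smul_left, hVξ',
          P.covLin_comm c.σz (c.vecξ P) c.vecY₁, cov_y₁_ξ]
        exact ⟨by linarith, by ring⟩)
    filter_upwards [hce] with ω h
    rw [← ha, h, lin_smul, hκ]
    ring

/-- The conditions common to mixed- and pure-strategy equilibria, for a linear profile. -/
theorem isContinuationEquilibrium_iff (hX : X.IsMarket P c.σz μ) :
    IsContinuationEquilibrium μ X P.γ (c.profile P) ↔
      ContinuationConditions (P.σv ^ 2) (c.σz ^ 2) (P.σε ^ 2) (P.σ₁ ^ 2) (P.σ₁p ^ 2) (P.σ₂ ^ 2) P.γ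
        c.lam₁ c.lam₁p c.lam₂₁ c.lam₂₂ c.α₁ c.α₂₁ c.α₂₂ c.β₁₁ c.β₂₁ c.β₂₂ c.β₂₃ := by
  have hm : c.m P = (c.α₁ ^ 2 * P.σv ^ 2 + c.σz ^ 2) /
    (c.α₁ ^ 2 * P.σv ^ 2 + c.σz ^ 2 + P.σ₁ ^ 2) := rfl
  have hI₁ : MemLp ((c.profile P).orderI₁ X) 2 μ := by rw [orderI₁_eq]; exact hX.memLp_lin _
  have hX₁ : MemLp ((c.profile P).orderX₁ X ((c.profile P).orderI₁ X)) 2 μ := by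
    rw [orderX₁_eq]; exact hX.memLp_lin _
  have hD := c.dealers_iff hX rfl rfl rfl rfl rfl rfl rfl rfl rfl
  have hI := c.it₂_iff hX
  simp only [ContinuationConditions, ← hm]
  constructor
  · intro h
    -- The HFT's criteria are available only after the first pricing equation and, for the second
    -- stage, `λ₂₂ > 0` have been extracted.
    have h₁ := hD.1 ⟨h.dealers₁, h.dealers₁p, h.dealers₂⟩
    have h₂ := hI.1 h.it₂
    exact ⟨h₁, h₂, (c.hft₂_iff hX h₁.1 h₂.1 rfl rfl rfl).1 h.hft₂,
      (c.hft₁_iff hX h₁.1 rfl rfl rfl rfl).1 h.hft₁⟩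
  · rintro ⟨h₁, h₂, h₃, h₄⟩
    have h₁' := hD.2 h₁
    exact ⟨h₁'.1, h₁'.2.1, h₁'.2.2, c.integrable_profitIT₂ hX hI₁ (c.memLp_orderI₂ hX hI₁),
      hI.2 h₂, c.integrable_objectiveHFT₂ hX hX₁ (c.memLp_orderX₂ hX hX₁),
      (c.hft₂_iff hX h₁.1 h₂.1 rfl rfl rfl).2 h₃, (c.hft₁_iff hX h₁.1 rfl rfl rfl rfl).2 h₄⟩

end LinearCoeffs

/-! ### The informed trader's first-stage problem -/

namespace LinearCoeffs

open Primitives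

section

variable (c : LinearCoeffs) (P : MarketParams)

/-- The response of the IT's order at time `2` to her order at time `1`. -/
noncomputable def response : ℝ := c.α₂₂ * (1 - c.m P) - c.α₂₁ * c.lam₁

/-- The curvature of the IT's total payoff in her order at time `1`. -/
noncomputable def curvatureIT : ℝ := c.lam₁ - c.lam₂₂ * c.response P ^ 2

/-- The coefficient of the linear term in `i₁` of the total profit, once the optimal `i₂` is
inserted. -/
noncomputable def vecIT : Fin 6 → ℝ :=
  (1 + c.response P) • vecV - (c.lam₁ + 2 * c.lam₂₂ * c.response P *
    (c.α₂₁ * c.lam₁ + c.α₂₂ * c.m P)) • ![0, 0, 0, 1, 0, 0] + c.response P • c.vecNoise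

/-- The part of `i₂` that does not depend on `i₁`. -/
noncomputable def vecIT' : Fin 6 → ℝ :=
  ![c.α₂₁, 0, 0, -(c.α₂₁ * c.lam₁ + c.α₂₂ * c.m P), 0, 0]

end

variable {Ω : Type*} {m₀ : MeasurableSpace Ω} {μ : Measure Ω} [IsProbabilityMeasure μ]
  {P : MarketParams} {X : Primitives Ω} (c : LinearCoeffs)

/-- The IT's total payoff is quadratic in her order at time `1`. -/
theorem profitIT_eq {Ω : Type*} (P : MarketParams) (X : Primitives Ω)
    (h₁ : 2 * c.lam₂₂ * c.α₂₁ = 1) (h₂ : 2 * c.lam₂₂ * c.α₂₂ = -c.q) (i : Ω → ℝ) :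
    (c.profile P).profitIT X i = fun ω => i ω * (X.lin P.p₀ (c.vecIT P) ω + 0) -
      c.curvatureIT P * i ω ^ 2 + 0 + X.lin P.p₀ (c.lam₂₂ • c.vecIT' P + c.vecNoise) ω *
        X.lin P.p₀ (c.vecIT' P) ω := by
  ext ω
  have hu : X.lin P.p₀ ![0, 0, 0, 1, 0, 0] ω = X.u₁ ω := by simp [lin_apply]
  have hI : X.lin P.p₀ (c.vecIT' P) ω = c.α₂₁ * X.lin P.p₀ vecV ω -
      (c.α₂₁ * c.lam₁ + c.α₂₂ * c.m P) * X.u₁ ω := by simp [lin_apply, vecIT', vecV]; ring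
  simp only [StrategyProfile.profitIT, profitIT₂_eq, orderI₂_apply, StrategyProfile.profitIT₁,
    StrategyProfile.price₁, vecIT, lin_sub, lin_add, lin_smul, hu, hI, v_eq P X ω]
  -- With the second-stage first-order conditions inserted, the second-stage profit is `λ₂₂ i₂²`
  -- plus noise times `i₂`, and `i₂` is affine in `i₁` with slope `response`.
  have hq : c.q = -(2 * c.lam₂₂ * c.α₂₂) := by linarith
  simp only [profile, Primitives.y₁, curvatureIT, response, hq]
  linear_combination (-(c.α₂₁ * (X.lin P.p₀ vecV ω - c.lam₁ * (i ω + X.u₁ ω)) +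
      c.α₂₂ * (i ω - c.m P * (i ω + X.u₁ ω))) * (X.lin P.p₀ vecV ω - c.lam₁ * (i ω + X.u₁ ω)) +
    (c.α₂₂ * (1 - c.m P) - c.α₂₁ * c.lam₁) * X.lin P.p₀ vecV ω * i ω) * h₁

theorem condExp_vecIT (hX : X.IsMarket P c.σz μ) :
    μ[X.lin P.p₀ (c.vecIT P) | infoOf X.v] =ᵐ[μ] X.lin P.p₀ ((1 + c.response P) • vecV) := by
  have hv : infoOf X.v = infoOf (X.lin P.p₀ vecV) :=
    infoOf_eq_of_comp (φ := fun x => P.p₀ + x) (ψ := fun x => x - P.p₀) (by fun_prop) (by fun_prop)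
      (funext fun ω => v_eq P X ω) (funext fun ω => by simp [v_eq P X ω])
  rw [hv]
  refine hX.condExp_lin _ _ ![vecV] (le_iSup (fun j => infoOf (X.lin P.p₀
    ((![vecV] : Fin 1 → Fin 6 → ℝ) j))) 0) (measurable_lin_smul _ (measurable_infoOf _)) ?_
  intro j
  fin_cases j
  simp [MarketParams.covLin_apply, vecIT, vecV, vecNoise]

theorem integrable_profitIT (hX : X.IsMarket P c.σz μ) (h₁ : 2 * c.lam₂₂ * c.α₂₁ = 1)
    (h₂ : 2 * c.lam₂₂ * c.α₂₂ = -c.q) {i : Ω → ℝ} (hi : MemLp i 2 μ) :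
    Integrable ((c.profile P).profitIT X i) μ := by
  rw [c.profitIT_eq P X h₁ h₂]
  exact integrable_quadratic _ hi (hX.memLp_lin _) (memLp_const 0) (integrable_const 0)
    ((hX.memLp_lin _).integrable_mul (hX.memLp_lin _))

theorem condExp_profitIT (hX : X.IsMarket P c.σz μ) (h₁ : 2 * c.lam₂₂ * c.α₂₁ = 1)
    (h₂ : 2 * c.lam₂₂ * c.α₂₂ = -c.q) {i : Ω → ℝ} (hi : Measurable[infoOf X.v] i)
    (hint : Integrable ((c.profile P).profitIT X i) μ) :
    μ[(c.profile P).profitIT X i | infoOf X.v] =ᵐ[μ] fun ω =>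
      i ω * ((1 + c.response P) * X.lin P.p₀ vecV ω) - c.curvatureIT P * i ω ^ 2 +
        (μ[fun ω => X.lin P.p₀ (c.lam₂₂ • c.vecIT' P + c.vecNoise) ω *
        X.lin P.p₀ (c.vecIT' P) ω | infoOf X.v]) ω := by
  rw [c.profitIT_eq P X h₁ h₂] at hint ⊢
  have hi₁ := hX.integrable_lin (c.vecIT P)
  have hi₂ : Integrable (fun ω => X.lin P.p₀ (c.lam₂₂ • c.vecIT' P + c.vecNoise) ω *
        X.lin P.p₀ (c.vecIT' P) ω) μ := (hX.memLp_lin _).integrable_mul (hX.memLp_lin _)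
  have h0 : AEStronglyMeasurable[infoOf X.v] (fun _ : Ω => (0 : ℝ)) μ :=
    stronglyMeasurable_const.aestronglyMeasurable
  filter_upwards [condExp_quadratic (infoOf_le hX.measurable_v)
    hi.stronglyMeasurable.aestronglyMeasurable h0 h0 hi₁ hi₂ hint, c.condExp_vecIT hX]
    with ω h₁ h₂
  rw [h₁, h₂, lin_smul]
  ring

theorem lin_ae_eq_zero {σz : ℝ} (hX : X.IsMarket P σz μ) {a : Fin 6 → ℝ}
    (h : P.covLin σz a a = 0) : X.lin P.p₀ a =ᵐ[μ] 0 := by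
  rw [← hX.integral_lin_mul_lin, integral_eq_zero_iff_of_nonneg (fun ω => mul_self_nonneg _)
    ((hX.memLp_lin _).integrable_mul (hX.memLp_lin _))] at h
  filter_upwards [h] with ω h
  exact mul_self_eq_zero.1 h

/-- The IT's indifference condition. -/
theorem indifferent_iff (hX : X.IsMarket P c.σz μ) (h₁ : 2 * c.lam₂₂ * c.α₂₁ = 1)
    (h₂ : 2 * c.lam₂₂ * c.α₂₂ = -c.q) :
    (∀ i₁ i₁' : Ω → ℝ, Measurable[infoOf X.v] i₁ → Measurable[infoOf X.v] i₁' →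
      Integrable ((c.profile P).profitIT X i₁) μ → Integrable ((c.profile P).profitIT X i₁') μ →
      μ[(c.profile P).profitIT X i₁ | infoOf X.v] =ᵐ[μ]
        μ[(c.profile P).profitIT X i₁' | infoOf X.v]) ↔
    c.curvatureIT P = 0 ∧ 1 + c.response P = 0 := by
  constructor
  · intro h
    have hi : ∀ t : ℝ, Integrable ((c.profile P).profitIT X fun _ => t) μ := fun t =>
      c.integrable_profitIT hX h₁ h₂ (memLp_const t)
    have hce := fun t : ℝ => c.condExp_profitIT hX h₁ h₂ (i := fun _ => t) measurable_const (hi t)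
    -- Comparing the constant orders `1` and `-1` with `0` isolates curvature and slope.
    have key : ∀ᵐ ω ∂μ, (1 + c.response P) * X.lin P.p₀ vecV ω - c.curvatureIT P = 0 ∧
        -((1 + c.response P) * X.lin P.p₀ vecV ω) - c.curvatureIT P = 0 := by
      filter_upwards [hce 0, hce 1, hce (-1),
        h _ (fun _ => 0) measurable_const measurable_const (hi 1) (hi 0),
        h _ (fun _ => 0) measurable_const measurable_const (hi (-1)) (hi 0)] with ω k₁ k₂ k₃ k₄ k₅
      rw [k₁, k₂] at k₄
      rw [k₁, k₃] at k₅
      constructor <;> linarith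
    obtain ⟨ω, hω⟩ := key.exists
    have hκ : c.curvatureIT P = 0 := by linarith [hω.1, hω.2]
    refine ⟨hκ, ?_⟩
    -- The slope is a multiple of `v - p₀` that vanishes almost surely; pairing with `v - p₀`, whose
    -- variance is positive, kills the factor.
    have h0 : ∫ ω, X.lin P.p₀ ((1 + c.response P) • vecV) ω * X.lin P.p₀ vecV ω ∂μ = 0 := by
      rw [← integral_zero Ω ℝ (μ := μ)]
      refine integral_congr_ae ?_
      filter_upwards [key] with ω h
      rw [lin_smul]
      rw [hκ, sub_zero] at h
      rw [h.1, zero_mul]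
    rw [hX.integral_lin_mul_lin] at h0
    have := P.σv_pos
    simpa [MarketParams.covLin_apply, vecV, this.ne'] using h0
  · rintro ⟨h₃, h₄⟩ i i' hi hi' hint hint'
    filter_upwards [c.condExp_profitIT hX h₁ h₂ hi hint,
      c.condExp_profitIT hX h₁ h₂ hi' hint'] with ω k₁ k₂
    rw [k₁, k₂, h₃, h₄]
    ring

/-- The IT's optimality condition at time `1`. -/
theorem it₁_iff (hX : X.IsMarket P c.σz μ) (hσ : c.σz = 0) (h₁ : 2 * c.lam₂₂ * c.α₂₁ = 1)
    (h₂ : 2 * c.lam₂₂ * c.α₂₂ = -c.q) :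
    IsArgmax μ (infoOf X.v) ((c.profile P).profitIT X) ((c.profile P).orderI₁ X) ↔
    0 < c.curvatureIT P ∧ 1 + c.response P = 2 * c.curvatureIT P * c.α₁ := by
  have hle : infoOf X.v ≤ m₀ := infoOf_le hX.measurable_v
  have hV : Measurable[infoOf X.v] (X.lin P.p₀ vecV) := by
    have : X.lin P.p₀ vecV = fun ω => X.v ω - P.p₀ := by ext ω; simp [v_eq P X ω]
    rw [this]; exact (measurable_infoOf _).sub_const _
  have hx₀ : Measurable[infoOf X.v] (X.lin P.p₀ (c.α₁ • vecV)) := measurable_lin_smul _ hV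
  -- The prescribed order contains `z` and is a function of `v` only up to a null set: `σz = 0`
  -- makes `z` vanish almost surely. Deviations are therefore built from the `v`-measurable version.
  have hxx₀ : (c.profile P).orderI₁ X =ᵐ[μ] X.lin P.p₀ (c.α₁ • vecV) := by
    rw [orderI₁_eq]
    filter_upwards [lin_ae_eq_zero hX (a := ![0, 1, 0, 0, 0, 0])
      (by simp [MarketParams.covLin_apply, hσ])] with ω h
    have : X.lin P.p₀ ![c.α₁, 1, 0, 0, 0, 0] ω =
        X.lin P.p₀ (c.α₁ • vecV) ω + X.lin P.p₀ ![0, 1, 0, 0, 0, 0] ω := by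
      simp [lin_apply, vecV]
    rw [this, h, Pi.zero_apply, add_zero]
  constructor
  · intro h
    obtain ⟨h₃, h₄⟩ := h.quadratic hle hx₀ hxx₀ (κ := c.curvatureIT P)
      (ξ := X.lin P.p₀ (c.vecIT P)) (fun t => by
        filter_upwards [hxx₀] with ω h
        simp only [c.profitIT_eq P X h₁ h₂, h]
        ring) (hX.integrable_lin _) (hX.integrable_lin _)
    refine ⟨h₃, ?_⟩
    have h₅ := (hX.covLin_eq_zero_of_condExp hle (c.vecIT P)
      ((2 * c.curvatureIT P * c.α₁) • vecV) 0 (h₄.trans (by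
        refine Filter.Eventually.of_forall fun ω => ?_
        simp only [lin_smul]
        ring))).2 _ hV
    have := P.σv_pos
    have h₆ : 1 + c.response P - 2 * c.curvatureIT P * c.α₁ = 0 := by
      simpa [MarketParams.covLin_apply, vecIT, vecV, vecNoise, this.ne'] using h₅
    linarith
  · rintro ⟨h₃, h₄⟩
    have h0 : AEStronglyMeasurable[infoOf X.v] (fun _ : Ω => (0 : ℝ)) μ :=
      stronglyMeasurable_const.aestronglyMeasurable
    have hI : MemLp ((c.profile P).orderI₁ X) 2 μ := by rw [orderI₁_eq]; exact hX.memLp_lin _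
    refine isArgmax_of_quadratic hle (fun x' => c.profitIT_eq P X h₁ h₂ x') h₃
      ⟨_, hx₀.stronglyMeasurable, hxx₀⟩ h0 h0 (hX.integrable_lin _)
      ((hX.memLp_lin _).integrable_mul (hX.memLp_lin _)) (c.integrable_profitIT hX h₁ h₂ hI) ?_
    filter_upwards [c.condExp_vecIT hX, hxx₀] with ω k₁ k₂
    rw [k₁, k₂, lin_smul, lin_smul, h₄]
    ring

end LinearCoeffs

/-! ### Changes of units and dimensionless conditions -/

theorem eq_iff_eq_of_eq_mul {x y x' y' k : ℝ} (hk : k ≠ 0) (hx : x = k * x') (hy : y = k * y') :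
    x = y ↔ x' = y' := by rw [hx, hy, mul_right_inj' hk]

/-- The conditions are invariant under changes of the units of the value and of the orders. -/
theorem continuationConditions_scale {a b : ℝ} (ha : 0 < a) (hb : 0 < b)
    (τ e n₁p n₂ γ l₁ l₁p l₂₁ l₂₂ α α₂₁ α₂₂ β₁₁ β₂₁ β₂₂ β₂₃ : ℝ) :
    ContinuationConditions (a ^ 2) (τ * b ^ 2) (e * b ^ 2) (b ^ 2) (n₁p * b ^ 2) (n₂ * b ^ 2)
      (γ * (a / b)) (l₁ * (a / b)) (l₁p * (a / b)) (l₂₁ * (a / b)) (l₂₂ * (a / b)) (α * (b / a))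
      (α₂₁ * (b / a)) α₂₂ β₁₁ β₂₁ β₂₂ β₂₃ ↔
    ContinuationConditions 1 τ e 1 n₁p n₂ γ l₁ l₁p l₂₁ l₂₂ α α₂₁ α₂₂ β₁₁ β₂₁ β₂₂ β₂₃ := by
  have ha' := ha.ne'
  have hb' := hb.ne'
  have hab : 0 < a / b := div_pos ha hb
  -- The regression coefficient of `i₁` on `y₁` is free of units; each of the remaining conditions
  -- merely acquires a nonzero factor, positive for the inequalities.
  have hm : ((α * (b / a)) ^ 2 * a ^ 2 + τ * b ^ 2) /
      ((α * (b / a)) ^ 2 * a ^ 2 + τ * b ^ 2 + b ^ 2) = (α ^ 2 * 1 + τ) / (α ^ 2 * 1 + τ + 1) := by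
    have h₁ : (α * (b / a)) ^ 2 * a ^ 2 + τ * b ^ 2 = b ^ 2 * (α ^ 2 * 1 + τ) := by
      field_simp
    have h₂ : (α * (b / a)) ^ 2 * a ^ 2 + τ * b ^ 2 + b ^ 2 = b ^ 2 * (α ^ 2 * 1 + τ + 1) := by
      rw [h₁]; ring
    rw [h₂, h₁, mul_div_mul_left _ _ (by positivity)]
  simp only [ContinuationConditions, hm]
  generalize (α ^ 2 * 1 + τ) / (α ^ 2 * 1 + τ + 1) = m
  refine and_congr (and_congr ?_ (and_congr ?_ (and_congr ?_ ?_)))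
    (and_congr (and_congr ?_ (and_congr ?_ ?_)) (and_congr (and_congr ?_ (and_congr ?_ ?_))
      (and_congr ?_ ?_)))
  · exact eq_iff_eq_of_eq_mul (mul_ne_zero ha' hb') (by field_simp) (by field_simp)
  · exact eq_iff_eq_of_eq_mul (mul_ne_zero ha' hb') (by field_simp) (by field_simp)
  · exact eq_iff_eq_of_eq_mul (mul_ne_zero ha' hb') (by field_simp) (by field_simp)
  · exact eq_iff_eq_of_eq_mul (mul_ne_zero ha' hb') (by field_simp) (by field_simp)
  · exact mul_pos_iff_of_pos_right hab
  · exact eq_iff_eq_of_eq_mul one_ne_zero (by field_simp) (by ring)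
  · exact eq_iff_eq_of_eq_mul hab.ne' (by field_simp) (by field_simp)
  · exact eq_iff_eq_of_eq_mul (mul_ne_zero ha' hb') (by field_simp) (by field_simp)
  · exact eq_iff_eq_of_eq_mul hab.ne' (by field_simp) (by field_simp)
  · exact eq_iff_eq_of_eq_mul hab.ne' (by field_simp) (by field_simp)
  · refine Iff.trans (iff_of_eq ?_) (mul_pos_iff_of_pos_right hab)
    congr 1
    ring
  · exact eq_iff_eq_of_eq_mul (mul_ne_zero ha' hb') (by field_simp) (by field_simp)

namespace LinearCoeffs

variable (c : LinearCoeffs) (P : MarketParams)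

/-- The conditions in terms of dimensionless quantities. -/
theorem continuationConditions_iff :
    ContinuationConditions (P.σv ^ 2) (c.σz ^ 2) (P.σε ^ 2) (P.σ₁ ^ 2) (P.σ₁p ^ 2) (P.σ₂ ^ 2) P.γ
      c.lam₁ c.lam₁p c.lam₂₁ c.lam₂₂ c.α₁ c.α₂₁ c.α₂₂ c.β₁₁ c.β₂₁ c.β₂₂ c.β₂₃ ↔
    ContinuationConditions 1 (c.θz P) P.θε 1 P.θp P.θ₂ P.Γ (c.Λ₁ P) (c.Λ₁p P) (c.Λ₂₁ P) (c.Λ₂₂ P)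
      (c.A₁ P) (c.A₂₁ P) c.α₂₂ c.β₁₁ c.β₂₁ c.β₂₂ c.β₂₃ := by
  have ha := P.σv_pos
  have hb := P.σ₁_pos
  have ha' := ha.ne'
  have hb' := hb.ne'
  rw [← continuationConditions_scale ha hb]
  simp only [θz, MarketParams.θε, MarketParams.θp, MarketParams.θ₂, MarketParams.Γ, Λ₁, Λ₁p, Λ₂₁,
    Λ₂₂, A₁, A₂₁]
  rw [div_mul_cancel₀ _ (by positivity), div_mul_cancel₀ _ (by positivity),
    div_mul_cancel₀ _ (by positivity), div_mul_cancel₀ _ (by positivity),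
    div_mul_cancel₀ _ (by positivity), div_mul_cancel₀ _ (by positivity),
    div_mul_cancel₀ _ (by positivity), div_mul_cancel₀ _ (by positivity),
    div_mul_cancel₀ _ (by positivity), div_mul_cancel₀ _ (by positivity),
    div_mul_cancel₀ _ (by positivity)]

theorem m_eq : c.m P = (c.A₁ P ^ 2 + c.θz P) / (c.A₁ P ^ 2 + c.θz P + 1) := by
  have ha := P.σv_pos.ne'
  have hb := P.σ₁_pos.ne'
  have h₁ : c.α₁ ^ 2 * P.σv ^ 2 + c.σz ^ 2 = P.σ₁ ^ 2 * (c.A₁ P ^ 2 + c.θz P) := by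
    simp only [A₁, θz]; field_simp
  rw [m, h₁, show P.σ₁ ^ 2 * (c.A₁ P ^ 2 + c.θz P) + P.σ₁ ^ 2 =
    P.σ₁ ^ 2 * (c.A₁ P ^ 2 + c.θz P + 1) by ring, mul_div_mul_left _ _ (by positivity)]

theorem response_eq : c.response P =
    c.α₂₂ / (c.A₁ P ^ 2 + c.θz P + 1) - c.A₂₁ P * c.Λ₁ P := by
  have ha := P.σv_pos.ne'
  have hb := P.σ₁_pos.ne'
  have hD : c.A₁ P ^ 2 + c.θz P + 1 ≠ 0 := by
    have : 0 ≤ c.θz P := by unfold θz; positivity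
    positivity
  have h : c.α₂₁ * c.lam₁ = c.A₂₁ P * c.Λ₁ P := by
    simp only [A₂₁, Λ₁]; field_simp
  rw [response, h, m_eq]
  field_simp
  ring

theorem curvatureIT_eq : c.curvatureIT P =
    P.σv / P.σ₁ * (c.Λ₁ P - c.Λ₂₂ P * c.response P ^ 2) := by
  have ha := P.σv_pos.ne'
  have hb := P.σ₁_pos.ne'
  simp only [curvatureIT, Λ₁, Λ₂₂]
  field_simp

variable {Ω : Type*} {m₀ : MeasurableSpace Ω} {μ : Measure Ω} [IsProbabilityMeasure μ]
  {P} {X : Primitives Ω}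

theorem isMixedEquilibrium_iff (hX : X.IsMarket P c.σz μ) :
    IsMixedEquilibrium μ X P.γ c.σz (c.profile P) ↔
      ContinuationConditions 1 (c.θz P) P.θε 1 P.θp P.θ₂ P.Γ (c.Λ₁ P) (c.Λ₁p P) (c.Λ₂₁ P) (c.Λ₂₂ P)
        (c.A₁ P) (c.A₂₁ P) c.α₂₂ c.β₁₁ c.β₂₁ c.β₂₂ c.β₂₃ ∧ 0 < c.θz P ∧
      c.Λ₁ P - c.Λ₂₂ P * (c.α₂₂ / (c.A₁ P ^ 2 + c.θz P + 1) - c.A₂₁ P * c.Λ₁ P) ^ 2 = 0 ∧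
      1 + (c.α₂₂ / (c.A₁ P ^ 2 + c.θz P + 1) - c.A₂₁ P * c.Λ₁ P) = 0 := by
  have hv := P.σv_pos
  have h₁ := P.σ₁_pos
  rw [← continuationConditions_iff, ← response_eq]
  have hk : c.curvatureIT P = 0 ↔ c.Λ₁ P - c.Λ₂₂ P * c.response P ^ 2 = 0 := by
    rw [curvatureIT_eq, mul_eq_zero_iff_left (by positivity)]
  have hz : 0 < c.θz P ↔ 0 < c.σz := by
    rw [θz, div_pos_iff_of_pos_right (by positivity), sq_pos_iff]
    exact ⟨fun h => lt_of_le_of_ne hX.σz_nonneg h.symm, ne_of_gt⟩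
  rw [← hk, hz]
  constructor
  · rintro ⟨h, hσ, hi⟩
    have hc := (c.isContinuationEquilibrium_iff hX).1 h
    exact ⟨hc, hσ, (c.indifferent_iff hX hc.2.1.2.1 hc.2.1.2.2).1 hi⟩
  · rintro ⟨hc, hσ, hi⟩
    exact ⟨(c.isContinuationEquilibrium_iff hX).2 hc, hσ,
      (c.indifferent_iff hX hc.2.1.2.1 hc.2.1.2.2).2 hi⟩

theorem isPureEquilibrium_iff (hX : X.IsMarket P c.σz μ) :
    IsPureEquilibrium μ X P.γ c.σz (c.profile P) ↔ c.σz = 0 ∧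
      ContinuationConditions 1 0 P.θε 1 P.θp P.θ₂ P.Γ (c.Λ₁ P) (c.Λ₁p P) (c.Λ₂₁ P) (c.Λ₂₂ P)
        (c.A₁ P) (c.A₂₁ P) c.α₂₂ c.β₁₁ c.β₂₁ c.β₂₂ c.β₂₃ ∧
      0 < c.Λ₁ P - c.Λ₂₂ P * (c.α₂₂ / (c.A₁ P ^ 2 + 1) - c.A₂₁ P * c.Λ₁ P) ^ 2 ∧
      1 + (c.α₂₂ / (c.A₁ P ^ 2 + 1) - c.A₂₁ P * c.Λ₁ P) =
        2 * (c.Λ₁ P - c.Λ₂₂ P * (c.α₂₂ / (c.A₁ P ^ 2 + 1) - c.A₂₁ P * c.Λ₁ P) ^ 2) * c.A₁ P := by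
  have hv := P.σv_pos
  have h₁ := P.σ₁_pos
  have hi := c.isContinuationEquilibrium_iff hX
  rw [continuationConditions_iff] at hi
  have key : c.σz = 0 → (0 < c.curvatureIT P ∧
      1 + c.response P = 2 * c.curvatureIT P * c.α₁ ↔
      0 < c.Λ₁ P - c.Λ₂₂ P * (c.α₂₂ / (c.A₁ P ^ 2 + 1) - c.A₂₁ P * c.Λ₁ P) ^ 2 ∧
      1 + (c.α₂₂ / (c.A₁ P ^ 2 + 1) - c.A₂₁ P * c.Λ₁ P) =
        2 * (c.Λ₁ P - c.Λ₂₂ P * (c.α₂₂ / (c.A₁ P ^ 2 + 1) - c.A₂₁ P * c.Λ₁ P) ^ 2) * c.A₁ P) := by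
    intro h
    have hz : c.θz P = 0 := by simp [θz, h]
    have hr := c.response_eq P
    rw [hz, add_zero] at hr
    rw [← hr, curvatureIT_eq, mul_pos_iff_of_pos_left (by positivity)]
    refine and_congr_right fun _ => iff_of_eq ?_
    congr 1
    simp only [A₁]
    field_simp
  constructor
  · rintro ⟨h, hσ, hm⟩
    have hc := (c.isContinuationEquilibrium_iff hX).1 h
    have hz : c.θz P = 0 := by simp [θz, hσ]
    refine ⟨hσ, hz ▸ hi.1 h, (key hσ).1 ((c.it₁_iff hX hσ hc.2.1.2.1 hc.2.1.2.2).1 hm)⟩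
  · rintro ⟨hσ, hc, hm⟩
    have hz : c.θz P = 0 := by simp [θz, hσ]
    have h := hi.2 (hz.symm ▸ hc)
    have hc := (c.isContinuationEquilibrium_iff hX).1 h
    exact ⟨h, hσ, (c.it₁_iff hX hσ hc.2.1.2.1 hc.2.1.2.2).2 ((key hσ).2 hm)⟩

end LinearCoeffs

/-! ### The mixed-strategy system -/

section MixedAlgebra

variable {θp θ₂ θε Γ A θz β D Y R T K M G₁₁ G₁S VS x h : ℝ}

/-- `G₁₁`, `G₁S`, `VS` play the roles of `Var(y₁₊)`, `Cov(y₁₊, S)`, `Var(S)` for `S = p₂ - p₁`,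
while `βA/D` and `1/2` are the covariances of `y₁₊` and `S` with the value. By Cramer's rule the
last factor vanishes when the regression coefficient of `S` is `1`, that is, when that of `y₂` is
`Λ₂₂`. -/
theorem mixedPoly₁_eq_residuals (hD : D = A ^ 2 + θz + 1)
    (hY : Y = A ^ 2 * (θε + 1) + θε * θz + θε + θz) (hR : R = A ^ 2 * Γ + A + Γ * θz + Γ)
    (hM : M = β ^ 2 * Y + θp * D) (hK : K = 4 * Y * R - A * D + 4 * Γ * Y * β)
    (hD0 : D ≠ 0) (hY0 : Y ≠ 0) (hR0 : R ≠ 0) (hβ : β ≠ 0)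
    (hh : h = A * K / (4 * Y * R * β)) (hG₁₁ : G₁₁ = M / D)
    (hG : G₁S = β * A * (1 / 2 + θε) + h * θp)
    (hV : VS = (1 + A ^ 2) / 4 + A ^ 2 * θε + h ^ 2 * θp + (A / D) ^ 2 * θ₂) :
    mixedPoly₁ θp θ₂ θε Γ A θz β =
      -(16 * R ^ 2 * Y * D ^ 3) * (G₁₁ * (1 / 2 - VS) - G₁S * (β * A / D - G₁S)) := by
  rw [mixedPoly₁_eq θp θ₂ θε Γ A θz β hD hY hR hM hK, hV, hG, hG₁₁, hh]
  have hY' : Y = D - 1 + θε * D := by rw [hY, hD]; ring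
  clear hK hR hD hY hh hG hV hG₁₁
  rw [hM]
  field_simp
  rw [hY']
  ring

/-- With `x` in the role of `Λ₂₁`, the last factor is the Cramer form of the requirement that the
coefficient of `y₁₊` in the regression of the value on `(y₁₊, y₂)` be `x`. -/
theorem mixedPoly₂_eq_residuals (hA : A ≠ 0) (hD : D = A ^ 2 + θz + 1)
    (hY : Y = A ^ 2 * (θε + 1) + θε * θz + θε + θz) (hR : R = A ^ 2 * Γ + A + Γ * θz + Γ)
    (hT : T = 2 * A ^ 2 * Γ + A + 2 * Γ * (θz + 1))
    (hM : M = β ^ 2 * Y + θp * D) (hK : K = 4 * Y * R - A * D + 4 * Γ * Y * β)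
    (hD0 : D ≠ 0) (hY0 : Y ≠ 0) (hR0 : R ≠ 0) (hT0 : T ≠ 0) (hβ : β ≠ 0)
    (hh : h = A * K / (4 * Y * R * β)) (hx : x = A * K / (2 * β * Y * T)) (hG₁₁ : G₁₁ = M / D)
    (hG : G₁S = β * A * (1 / 2 + θε) + h * θp)
    (hV : VS = (1 + A ^ 2) / 4 + A ^ 2 * θε + h ^ 2 * θp + (A / D) ^ 2 * θ₂) :
    mixedPoly₂ θp θ₂ θε Γ A θz β = -(32 * β * D ^ 3 * Y ^ 2 * R ^ 2 * T ^ 2 / A) *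
      ((VS - x * G₁S) * (β * A / D - G₁S) - (G₁S - x * G₁₁) * (1 / 2 - VS)) := by
  have hK' : K = 4 * (θε + 1) * Γ * A ^ 4 + (4 * θε + 3) * A ^ 3 + 4 * Γ * (θε * β + β + 2 * θε +
      2 * θε * θz + 2 * θz + 1) * A ^ 2 + (3 * θz + 4 * θε * (θz + 1) - 1) * A +
      4 * Γ * (β + θz + 1) * (θε * θz + θε + θz) := by
    rw [hK, hY, hR, hD]; ring
  have hM' : M = A ^ 2 * (β ^ 2 * (θε + 1) + θp) + β ^ 2 * (θε * θz + θε + θz) +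
      θp * (θz + 1) := by
    rw [hM, hY, hD]; ring
  rw [mixedPoly₂_eq θp θ₂ θε Γ A θz β hD rfl hY hR hT hK',
    mixedN_eq θp θε Γ A θz β hD rfl hY hR hT hK' hM' hK,
    mixedP_eq θp θ₂ θε Γ A θz β hD hY hR hM hK, hV, hG, hG₁₁, hh, hx]
  -- `Y`, `T`, `θz` and `M` are eliminated in favour of `D`, `R`, `A`; with `K` kept as an
  -- independent variable, the identity becomes small enough for `ring`.
  have hY' : Y = D - 1 + θε * D := by rw [hY, hD]; ring
  have hθz : θz = D - 1 - A ^ 2 := by rw [hD]; ring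
  have hT' : T = 2 * R - A := by rw [hT, hR]; ring
  clear hK hR hY hh hG hV hG₁₁ hK' hM' hT hx
  rw [hM, hθz]
  clear hM hθz hD
  field_simp
  rw [hT', hY']
  ring

/-- The order flow at time `1₊` and the time-`2` price impact are not collinear. -/
theorem mixed_det_pos (hA : A ≠ 0) (hθ₂ : 0 < θ₂) (hθp : 0 < θp) (hθε : 0 ≤ θε) (hθz : 0 ≤ θz)
    (hD : D = A ^ 2 + θz + 1) (hY : Y = A ^ 2 * (θε + 1) + θε * θz + θε + θz)
    (hM : M = β ^ 2 * Y + θp * D) (hG₁₁ : G₁₁ = M / D)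
    (hG : G₁S = β * A * (1 / 2 + θε) + h * θp)
    (hV : VS = (1 + A ^ 2) / 4 + A ^ 2 * θε + h ^ 2 * θp + (A / D) ^ 2 * θ₂) :
    0 < G₁₁ * VS - G₁S ^ 2 := by
  have hD0 : 0 < D := by rw [hD]; positivity
  set a : ℝ := (1 + A ^ 2) / 4 + A ^ 2 * θε with ha
  set y : ℝ := Y / D with hy
  have hG₁₁' : G₁₁ = β ^ 2 * y + θp := by
    rw [hG₁₁, hM, hy]; field_simp
  -- `y` is the variance of the signal surprise, `θε + (D - 1)/D`; it is smallest at `θz = 0`.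
  have hy' : θε + A ^ 2 / (1 + A ^ 2) ≤ y := by
    rw [hy, le_div_iff₀ hD0]
    have : (1 + A ^ 2) ≠ 0 := by positivity
    have h₁ : A ^ 2 / (1 + A ^ 2) * D = A ^ 2 + θz * (A ^ 2 / (1 + A ^ 2)) := by
      rw [hD]; field_simp; ring
    have h₂ : A ^ 2 / (1 + A ^ 2) ≤ 1 := by rw [div_le_one (by positivity)]; linarith
    have h₃ := mul_le_mul_of_nonneg_left h₂ hθz
    rw [add_mul, h₁, hY, hD]
    nlinarith
  -- Cauchy–Schwarz between the signal surprise and the part of `p₂ - p₁` due to `v - p₁` and the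
  -- surprises; the variance of this part is `a`.
  have hc : (A * (1 / 2 + θε)) ^ 2 ≤ a * y := by
    have ha0 : 0 ≤ a := by positivity
    refine le_trans ?_ (mul_le_mul_of_nonneg_left hy' ha0)
    have : a * (θε + A ^ 2 / (1 + A ^ 2)) - (A * (1 / 2 + θε)) ^ 2 =
        θε * (1 - A ^ 2) ^ 2 / (4 * (1 + A ^ 2)) := by
      have : (1 + A ^ 2) ≠ 0 := by positivity
      rw [ha]; field_simp; ring
    have h₁ : 0 ≤ θε * (1 - A ^ 2) ^ 2 / (4 * (1 + A ^ 2)) := by positivity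
    linarith
  have ha0 : 0 < a := by positivity
  have hy0 : 0 ≤ y := le_trans (by positivity) hy'
  have hG0 : 0 < G₁₁ := by rw [hG₁₁']; positivity
  -- A variance, namely that of the difference between `βh` times the signal surprise and that part
  -- of `p₂ - p₁`; multiplying by `a` completes the square.
  have hsq : 0 ≤ β ^ 2 * y * h ^ 2 + a - 2 * (β * (A * (1 / 2 + θε)) * h) := by
    have h₁ : 0 ≤ (a - β * (A * (1 / 2 + θε)) * h) ^ 2 +
        (β * h) ^ 2 * (a * y - (A * (1 / 2 + θε)) ^ 2) := by
      have := mul_nonneg (sq_nonneg (β * h)) (sub_nonneg.2 hc)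
      positivity
    have h₂ : (a - β * (A * (1 / 2 + θε)) * h) ^ 2 +
        (β * h) ^ 2 * (a * y - (A * (1 / 2 + θε)) ^ 2) =
        a * (β ^ 2 * y * h ^ 2 + a - 2 * (β * (A * (1 / 2 + θε)) * h)) := by ring
    rw [h₂] at h₁
    exact nonneg_of_mul_nonneg_right h₁ ha0
  -- Strictness comes from the noise in `y₂`.
  have hpos : 0 < (A / D) ^ 2 * θ₂ * G₁₁ := by positivity
  have key : G₁₁ * VS - G₁S ^ 2 = (A / D) ^ 2 * θ₂ * G₁₁ +
      β ^ 2 * (a * y - (A * (1 / 2 + θε)) ^ 2) +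
      θp * (β ^ 2 * y * h ^ 2 + a - 2 * (β * (A * (1 / 2 + θε)) * h)) := by
    rw [hV, hG, hG₁₁']; ring
  have h₁ := mul_nonneg (sq_nonneg β) (sub_nonneg.2 hc)
  have h₂ := mul_nonneg hθp.le hsq
  rw [key]
  linarith

/-- The two polynomials are nonzero multiples of two linear combinations of the residuals `βA/D -
G₁S` and `1/2 - VS`. The determinant of the combinations is `-(G₁₁ VS - G₁S²)`, in which `x`
cancels. -/
theorem mixedPoly_eq_zero_iff (hA : A ≠ 0) (hθ₂ : 0 < θ₂) (hθp : 0 < θp) (hθε : 0 ≤ θε)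
    (hθz : 0 ≤ θz) (hD : D = A ^ 2 + θz + 1)
    (hY : Y = A ^ 2 * (θε + 1) + θε * θz + θε + θz) (hR : R = A ^ 2 * Γ + A + Γ * θz + Γ)
    (hT : T = 2 * A ^ 2 * Γ + A + 2 * Γ * (θz + 1))
    (hM : M = β ^ 2 * Y + θp * D) (hK : K = 4 * Y * R - A * D + 4 * Γ * Y * β)
    (hD0 : D ≠ 0) (hY0 : Y ≠ 0) (hR0 : R ≠ 0) (hT0 : T ≠ 0) (hβ : β ≠ 0)
    (hh : h = A * K / (4 * Y * R * β))
    (hG : G₁S = β * A * (1 / 2 + θε) + h * θp)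
    (hV : VS = (1 + A ^ 2) / 4 + A ^ 2 * θε + h ^ 2 * θp + (A / D) ^ 2 * θ₂) :
    (0 = mixedPoly₁ θp θ₂ θε Γ A θz β ∧ 0 = mixedPoly₂ θp θ₂ θε Γ A θz β) ↔
      G₁S = β * A / D ∧ VS = 1 / 2 := by
  rw [mixedPoly₁_eq_residuals hD hY hR hM hK hD0 hY0 hR0 hβ hh rfl hG hV,
    mixedPoly₂_eq_residuals hA hD hY hR hT hM hK hD0 hY0 hR0 hT0 hβ hh rfl rfl hG hV]
  constructor
  · rintro ⟨h₁, h₂⟩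
    have h₁' := (mul_eq_zero.1 h₁.symm).resolve_left (by simp [hR0, hY0, hD0])
    have h₂' := (mul_eq_zero.1 h₂.symm).resolve_left (by simp [hR0, hY0, hD0, hA, hT0, hβ])
    have hdet := (mixed_det_pos hA hθ₂ hθp hθε hθz hD hY hM rfl hG hV).ne'
    constructor
    · refine (sub_eq_zero.1 (mul_left_cancel₀ hdet ?_)).symm
      linear_combination (M / D) * h₂' + (G₁S - A * K / (2 * β * Y * T) * (M / D)) * h₁'
    · refine (sub_eq_zero.1 (mul_left_cancel₀ hdet ?_)).symm
      linear_combination (VS - A * K / (2 * β * Y * T) * G₁S) * h₁' + G₁S * h₂'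
  · rintro ⟨h₁, h₂⟩
    rw [h₁, h₂]
    simp

end MixedAlgebra

/-- The conditions for normalised variances of the value and of the first order flow's noise, with
the regression coefficients eliminated. -/
theorem continuationConditions_one_iff {τ e n₁p n₂ γ l₁ l₁p l₂₁ l α α₂₁ α₂₂ β₁₁ β₂₁ β₂₂ β₂₃ : ℝ}
    {D Y M b g G₁₂ G₂₂ κ : ℝ} (hτ : 0 ≤ τ) (hD : D = α ^ 2 + τ + 1)
    (hY : Y = D - 1 + e * D) (hM : M = β₁₁ ^ 2 * Y + n₁p * D) (hb : b = β₂₁ + β₂₃ * β₁₁)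
    (hg : g = γ + l)
    (hG₁₂ : G₁₂ = β₁₁ * (α₂₁ * α + α₂₂ * (D - 1) + b * Y) + β₂₂ * n₁p * D)
    (hG₂₂ : G₂₂ = α₂₁ ^ 2 * (D - α ^ 2) + α₂₂ ^ 2 * (D - 1) + 2 * α₂₁ * α₂₂ * α + b ^ 2 * Y +
      2 * b * (α₂₁ * α + α₂₂ * (D - 1)) + β₂₂ ^ 2 * n₁p * D + n₂ * D)
    (hκ : κ = l₁p + γ - g * β₂₃ ^ 2) :
    ContinuationConditions 1 τ e 1 n₁p n₂ γ l₁ l₁p l₂₁ l α α₂₁ α₂₂ β₁₁ β₂₁ β₂₂ β₂₃ ↔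
    (l₁ * D = α ∧ l₁p * M = β₁₁ * α ∧ l₂₁ * M + l * G₁₂ = β₁₁ * α ∧
      l₂₁ * G₁₂ + l * G₂₂ = α₂₁ * (D - α ^ 2) + (α₂₂ + b) * α) ∧
    (0 < l ∧ 2 * l * α₂₁ = 1 ∧ 2 * l * α₂₂ = -(l₂₁ * β₁₁ + l * b)) ∧
    (2 * g * β₂₁ * Y = α - l * (α₂₁ * α + α₂₂ * (D - 1)) ∧ 2 * g * β₂₂ = -l₂₁ ∧
      2 * g * β₂₃ = -(l₂₁ + 2 * γ)) ∧
    (0 < κ ∧ α + 2 * g * β₂₃ * β₂₁ * Y = 2 * κ * β₁₁ * Y) := by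
  have hD0 : 0 < D := by rw [hD]; positivity
  have hD0' := hD0.ne'
  have hw : α ^ 2 * 1 + τ = D - 1 := by rw [hD]; ring
  -- `D` is the variance of `y₁`, so all conditional second moments share the denominator `D`, which
  -- is then cleared.
  have hm : 1 - (D - 1) / (D - 1 + 1) = 1 / D := by
    rw [sub_add_cancel]; field_simp; ring
  simp only [ContinuationConditions, hw, hm, ← hb, ← hg]
  have hi : (1 / D : ℝ) ≠ 0 := by positivity
  have e₁ : l₁ * (D - 1 + 1) = α * 1 ↔ l₁ * D = α := by rw [sub_add_cancel, mul_one]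
  refine and_congr ((and_congr e₁ Iff.rfl).trans (and_congr_right fun h₁ =>
    and_congr ?_ (and_congr ?_ ?_))) (and_congr Iff.rfl ((and_congr (and_congr ?_ Iff.rfl)
      Iff.rfl).trans (and_congr_right fun h₂ => ?_)))
  · exact eq_iff_eq_of_eq_mul hi (by rw [hM, hY]; field_simp) (by field_simp)
  · exact eq_iff_eq_of_eq_mul hi (by rw [hM, hG₁₂, hY]; field_simp) (by field_simp)
  · have h₁' : 1 - l₁ * α = 1 / D * (D - α ^ 2) := by
      field_simp; rw [← h₁]; ring
    rw [h₁']
    exact eq_iff_eq_of_eq_mul hi (by rw [hG₁₂, hG₂₂, hY]; field_simp) (by field_simp)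
  · exact eq_iff_eq_of_eq_mul hi (by rw [hY]; field_simp) (by field_simp)
  · obtain ⟨a₁, -, a₃⟩ := h₂
    have hκ' : l₁p + β₂₃ * l₂₁ + l * β₂₃ ^ 2 + γ * (1 + β₂₃) ^ 2 = κ := by
      rw [hκ]; rw [hg] at a₃ ⊢; linear_combination β₂₃ * a₃
    rw [hκ']
    refine and_congr Iff.rfl (eq_iff_eq_of_eq_mul hi ?_ (by rw [hY]; field_simp))
    -- An envelope effect: the second-stage condition for `β₂₃` makes the cross term between `x₁`
    -- and the rest of `x₂` disappear.
    have h₃ : l₂₁ + 2 * l * β₂₃ + 2 * γ * (1 + β₂₃) = 0 := by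
      rw [hg] at a₃; linear_combination a₃
    rw [h₃]
    field_simp
    linear_combination -β₂₃ * a₁

section MixedReduction

variable {θp θ₂ θε Γ A θz β L₁ L₁p L₂₁ L A₂₁ α₂₂ β₂₁ β₂₂ β₂₃ D Y R T K M g κ b G₁₂ G₂₂ : ℝ}

/-- The normal equations for the time-`2` price in terms of the informed part of this price. -/
theorem mixed_dealers₂_iff (hA : 0 < A) (hD0 : D ≠ 0) (hD : L * D = A) (hY : Y = D - 1 + θε * D)
    (hM : M = β ^ 2 * Y + θp * D) (h₂₁ : 2 * L * A₂₁ = 1) (h₂₂ : 2 * α₂₂ = -D)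
    (hq : L₂₁ * β + L * b = A)
    (hG₁₂ : G₁₂ = β * (A₂₁ * A + α₂₂ * (D - 1) + b * Y) + β₂₂ * θp * D)
    (hG₂₂ : G₂₂ = A₂₁ ^ 2 * (D - A ^ 2) + α₂₂ ^ 2 * (D - 1) + 2 * A₂₁ * α₂₂ * A + b ^ 2 * Y +
      2 * b * (A₂₁ * A + α₂₂ * (D - 1)) + β₂₂ ^ 2 * θp * D + θ₂ * D) :
    (L₂₁ * M + L * G₁₂ = β * A ∧ L₂₁ * G₁₂ + L * G₂₂ = A₂₁ * (D - A ^ 2) + (α₂₂ + b) * A) ↔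
      β * A * (1 / 2 + θε) + (L₂₁ + L * β₂₂) * θp = β * A / D ∧
      (1 + A ^ 2) / 4 + A ^ 2 * θε + (L₂₁ + L * β₂₂) ^ 2 * θp + (A / D) ^ 2 * θ₂ = 1 / 2 := by
  have hL0 : L ≠ 0 := by rintro rfl; simp at hD; exact hA.ne hD
  have hLb : L * b = A - L₂₁ * β := by linarith
  have hLA : L * A₂₁ = 1 / 2 := by linarith
  have hα : α₂₂ = -D / 2 := by linarith
  have hLD : L = A / D := by rw [← hD]; field_simp
  -- With `S = Λ₂₁ y₁₊ + Λ₂₂ y₂`, the identities `k₁`, `k₂`, `k₃` compute `D` times the covariance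
  -- of `y₁₊` with `S`, the variance of `S`, and the covariance of the value with `S`. Replacing
  -- `y₂` by `S` is reversible because `L ≠ 0`.
  have k₁ : L₂₁ * M + L * G₁₂ =
      D * (β * A * (1 / 2 + θε) + (L₂₁ + L * β₂₂) * θp) := by
    rw [hM, hG₁₂, hα, hY]
    linear_combination β * A * hLA + β * (D - 1 + θε * D) * hLb - β * (D - 1) / 2 * hD
  have k₂ : L₂₁ * (L₂₁ * M + L * G₁₂) + L * (L₂₁ * G₁₂ + L * G₂₂) =
      D * ((1 + A ^ 2) / 4 + A ^ 2 * θε + (L₂₁ + L * β₂₂) ^ 2 * θp + (A / D) ^ 2 * θ₂) := by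
    have hb : b = (A - L₂₁ * β) / L := by rw [← hLb]; field_simp
    have hA₂₁ : A₂₁ = 1 / (2 * L) := by field_simp; linarith
    rw [hM, hG₁₂, hG₂₂, hα, hY, hb, hA₂₁, ← hD]
    field_simp
    ring
  have k₃ : L₂₁ * (β * A) + L * (A₂₁ * (D - A ^ 2) + (α₂₂ + b) * A) = D / 2 := by
    rw [hα]
    linear_combination (D - A ^ 2) * hLA + A * hLb - A / 2 * hD
  constructor
  · rintro ⟨h₁, h₂⟩
    rw [h₁, h₂, k₃] at k₂
    rw [h₁] at k₁
    refine ⟨?_, mul_left_cancel₀ hD0 ?_⟩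
    · rw [eq_div_iff hD0]; linarith
    · linarith
  · rintro ⟨h₁, h₂⟩
    rw [h₁, mul_div_cancel₀ _ hD0] at k₁
    refine ⟨k₁, mul_left_cancel₀ hL0 ?_⟩
    rw [h₂, k₁] at k₂
    linarith

end MixedReduction

section MixedReduction

variable {θp θ₂ θε Γ A θz β L₁ L₁p L₂₁ L A₂₁ α₂₂ β₂₁ β₂₂ β₂₃ D Y R T K M g κ : ℝ}

/-- Inserting the second-stage values of `β₂₁` and `β₂₃` into the net-effect equation leaves one
linear equation for `Λ₂₁`. -/
theorem mixed_coefficients (hLD : L * D = A)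
    (hR : R = g * D) (hT : T = 2 * R - A)
    (hK : K = 4 * Y * R - A * D + 4 * Γ * Y * β)
    (a₁ : 4 * R * β₂₁ * Y = A * D ^ 2) (a₃ : 2 * g * β₂₃ = -(L₂₁ + 2 * Γ))
    (hq : L₂₁ * β + L * (β₂₁ + β₂₃ * β) = A) : 2 * β * Y * T * L₂₁ = A * K := by
  subst hT hK hR
  linear_combination 4 * Y * g * D * hq - L * a₁ - 2 * Y * D * L * β * a₃ +
    (2 * Y * L₂₁ * β - A * D + 4 * Y * Γ * β) * hLD

/-- If `β₁₁` were `0`, then `y₁₊` would be pure noise and the pricing equation would force `Λ₂₁ =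
0`. The net-effect equation then gives `β₂₁ = D`, and the HFT's two first-order conditions combine
to `4Y = D - 2`, which is impossible since `Y ≥ D - 1` and `D > 1`. -/
theorem mixed_beta_ne_zero (hA : 0 < A) (hθp : 0 < θp) (hθε : 0 ≤ θε) (hΓ : 0 ≤ Γ) (hL : 0 < L)
    (hg : g = Γ + L) (hD : 1 < D) (hLD : L * D = A) (hY : Y = D - 1 + θε * D)
    (hM : M = β ^ 2 * Y + θp * D)
    (a₁ : 4 * (g * D) * β₂₁ * Y = A * D ^ 2) (a₂ : 2 * g * β₂₂ = -L₂₁)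
    (a₃ : 2 * g * β₂₃ = -(L₂₁ + 2 * Γ))
    (hq : L₂₁ * β + L * (β₂₁ + β₂₃ * β) = A)
    (k : A + 2 * g * β₂₃ * β₂₁ * Y = 2 * κ * β * Y)
    (h₁ : β * A * (1 / 2 + θε) + (L₂₁ + L * β₂₂) * θp = β * A / D) : β ≠ 0 := by
  rintro rfl
  have hg0 : 0 < g := by linarith
  have hh : L₂₁ + L * β₂₂ = 0 := by
    have : (L₂₁ + L * β₂₂) * θp = 0 := by simpa using h₁
    exact (mul_eq_zero.1 this).resolve_right hθp.ne'
  have hL₂₁ : L₂₁ = 0 := by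
    have h₂ : L₂₁ * (2 * g - L) = 0 := by linear_combination 2 * g * hh - L * a₂
    exact (mul_eq_zero.1 h₂).resolve_right (by rw [hg]; linarith)
  have hβ₂₁ : β₂₁ = D := by
    refine mul_left_cancel₀ hL.ne' ?_
    linear_combination hq - hLD
  rw [hL₂₁] at a₃
  rw [a₃, hβ₂₁] at k
  rw [hβ₂₁] at a₁
  have hD2 : D ^ 2 ≠ 0 := by positivity
  have h₃ : 4 * g * Y = A := mul_right_cancel₀ hD2 (by linear_combination a₁)
  have h₄ : A * (4 * Y) = A * (D - 2) := by
    rw [hg] at h₃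
    linear_combination D * h₃ - 4 * Y * hLD + 2 * k
  have h₅ := mul_left_cancel₀ hA.ne' h₄
  have : 0 ≤ θε * D := mul_nonneg hθε (by linarith)
  linarith

/-- The expression `Z` is `16κ`, so its positivity is the second-order condition; the equation for
`β` is the first-order condition solved for `β`. -/
theorem mixed_hft_iff {F Z : ℝ} (hD : D ≠ 0) (hβ : β ≠ 0) (hY : Y ≠ 0) (hR0 : R ≠ 0) (hT : T ≠ 0)
    (hg0 : g ≠ 0) (hR : R = g * D) (hL₁p : L₁p = A * β / M)
    (a₁ : 4 * R * β₂₁ * Y = A * D ^ 2) (a₃ : 2 * g * β₂₃ = -(L₂₁ + 2 * Γ))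
    (hF : F = 2 * β * Y * T * (L₂₁ + 2 * Γ))
    (hZ : Z = 16 * Γ + 16 * A * β / M - D * F ^ 2 / (β ^ 2 * Y ^ 2 * R * T ^ 2))
    (hκ : κ = L₁p + Γ - g * β₂₃ ^ 2) :
    (0 < κ ∧ A + 2 * g * β₂₃ * β₂₁ * Y = 2 * κ * β * Y) ↔
      0 < Z ∧ 0 = β - A * (8 * Y - D ^ 2 * F / (β * R * T)) / (Y ^ 2 * Z) := by
  have hZκ : Z = 16 * κ := by
    have hβ₂₃ : β₂₃ = -(L₂₁ + 2 * Γ) / (2 * g) := by rw [← a₃]; field_simp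
    rw [hZ, hκ, hF, hL₁p, hβ₂₃, hR]
    field_simp
    ring
  have hβ₂₁ : β₂₁ = A * D ^ 2 / (4 * R * Y) := by rw [← a₁]; field_simp
  rw [hZκ]
  constructor
  · rintro ⟨h₁, h₂⟩
    refine ⟨by linarith, ?_⟩
    have h₃ : β = A * (8 * Y - D ^ 2 * F / (β * R * T)) / (Y ^ 2 * (16 * κ)) := by
      rw [eq_div_iff (by positivity), hF]
      rw [a₃, hβ₂₁] at h₂
      field_simp at h₂ ⊢
      linear_combination -2 * h₂
    linarith
  · rintro ⟨h₁, h₂⟩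
    have hκ0 : 0 < κ := by linarith
    refine ⟨hκ0, ?_⟩
    have h₃ : β = A * (8 * Y - D ^ 2 * F / (β * R * T)) / (Y ^ 2 * (16 * κ)) := by linarith
    rw [eq_div_iff (by positivity), hF] at h₃
    rw [a₃, hβ₂₁]
    field_simp at h₃ ⊢
    linear_combination -h₃ / 2

end MixedReduction

set_option maxHeartbeats 1000000 in
/-- The mixed-strategy equilibrium conditions amount to the explicit system and closed forms. -/
theorem mixed_conditions_iff {θp θ₂ θε Γ A θz β L₁ L₁p L₂₁ L A₂₁ α₂₂ β₂₁ β₂₂ β₂₃ : ℝ}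
    (hθp : 0 < θp) (hθ₂ : 0 < θ₂) (hθε : 0 ≤ θε) (hΓ : 0 ≤ Γ) :
    (ContinuationConditions 1 θz θε 1 θp θ₂ Γ L₁ L₁p L₂₁ L A A₂₁ α₂₂ β β₂₁ β₂₂ β₂₃ ∧ 0 < θz ∧
      L₁ - L * (α₂₂ / (A ^ 2 + θz + 1) - A₂₁ * L₁) ^ 2 = 0 ∧
      1 + (α₂₂ / (A ^ 2 + θz + 1) - A₂₁ * L₁) = 0) ↔
    MixedSystem θp θ₂ θε Γ A θz β ∧
      MixedClosedForms θp θε Γ A θz β L₁ L₁p L₂₁ L A₂₁ α₂₂ β₂₁ β₂₂ β₂₃ := by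
  -- In units with `σ₁ = σv = 1`: `D` is the variance of `y₁`, `Y/D` that of the signal surprise,
  -- `M/D` that of `y₁₊`; moreover `R = D (Γ + Λ₂₂)` and `T = D (2Γ + Λ₂₂)` once `Λ₂₂ = A/D`. The
  -- names are kept opaque so that they act as atoms.
  obtain ⟨D, hD⟩ : ∃ D, D = A ^ 2 + θz + 1 := ⟨_, rfl⟩
  obtain ⟨Y, hY⟩ : ∃ Y, Y = A ^ 2 * (θε + 1) + θε * θz + θε + θz := ⟨_, rfl⟩
  obtain ⟨R, hR⟩ : ∃ R, R = A ^ 2 * Γ + A + Γ * θz + Γ := ⟨_, rfl⟩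
  obtain ⟨T, hT⟩ : ∃ T, T = 2 * A ^ 2 * Γ + A + 2 * Γ * (θz + 1) := ⟨_, rfl⟩
  obtain ⟨K, hK⟩ : ∃ K, K = 4 * Y * R - A * D + 4 * Γ * Y * β := ⟨_, rfl⟩
  obtain ⟨M, hM⟩ : ∃ M, M = β ^ 2 * Y + θp * D := ⟨_, rfl⟩
  have hY' : Y = D - 1 + θε * D := by rw [hY, hD]; ring
  have hR' : R = Γ * D + A := by rw [hR, hD]; ring
  have hT' : T = 2 * R - A := by rw [hT, hR]; ring
  have hM' : A ^ 2 * (β ^ 2 * (θε + 1) + θp) + β ^ 2 * (θε * θz + θε + θz) + θp * (θz + 1) = M := by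
    rw [hM, hY, hD]; ring
  have hF : 4 * A ^ 5 * (θε + 1) * Γ + A ^ 4 * (θε * (8 * β * Γ ^ 2 + 4) + 8 * β * Γ ^ 2 + 3) +
      4 * A ^ 3 * Γ * (2 * β * (θε + 1) + 2 * θε * (θz + 1) + 2 * θz + 1) + A ^ 2 *
      (4 * θε * (θz + 1) * (4 * β * Γ ^ 2 + 1) + 8 * β * Γ ^ 2 * (2 * θz + 1) + 3 * θz - 1) +
      4 * A * Γ * (2 * β + θz + 1) * (θε * θz + θε + θz) +
      8 * β * Γ ^ 2 * (θz + 1) * (θε * θz + θε + θz) = 4 * Γ * β * Y * T + A * K := by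
    rw [hK, hT, hY, hR, hD]; ring
  have hK' : 4 * A ^ 4 * (θε + 1) * Γ + A ^ 3 * (4 * θε + 3) +
      4 * A ^ 2 * Γ * (β * θε + β + 2 * θε * θz + 2 * θε + 2 * θz + 1) +
      A * (4 * θε * (θz + 1) + 3 * θz - 1) + 4 * Γ * (β + θz + 1) * (θε * θz + θε + θz) = K := by
    rw [hK, hY, hR, hD]; ring
  have hD'' : 1 + A ^ 2 + θz = D := by rw [hD]; ring
  simp only [MixedSystem, MixedClosedForms]
  rw [← hD, hM', hD'', hK', ← hY, ← hR, ← hT, hF]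
  constructor
  · rintro ⟨hc, hθz, hr₁, hr₂⟩
    rw [continuationConditions_one_iff hθz.le hD hY' hM rfl rfl rfl rfl rfl] at hc
    obtain ⟨⟨d₁, d₂, d₃, d₄⟩, ⟨hL, i₂, i₃⟩, ⟨a₁, a₂, a₃⟩, hκ⟩ := hc
    have hD1 : 1 < D := by rw [hD]; linarith only [sq_nonneg A, hθz]
    have hD0 : 0 < D := by linarith
    -- Zero slope means that the response is `-1`; zero curvature then equates `Λ₁` and `Λ₂₂`.
    have hr : α₂₂ / D - A₂₁ * L₁ = -1 := by linarith
    have hL₁ : L₁ = L := by rw [hr] at hr₁; linarith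
    subst hL₁
    have hA : 0 < A := by rw [← d₁]; positivity
    have hα : 2 * α₂₂ = -D := by
      field_simp at hr
      linear_combination 2 * hr + D * i₂
    -- The value of `α₂₂` dictated by indifference, put into her second-stage condition, fixes the
    -- net price effect of her surprise.
    have hq : L₂₁ * β + L₁ * (β₂₁ + β₂₃ * β) = A := by
      linear_combination i₃ - L₁ * hα + d₁
    have hRg : R = (Γ + L₁) * D := by rw [hR', ← d₁]; ring
    have a₁' : 4 * R * β₂₁ * Y = A * D ^ 2 := by
      rw [hRg]
      linear_combination 2 * D * a₁ - D * A * i₂ - D * L₁ * (D - 1) * hα + D * (D - 1) * d₁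
    have hY0 : 0 < Y := by rw [hY']; positivity
    have hg0 : 0 < Γ + L₁ := by linarith
    have hR0 : 0 < R := by rw [hRg]; positivity
    have hT0 : 0 < T := by rw [hT]; positivity
    have hdeal := (mixed_dealers₂_iff hA hD0.ne' d₁ hY' hM i₂ hα hq rfl rfl).1 ⟨d₃, d₄⟩
    have hβ : β ≠ 0 := mixed_beta_ne_zero hA hθp hθε hΓ hL rfl hD1 d₁ hY' hM (hRg ▸ a₁') a₂ a₃ hq
      hκ.2 hdeal.1
    have hL₂₁ := mixed_coefficients d₁ hRg hT' hK a₁' a₃ hq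
    have hM0 : 0 < M := by rw [hM]; positivity
    have hL₁D : L₁ = A / D := by rw [← d₁]; field_simp
    have hL₁p : L₁p = A * β / M := by rw [eq_div_iff hM0.ne', d₂]; ring
    have hL₂₁' : L₂₁ = A * K / (2 * β * Y * T) := by
      rw [eq_div_iff (by positivity), ← hL₂₁]; ring
    have hh : L₂₁ + L₁ * β₂₂ = A * K / (4 * Y * R * β) := by
      have : β₂₂ = -L₂₁ / (2 * (Γ + L₁)) := by rw [← a₂]; field_simp
      rw [eq_div_iff (by positivity), ← hL₂₁, this, hT', hRg, ← d₁]
      field_simp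
      ring
    have hpoly := (mixedPoly_eq_zero_iff hA.ne' hθ₂ hθp hθε hθz.le hD hY hR hT hM hK hD0.ne' hY0.ne'
      hR0.ne' hT0.ne' hβ hh rfl rfl).2 hdeal
    have hhft := (mixed_hft_iff hD0.ne' hβ hY0.ne' hR0.ne' hT0.ne' hg0.ne' hRg hL₁p a₁' a₃
      (F := 4 * Γ * β * Y * T + A * K) (by linear_combination -hL₂₁)
      rfl rfl).1 hκ
    refine ⟨⟨hβ, ?_, hA, hθz, ?_, hpoly⟩, hL₁D, hL₁p, hL₂₁', rfl, ?_, ?_, ?_, ?_, ?_⟩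
    · exact lt_of_lt_of_eq hhft.1 (by ring)
    · refine hhft.2.trans ?_
      ring
    · rw [eq_div_iff (by positivity)]; linarith
    · linarith
    · rw [eq_div_iff (by positivity), ← a₁']; ring
    · rw [eq_comm, neg_eq_iff_eq_neg, div_eq_iff (by positivity)]; linarith
    · rw [eq_comm, neg_eq_iff_eq_neg, div_eq_iff (by positivity)]; linarith
  · rintro ⟨⟨hβ, hZ, hA, hθz, hβeq, hpoly⟩, hL₁D, hL₁p, hL₂₁', hLL, hA₂₁, hα, hβ₂₁, hβ₂₂, hβ₂₃⟩
    subst hLL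
    have hD1 : 1 < D := by rw [hD]; linarith only [sq_nonneg A, hθz]
    have hD0 : 0 < D := by linarith
    have hL : 0 < L := by rw [hL₁D]; positivity
    have d₁ : L * D = A := by rw [hL₁D]; field_simp
    have i₂ : 2 * L * A₂₁ = 1 := by rw [hA₂₁]; field_simp
    have hα' : 2 * α₂₂ = -D := by linarith
    have hRg : R = (Γ + L) * D := by rw [hR', ← d₁]; ring
    have hY0 : 0 < Y := by rw [hY']; positivity
    have hg0 : 0 < Γ + L := by linarith
    have hR0 : 0 < R := by rw [hRg]; positivity
    have hT0 : 0 < T := by rw [hT]; positivity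
    have hM0 : 0 < M := by rw [hM]; positivity
    have a₁' : 4 * R * β₂₁ * Y = A * D ^ 2 := by rw [hβ₂₁]; field_simp
    have a₂ : 2 * (Γ + L) * β₂₂ = -L₂₁ := by rw [hβ₂₂]; field_simp
    have a₃ : 2 * (Γ + L) * β₂₃ = -(L₂₁ + 2 * Γ) := by rw [hβ₂₃]; field_simp; ring
    have hL₂₁ : 2 * β * Y * T * L₂₁ = A * K := by rw [hL₂₁']; field_simp
    -- The elimination that produced the closed form of `Λ₂₁` is run backwards; it had multiplied by
    -- `4Y(Γ + L)D`, which is nonzero.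
    have hq : L₂₁ * β + L * (β₂₁ + β₂₃ * β) = A := by
      have hY4 : 4 * Y * (Γ + L) * D ≠ 0 := by positivity
      refine mul_left_cancel₀ hY4 ?_
      rw [hT', hRg] at hL₂₁
      rw [hRg] at a₁'
      rw [hK, hRg] at hL₂₁
      linear_combination hL₂₁ + L * a₁' + 2 * Y * D * L * β * a₃ -
        (2 * Y * L₂₁ * β - A * D + 4 * Y * Γ * β) * d₁
    have hh : L₂₁ + L * β₂₂ = A * K / (4 * Y * R * β) := by
      have : β₂₂ = -L₂₁ / (2 * (Γ + L)) := by rw [← a₂]; field_simp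
      rw [eq_div_iff (by positivity), ← hL₂₁, this, hT', hRg, ← d₁]
      field_simp
      ring
    have hdeal := (mixedPoly_eq_zero_iff hA.ne' hθ₂ hθp hθε hθz.le hD hY hR hT hM hK hD0.ne' hY0.ne'
      hR0.ne' hT0.ne' hβ hh rfl rfl).1 hpoly
    have hdeal' := (mixed_dealers₂_iff hA hD0.ne' d₁ hY' hM i₂ hα' hq rfl rfl).2 hdeal
    have hhft := (mixed_hft_iff hD0.ne' hβ hY0.ne' hR0.ne' hT0.ne' hg0.ne' hRg hL₁p a₁' a₃
      (F := 4 * Γ * β * Y * T + A * K) (by linear_combination -hL₂₁)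
      rfl rfl).2 ⟨lt_of_lt_of_eq hZ (by ring), hβeq.trans (by ring)⟩
    have hr : α₂₂ / D - A₂₁ * L = -1 := by
      rw [hα, hA₂₁]; field_simp; ring
    rw [hr, continuationConditions_one_iff hθz.le hD hY' hM rfl rfl rfl rfl rfl]
    refine ⟨⟨⟨d₁, ?_, hdeal'⟩, ⟨hL, i₂, ?_⟩, ⟨?_, a₂, a₃⟩, hhft⟩, hθz, by ring, by ring⟩
    · rw [hL₁p]; field_simp
    · linear_combination hq + L * hα' - d₁
    · refine mul_left_cancel₀ hD0.ne' ?_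
      rw [hRg] at a₁'
      linear_combination a₁' / 2 + D * A * i₂ / 2 + D * L * (D - 1) * hα' / 2 - D * (D - 1) * d₁ / 2

/-! ### The pure-strategy system -/

section PureReduction

variable {θp θ₂ θε Γ A β x L A₂₁ α₂₂ β₂₁ β₂₂ β₂₃ D Y Q K H N V M g κ b q w e G₁₂ G₂₂ : ℝ}

/-- A linear fixed point: the net effect `q` contains `β₂₁`, while the HFT's optimal `β₂₁` depends
on `q` through the informed trader's reaction. Eliminating `β₂₁` leaves `q` with the coefficient
`Q`. -/
theorem pure_beta₂₁_iff (hY : Y ≠ 0) (hg0 : g ≠ 0) (hQ0 : Q ≠ 0) (hg : g = Γ + L)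
    (hQ : Q = 4 * g * Y - L * A ^ 2) (hw : w = 2 * Γ * (x - L) + x * L)
    (hq : q = x * β + L * (β₂₁ + β₂₃ * β)) (a₃ : 2 * g * β₂₃ = -(x + 2 * Γ)) :
    4 * g * β₂₁ * Y = A + q * A ^ 2 ↔
      β₂₁ = (A ^ 2 * β * w / (2 * g) + A) / Q ∧ q * Q = 2 * β * Y * w + A * L := by
  have h₁ : 2 * g * q = 2 * g * L * β₂₁ + β * w := by
    rw [hq, hw]
    rw [hg] at a₃ ⊢
    linear_combination L * β * a₃
  rw [eq_div_iff hQ0]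
  constructor
  · intro h
    have h₂ : q * Q = 2 * β * Y * w + A * L := by
      rw [hQ]; linear_combination 2 * Y * h₁ + L * h
    refine ⟨?_, h₂⟩
    field_simp
    refine mul_left_cancel₀ hY (mul_left_cancel₀ (two_ne_zero (α := ℝ)) ?_)
    linear_combination Q * h + A ^ 2 * h₂ + A * hQ
  · rintro ⟨h, h₂⟩
    refine mul_left_cancel₀ hQ0 ?_
    field_simp at h
    linear_combination 2 * Y * h - A ^ 2 * h₂ - A * hQ

/-- This is `D²` times the Gram determinant of `y₁₊` and `y₂`; it is positive because both flows
carry their own independent noise. -/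
theorem pure_det_pos (hA : A ≠ 0) (hθ₂ : 0 < θ₂) (hθp : 0 < θp) (hθε : 0 ≤ θε)
    (hD : D = A ^ 2 + 1) (hY : Y = D - 1 + θε * D) (hM : M = β ^ 2 * Y + θp * D)
    (hG₁₂ : G₁₂ = β * (A₂₁ * A + α₂₂ * (D - 1) + b * Y) + β₂₂ * θp * D)
    (hG₂₂ : G₂₂ = A₂₁ ^ 2 * (D - A ^ 2) + α₂₂ ^ 2 * (D - 1) + 2 * A₂₁ * α₂₂ * A + b ^ 2 * Y +
      2 * b * (A₂₁ * A + α₂₂ * (D - 1)) + β₂₂ ^ 2 * θp * D + θ₂ * D) :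
    0 < M * G₂₂ - G₁₂ ^ 2 := by
  have hD0 : 0 < D := by rw [hD]; positivity
  -- `p` and `W` are `D` times the covariance with the signal surprise and the variance of the part
  -- of `y₂` free of `u₁₊` and `u₂`; `h₂` below is their Cauchy–Schwarz inequality, with an explicit
  -- square as the defect.
  set f : ℝ := A₂₁ + α₂₂ * A + b * A with hf
  set p : ℝ := A * f + b * θε * D with hp
  set W : ℝ := f ^ 2 + b ^ 2 * θε * D with hW
  have hY' : Y = A ^ 2 + θε * D := by rw [hY, hD]; ring
  have hY0 : 0 < Y := by rw [hY']; positivity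
  have h₁ : Y * W - p ^ 2 = θε * D * (f - A * b) ^ 2 := by
    rw [hY', hW, hp]; ring
  have h₂ : 0 ≤ Y * W - p ^ 2 := by rw [h₁]; positivity
  have h₃ : 0 ≤ β₂₂ ^ 2 * β ^ 2 * Y + W - 2 * β * β₂₂ * p := by
    refine nonneg_of_mul_nonneg_right (a := Y) ?_ hY0
    have : Y * (β₂₂ ^ 2 * β ^ 2 * Y + W - 2 * β * β₂₂ * p) =
        (Y * β₂₂ * β - p) ^ 2 + (Y * W - p ^ 2) := by ring
    rw [this]
    positivity
  have key : M * G₂₂ - G₁₂ ^ 2 = β ^ 2 * (Y * W - p ^ 2) +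
      θp * D * (β₂₂ ^ 2 * β ^ 2 * Y + W - 2 * β * β₂₂ * p) +
      (β ^ 2 * Y + θp * D) * (θ₂ * D) := by
    have hG₁₂' : G₁₂ = β * p + β₂₂ * θp * D := by rw [hG₁₂, hp, hf, hY', hD]; ring
    have hG₂₂' : G₂₂ = W + β₂₂ ^ 2 * θp * D + θ₂ * D := by rw [hG₂₂, hW, hf, hY', hD]; ring
    rw [hM, hG₁₂', hG₂₂']; ring
  have h₄ := mul_nonneg (sq_nonneg β) h₂
  have h₅ := mul_nonneg (mul_pos hθp hD0).le h₃
  have h₆ : 0 < (β ^ 2 * Y + θp * D) * (θ₂ * D) := by positivity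
  rw [key]
  linarith

/-- Cramer's rule for the normal equations of the time-`2` price. -/
theorem pure_dealers₂_iff (hg0 : g ≠ 0) (hQ0 : Q ≠ 0) (hL0 : L ≠ 0) (hD0 : D ≠ 0)
    (hdet : M * G₂₂ - G₁₂ ^ 2 ≠ 0) (hK : K = -(e * L * Q)) (hN : N = -(2 * g * D * L * Q * G₁₂))
    (hV : V = 4 * D * L ^ 2 * Q ^ 2 * g ^ 2 * G₂₂) :
    (x * M + L * G₁₂ = β * A ∧ x * G₁₂ + L * G₂₂ = e) ↔
      0 = 2 * D * g * K * (-N) + A * D * β * V + x * (N ^ 2 - D * M * V) ∧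
      0 = -4 * D ^ 2 * Q * K * M * g ^ 2 - 2 * A * D * β * Q * (-N) * g + N ^ 2 - D * M * V := by
  subst hK hN hV
  constructor
  · rintro ⟨h₁, h₂⟩
    constructor
    · linear_combination 4 * D ^ 2 * g ^ 2 * L ^ 2 * Q ^ 2 * (G₂₂ * h₁ - G₁₂ * h₂)
    · linear_combination 4 * D ^ 2 * g ^ 2 * L * Q ^ 2 * (M * h₂ - G₁₂ * h₁)
  · rintro ⟨h₁, h₂⟩
    have h₁' : β * A * G₂₂ - e * G₁₂ - x * (M * G₂₂ - G₁₂ ^ 2) = 0 := by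
      refine (mul_eq_zero.1 (?_ : (4 * D ^ 2 * g ^ 2 * L ^ 2 * Q ^ 2) * _ = 0)).resolve_left
        (by positivity)
      linear_combination -h₁
    have h₂' : e * M - β * A * G₁₂ - L * (M * G₂₂ - G₁₂ ^ 2) = 0 := by
      refine (mul_eq_zero.1 (?_ : (4 * D ^ 2 * g ^ 2 * L * Q ^ 2) * _ = 0)).resolve_left
        (by positivity)
      linear_combination -h₂
    constructor
    · refine mul_left_cancel₀ hdet ?_
      linear_combination -M * h₁' - G₁₂ * h₂'
    · refine mul_left_cancel₀ hdet ?_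
      linear_combination -G₁₂ * h₁' - G₂₂ * h₂'

/-- `e`, `G₁₂`, `G₂₂` are `D` times the covariance of the value with `y₂`, the covariance of the two
order flows, and the variance of `y₂`. The long expressions `K`, `N`, `V` are these moments with
denominators cleared by means of `q * Q`. -/
theorem pure_auxiliary (hL0 : L ≠ 0) (hD : D = A ^ 2 + 1) (hg : g = Γ + L)
    (hY : Y = D - 1 + θε * D) (hQ : Q = 4 * g * Y - L * A ^ 2)
    (hw : w = 2 * Γ * (x - L) + x * L)
    (hK : K = β * ((3 * θε + 2) * x * L + 2 * (θε + 1) * Γ * (x + L)) * A ^ 3 -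
      2 * (θε + 1) * g * A ^ 2 + β * θε * (3 * x * L + 2 * Γ * (x + L)) * A - 2 * θε * g)
    (hH : H = β * (4 * (θε + 1) * Γ + 2 * θε * x + x) * A ^ 2 - A + 2 * β * θε * (2 * Γ + x))
    (hN : N = 2 * β * g * K * A ^ 3 + 2 * β * g * K * A + 2 * D ^ 2 * β * θε * H * L * g +
      D ^ 2 * x * L * Q * θp)
    (hV : V = 4 * D ^ 2 * θε * (-H) ^ 2 * L ^ 2 * g ^ 2 + 4 * A ^ 2 * K ^ 2 * g ^ 2 +
      4 * K ^ 2 * g ^ 2 + 4 * D ^ 2 * L ^ 2 * Q ^ 2 * θ₂ * g ^ 2 + D ^ 2 * x ^ 2 * L ^ 2 * Q ^ 2 * θp)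
    (hq : q = x * β + L * b) (hqQ : q * Q = 2 * β * Y * w + A * L)
    (h₂₁ : 2 * L * A₂₁ = 1) (h₂₂ : 2 * L * α₂₂ = -q) (a₂ : 2 * g * β₂₂ = -x)
    (hG₁₂ : G₁₂ = β * (A₂₁ * A + α₂₂ * (D - 1) + b * Y) + β₂₂ * θp * D)
    (hG₂₂ : G₂₂ = A₂₁ ^ 2 * (D - A ^ 2) + α₂₂ ^ 2 * (D - 1) + 2 * A₂₁ * α₂₂ * A + b ^ 2 * Y +
      2 * b * (A₂₁ * A + α₂₂ * (D - 1)) + β₂₂ ^ 2 * θp * D + θ₂ * D)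
    (he : e = A₂₁ * (D - A ^ 2) + (α₂₂ + b) * A) :
    K = -(e * L * Q) ∧ N = -(2 * g * D * L * Q * G₁₂) ∧
      V = 4 * D * L ^ 2 * Q ^ 2 * g ^ 2 * G₂₂ := by
  have he' : e = A₂₁ + (α₂₂ + b) * A := by rw [he, hD]; ring
  have hLe : 2 * L * e = 1 + (q - 2 * x * β) * A := by
    rw [he']; linear_combination h₂₁ + A * h₂₂ - 2 * A * hq
  have hK' : K = -(e * L * Q) := by
    have h : 2 * K = -(2 * L * e * Q) := by
      rw [hLe]
      have : (1 + (q - 2 * x * β) * A) * Q = Q + A * (q * Q) - 2 * x * β * A * Q := by ring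
      rw [this, hqQ, hK, hQ, hw, hg, hY, hD]
      ring
    linear_combination h / 2
  -- `b` is the total weight of the signal surprise in `y₂`.
  have hH' : H = -(Q * b) := by
    refine mul_left_cancel₀ hL0 ?_
    have : L * -(Q * b) = -(q * Q) + x * β * Q := by rw [hq]; ring
    rw [this, hqQ, hH, hQ, hw, hg, hY, hD]
    ring
  have hP : A₂₁ * A + α₂₂ * (D - 1) + b * Y = A * e + b * θε * D := by
    rw [he', hY, hD]; ring
  have hx : x = -(2 * g * β₂₂) := by linarith
  refine ⟨hK', ?_, ?_⟩
  · rw [hN, hG₁₂, hP]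
    have : 2 * β * g * K * A ^ 3 + 2 * β * g * K * A = 2 * β * g * A * D * K := by rw [hD]; ring
    rw [this, hK', hH', hx]
    ring
  · have hW : G₂₂ = e ^ 2 + b ^ 2 * θε * D + β₂₂ ^ 2 * θp * D + θ₂ * D := by
      rw [hG₂₂, he', hY, hD]; ring
    have : 4 * A ^ 2 * K ^ 2 * g ^ 2 + 4 * K ^ 2 * g ^ 2 = 4 * D * K ^ 2 * g ^ 2 := by
      rw [hD]; ring
    rw [hV, hW, add_assoc (4 * D ^ 2 * θε * (-H) ^ 2 * L ^ 2 * g ^ 2), this, hK', hH', hx]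
    ring

end PureReduction

section PureReduction

variable {θp θ₂ θε Γ A β x L L₁ L₁p A₂₁ α₂₂ β₂₁ β₂₂ β₂₃ D Y Q J M g κ q w : ℝ}

/-- Her response is `r = -(A + q)/(2LD)`, so `J²/(4D²LQ²)` is `L r²`; the quotient in the equation
is `(1 + r)/(2κ)`, with `κ` her curvature. -/
theorem pure_it_iff {r B : ℝ} (hL : L ≠ 0) (hD : D ≠ 0) (hQ : Q ≠ 0)
    (hr : r = α₂₂ / D - A₂₁ * L₁) (hL₁ : L₁ = A / D) (h₂₁ : 2 * L * A₂₁ = 1)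
    (h₂₂ : 2 * L * α₂₂ = -q) (hJ : J = (A + q) * Q) (hB : B = q * Q) :
    (0 < L₁ - L * r ^ 2 ∧ 1 + r = 2 * (L₁ - L * r ^ 2) * A) ↔
      0 < A / D - J ^ 2 / (4 * D ^ 2 * L * Q ^ 2) ∧
      0 = A - (-B / (D * L * Q) - A / (L * D) + 2) /
        (4 * (A / D - J ^ 2 / (4 * D ^ 2 * L * Q ^ 2))) := by
  have hA₂₁ : A₂₁ = 1 / (2 * L) := by rw [← h₂₁]; field_simp
  have hα₂₂ : α₂₂ = -q / (2 * L) := by rw [← h₂₂]; field_simp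
  have hr' : r = -(A + q) / (2 * L * D) := by
    rw [hr, hL₁, hA₂₁, hα₂₂]; field_simp; ring
  have hκ : A / D - J ^ 2 / (4 * D ^ 2 * L * Q ^ 2) = L₁ - L * r ^ 2 := by
    rw [hJ, hL₁, hr']; field_simp; ring
  have hn : -B / (D * L * Q) - A / (L * D) + 2 = 2 * (1 + r) := by
    rw [hB, hr']; field_simp; ring
  rw [hκ, hn]
  refine and_congr_right fun h => ?_
  rw [eq_comm (a := (0 : ℝ)), sub_eq_zero, eq_div_iff (by positivity)]
  constructor <;> intro h' <;> linarith

/-- The expression in the inequality is `4κ`, and the denominator factor `d` is `4κMg`; inserting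
`β₂₁` and `β₂₃` turns the numerator of the first-order condition into `-A n`. -/
theorem pure_hft_iff {n d : ℝ} (hM : 0 < M) (hg0 : 0 < g) (hg : g = Γ + L) (hY : Y ≠ 0)
    (hQ0 : Q ≠ 0) (hQ : Q = 4 * g * Y - L * A ^ 2) (hL₁p : L₁p = A * β / M)
    (hβ₂₁ : β₂₁ = (A ^ 2 * β * w / (2 * g) + A) / Q) (a₃ : 2 * g * β₂₃ = -(x + 2 * Γ))
    (hκ : κ = L₁p + Γ - g * β₂₃ ^ 2)
    (hn : n = A * β * Y * (2 * Γ + x) * w - 2 * g * ((2 * Γ - x) * Y + 4 * L * Y - L * A ^ 2))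
    (hd : d = 4 * A * β * g - M * (4 * Γ * (x - L) + x ^ 2)) :
    (0 < κ ∧ A + 2 * g * β₂₃ * β₂₁ * Y = 2 * κ * β * Y) ↔
      0 < 4 * A * β / M - (2 * Γ + x) ^ 2 / g + 4 * Γ ∧ 0 = A * M * n / (Y * Q * d) + β := by
  have hM' := hM.ne'
  have hg' := hg0.ne'
  have hβ₂₃ : β₂₃ = -(x + 2 * Γ) / (2 * g) := by rw [← a₃]; field_simp
  have hκ' : 4 * A * β / M - (2 * Γ + x) ^ 2 / g + 4 * Γ = 4 * κ := by
    rw [hκ, hL₁p, hβ₂₃]; field_simp; ring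
  have hd' : d = 4 * κ * M * g := by
    rw [← hκ', hd, show 4 * Γ * (x - L) + x ^ 2 = (2 * Γ + x) ^ 2 - 4 * Γ * g by rw [hg]; ring]
    field_simp
    ring
  rw [hκ', hd', mul_pos_iff_of_pos_left (by norm_num : (0 : ℝ) < 4)]
  refine and_congr_right fun h => ?_
  have hκ0 := h.ne'
  have hβ' : 2 * g * Q * β₂₁ = A ^ 2 * β * w + 2 * g * A := by
    rw [hβ₂₁]; field_simp
  have key : 2 * g * Q * (A + 2 * g * β₂₃ * β₂₁ * Y) = -(A * n) := by
    rw [a₃, hn]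
    have : (2 * Γ - x) * Y + 4 * L * Y - L * A ^ 2 = Q - (x + 2 * Γ) * Y := by rw [hQ, hg]; ring
    rw [this]
    linear_combination -(x + 2 * Γ) * Y * hβ'
  have hgQ : 2 * g * Q ≠ 0 := by positivity
  rw [← mul_right_inj' hgQ, key, eq_comm (a := (0 : ℝ)), add_eq_zero_iff_eq_neg,
    div_eq_iff (by positivity)]
  constructor
  · intro h'; linear_combination -M * h'
  · intro h'
    refine mul_left_cancel₀ hM' ?_
    linear_combination -h'

end PureReduction

/-- The pure-strategy equilibrium conditions amount to the explicit system and closed forms. -/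
theorem pure_conditions_iff {θp θ₂ θε Γ A β L₁ L₁p x L A₂₁ α₂₂ β₂₁ β₂₂ β₂₃ : ℝ}
    (hθp : 0 < θp) (hθ₂ : 0 < θ₂) (hθε : 0 ≤ θε) (hΓ : 0 ≤ Γ) :
    (ContinuationConditions 1 0 θε 1 θp θ₂ Γ L₁ L₁p x L A A₂₁ α₂₂ β β₂₁ β₂₂ β₂₃ ∧
      0 < L₁ - L * (α₂₂ / (A ^ 2 + 1) - A₂₁ * L₁) ^ 2 ∧
      1 + (α₂₂ / (A ^ 2 + 1) - A₂₁ * L₁) =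
        2 * (L₁ - L * (α₂₂ / (A ^ 2 + 1) - A₂₁ * L₁) ^ 2) * A) ↔
    PureSystem θp θ₂ θε Γ x L A β ∧
      PureClosedForms θp θε Γ x L A β L₁ L₁p A₂₁ α₂₂ β₂₁ β₂₂ β₂₃ := by
  obtain ⟨D, hD⟩ : ∃ D, D = A ^ 2 + 1 := ⟨_, rfl⟩
  obtain ⟨g, hg⟩ : ∃ g, g = Γ + L := ⟨_, rfl⟩
  obtain ⟨Q, hQ⟩ : ∃ Q, Q = A ^ 2 * (4 * (θε + 1) * Γ + (4 * θε + 3) * L) + 4 * θε * g := ⟨_, rfl⟩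
  obtain ⟨w, hw⟩ : ∃ w, w = 2 * Γ * (x - L) + x * L := ⟨_, rfl⟩
  obtain ⟨M, hM⟩ : ∃ M, M = A ^ 2 * (β ^ 2 * (θε + 1) + θp) + β ^ 2 * θε + θp := ⟨_, rfl⟩
  obtain ⟨K, hK⟩ : ∃ K, K = β * ((3 * θε + 2) * x * L + 2 * (θε + 1) * Γ * (x + L)) * A ^ 3 -
      2 * (θε + 1) * g * A ^ 2 + β * θε * (3 * x * L + 2 * Γ * (x + L)) * A - 2 * θε * g := ⟨_, rfl⟩
  obtain ⟨H, hH⟩ : ∃ H, H = β * (4 * (θε + 1) * Γ + 2 * θε * x + x) * A ^ 2 - A +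
      2 * β * θε * (2 * Γ + x) := ⟨_, rfl⟩
  obtain ⟨N, hN⟩ : ∃ N, N = 2 * β * g * K * A ^ 3 + 2 * β * g * K * A +
      2 * D ^ 2 * β * θε * H * L * g + D ^ 2 * x * L * Q * θp := ⟨_, rfl⟩
  obtain ⟨V, hV⟩ : ∃ V, V = 4 * D ^ 2 * θε * (-H) ^ 2 * L ^ 2 * g ^ 2 +
      4 * A ^ 2 * K ^ 2 * g ^ 2 + 4 * K ^ 2 * g ^ 2 + 4 * D ^ 2 * L ^ 2 * Q ^ 2 * θ₂ * g ^ 2 +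
      D ^ 2 * x ^ 2 * L ^ 2 * Q ^ 2 * θp := ⟨_, rfl⟩
  obtain ⟨J, hJ⟩ : ∃ J, J = A ^ 3 * (4 * (θε + 1) * Γ + (4 * θε + 3) * L) +
      2 * A ^ 2 * β * (θε + 1) * w + A * (4 * θε * g + L) + 2 * β * θε * w := ⟨_, rfl⟩
  obtain ⟨Y, hY⟩ : ∃ Y, Y = A ^ 2 * (θε + 1) + θε := ⟨_, rfl⟩
  have hD' : D = A ^ 2 + 0 + 1 := by rw [hD]; ring
  have hY' : Y = D - 1 + θε * D := by rw [hY, hD]; ring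
  have hQ' : Q = 4 * g * Y - L * A ^ 2 := by rw [hQ, hY, hg]; ring
  have hM' : M = β ^ 2 * Y + θp * D := by rw [hM, hY, hD]; ring
  have hD'' : 1 + A ^ 2 = D := by rw [hD]; ring
  have hB : 2 * A ^ 2 * β * (θε + 1) * w + A * L + 2 * β * θε * w = 2 * β * Y * w + A * L := by
    rw [hY]; ring
  have hJ' : J = A * Q + (2 * β * Y * w + A * L) := by rw [hJ, hQ, hY]; ring
  have hLD : A ^ 2 * L + L = L * D := by rw [hD]; ring
  have hn : A ^ 3 * β * (θε + 1) * (2 * Γ + x) * w - 2 * A ^ 2 * g *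
      (2 * (θε + 1) * Γ - (θε + 1) * x + (4 * θε + 3) * L) + A * β * θε * (2 * Γ + x) * w -
      2 * θε * g * (2 * Γ - x + 4 * L) =
      A * β * Y * (2 * Γ + x) * w - 2 * g * ((2 * Γ - x) * Y + 4 * L * Y - L * A ^ 2) := by
    rw [hY]; ring
  have hd : A ^ 2 * (β ^ 2 * (θε + 1) + θp) * -(4 * Γ * (x - L) + x ^ 2) + 4 * A * β * g -
      (β ^ 2 * θε + θp) * (4 * Γ * (x - L) + x ^ 2) =
      4 * A * β * g - M * (4 * Γ * (x - L) + x ^ 2) := by rw [hM]; ring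
  have pos : 0 < A → 0 < L → 0 < D ∧ 0 < g ∧ 0 < Y ∧ 0 < Q ∧ 0 < M := by
    intro hA hL
    have hD0 : 0 < D := by rw [hD]; positivity
    have hg0 : 0 < g := by rw [hg]; positivity
    have hY0 : 0 < Y := by rw [hY]; positivity
    exact ⟨hD0, hg0, hY0, by rw [hQ]; positivity, by rw [hM']; positivity⟩
  simp only [PureSystem, PureClosedForms]
  rw [← hD, hD'', ← hM, ← hY, ← hg, ← hQ, ← hw, ← hK, ← hH, ← hN, ← hV, ← hJ, hB, hLD, hn, hd,
    continuationConditions_one_iff le_rfl hD' hY' hM' rfl hg rfl rfl rfl]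
  constructor
  · rintro ⟨⟨⟨d₁, d₂, d₃₄⟩, ⟨hL, i₂, i₃⟩, ⟨a₁, a₂, a₃⟩, hκ⟩, hit⟩
    have hD0 : 0 < D := by rw [hD]; positivity
    have hL₁ : L₁ = A / D := by rw [← d₁]; field_simp
    -- The second-order condition bounds `Λ₁` below by `L r² ≥ 0`, which excludes nonpositive
    -- trading intensities.
    have hA : 0 < A := by
      have h₁ : 0 < L₁ := lt_of_lt_of_le hit.1 (sub_le_self _ (by positivity))
      rw [← d₁]; positivity
    obtain ⟨-, hg0, hY0, hQ0, hM0⟩ := pos hA hL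
    obtain ⟨q, hq⟩ : ∃ q, q = x * β + L * (β₂₁ + β₂₃ * β) := ⟨_, rfl⟩
    rw [← hq] at i₃
    have a₁' : 4 * g * β₂₁ * Y = A + q * A ^ 2 := by
      have hDA : D - 1 = A ^ 2 := by rw [hD]; ring
      rw [hDA] at a₁
      linear_combination 2 * a₁ - A * i₂ - A ^ 2 * i₃
    obtain ⟨hβ₂₁, hqQ⟩ := (pure_beta₂₁_iff hY0.ne' hg0.ne' hQ0.ne' hg hQ' hw hq a₃).1 a₁'
    have hJq : J = (A + q) * Q := by rw [hJ', ← hqQ]; ring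
    obtain ⟨k₁, k₂, k₃⟩ := pure_auxiliary hL.ne' hD hg hY' hQ' hw hK hH hN hV hq hqQ i₂ i₃ a₂
      rfl rfl rfl
    have hdet := (pure_det_pos hA.ne' hθ₂ hθp hθε hD hY' hM' (A₂₁ := A₂₁) (α₂₂ := α₂₂)
      (b := β₂₁ + β₂₃ * β) (β₂₂ := β₂₂) rfl rfl).ne'
    have hL₁p : L₁p = A * β / M := by rw [eq_div_iff hM0.ne', d₂]; ring
    have h₁₂ := (pure_dealers₂_iff hg0.ne' hQ0.ne' hL.ne' hD0.ne' hdet k₁ k₂ k₃).1 d₃₄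
    have h₃ := (pure_it_iff hL.ne' hD0.ne' hQ0.ne' rfl hL₁ i₂ i₃ hJq hqQ.symm).1 hit
    have h₄ := (pure_hft_iff hM0 hg0 hg hY0.ne' hQ0.ne' hQ' hL₁p hβ₂₁ a₃ rfl rfl rfl).1 hκ
    refine ⟨⟨h₁₂.1, h₁₂.2, h₃.2, h₄.2, hL, h₃.1, h₄.1⟩, hL₁, hL₁p, ?_, ?_, hβ₂₁, ?_, ?_⟩
    · rw [eq_div_iff (by positivity)]; linarith
    · rw [← hqQ, eq_comm, neg_eq_iff_eq_neg, div_eq_iff (by positivity)]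
      linear_combination Q * i₃
    · rw [eq_comm, neg_eq_iff_eq_neg, div_eq_iff (by positivity)]; linarith
    · rw [eq_comm, neg_eq_iff_eq_neg, div_eq_iff (by positivity)]; linarith
  · rintro ⟨⟨h₁, h₂, h₃, h₄, hL, h₅, h₆⟩, hL₁, hL₁p, hA₂₁, hα₂₂, hβ₂₁, hβ₂₂, hβ₂₃⟩
    have hD0 : 0 < D := by rw [hD]; positivity
    have hA : 0 < A := by
      have h : 0 < A / D := lt_of_lt_of_le h₅ (sub_le_self _ (by positivity))
      exact (div_pos_iff_of_pos_right hD0).1 h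
    obtain ⟨-, hg0, hY0, hQ0, hM0⟩ := pos hA hL
    have d₁ : L₁ * D = A := by rw [hL₁]; field_simp
    have i₂ : 2 * L * A₂₁ = 1 := by rw [hA₂₁]; field_simp
    have a₂ : 2 * g * β₂₂ = -x := by rw [hβ₂₂]; field_simp
    have a₃ : 2 * g * β₂₃ = -(x + 2 * Γ) := by rw [hβ₂₃]; field_simp; ring
    obtain ⟨q, hq⟩ : ∃ q, q = x * β + L * (β₂₁ + β₂₃ * β) := ⟨_, rfl⟩
    -- The fixed-point equation for `q` follows from the closed forms of `β₂₁` and `β₂₃` alone; the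
    -- closed form of `α₂₂` then becomes her second-stage condition.
    have hqQ : q * Q = 2 * β * Y * w + A * L := by
      have e₁ : 2 * g * q = 2 * g * L * β₂₁ + β * w := by
        rw [hq, hw]
        rw [hg] at a₃ ⊢
        linear_combination L * β * a₃
      have e₂ : 2 * g * Q * β₂₁ = A ^ 2 * β * w + 2 * g * A := by rw [hβ₂₁]; field_simp
      refine mul_left_cancel₀ hg0.ne' (mul_left_cancel₀ (two_ne_zero (α := ℝ)) ?_)
      linear_combination Q * e₁ + L * e₂ + β * w * hQ'
    have a₁' := (pure_beta₂₁_iff hY0.ne' hg0.ne' hQ0.ne' hg hQ' hw hq a₃).2 ⟨hβ₂₁, hqQ⟩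
    have i₃ : 2 * L * α₂₂ = -q := by
      rw [hα₂₂, ← hqQ]; field_simp
    have hJq : J = (A + q) * Q := by rw [hJ', ← hqQ]; ring
    obtain ⟨k₁, k₂, k₃⟩ := pure_auxiliary hL.ne' hD hg hY' hQ' hw hK hH hN hV hq hqQ i₂ i₃ a₂
      rfl rfl rfl
    have hdet := (pure_det_pos hA.ne' hθ₂ hθp hθε hD hY' hM' (A₂₁ := A₂₁) (α₂₂ := α₂₂)
      (b := β₂₁ + β₂₃ * β) (β₂₂ := β₂₂) rfl rfl).ne'
    have d₃₄ := (pure_dealers₂_iff hg0.ne' hQ0.ne' hL.ne' hD0.ne' hdet k₁ k₂ k₃).2 ⟨h₁, h₂⟩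
    have hit := (pure_it_iff hL.ne' hD0.ne' hQ0.ne' rfl hL₁ i₂ i₃ hJq hqQ.symm).2 ⟨h₅, h₃⟩
    have hκ := (pure_hft_iff hM0 hg0 hg hY0.ne' hQ0.ne' hQ' hL₁p hβ₂₁ a₃ rfl rfl rfl).2 ⟨h₆, h₄⟩
    refine ⟨⟨⟨d₁, ?_, d₃₄⟩, ⟨hL, i₂, ?_⟩, ⟨?_, a₂, a₃⟩, hκ⟩, hit⟩
    · rw [hL₁p]; field_simp
    · rw [← hq]; exact i₃
    · have hDA : D - 1 = A ^ 2 := by rw [hD]; ring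
      rw [hDA]
      linear_combination a₁' / 2 + A * i₂ / 2 + A ^ 2 * i₃ / 2

theorem mainTheorem5 {Ω : Type*} [MeasurableSpace Ω] (μ : Measure Ω) [IsProbabilityMeasure μ]
    (P : MarketParams) (c : LinearCoeffs) (X : Primitives Ω) (hX : X.IsMarket P c.σz μ) :
    (IsMixedEquilibrium μ X P.γ c.σz (c.profile P) ↔
      MixedSystem P.θp P.θ₂ P.θε P.Γ (c.A₁ P) (c.θz P) c.β₁₁ ∧
      MixedClosedForms P.θp P.θε P.Γ (c.A₁ P) (c.θz P) c.β₁₁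
        (c.Λ₁ P) (c.Λ₁p P) (c.Λ₂₁ P) (c.Λ₂₂ P) (c.A₂₁ P) c.α₂₂ c.β₂₁ c.β₂₂ c.β₂₃) ∧
    (IsPureEquilibrium μ X P.γ c.σz (c.profile P) ↔
      c.σz = 0 ∧
      PureSystem P.θp P.θ₂ P.θε P.Γ (c.Λ₂₁ P) (c.Λ₂₂ P) (c.A₁ P) c.β₁₁ ∧
      PureClosedForms P.θp P.θε P.Γ (c.Λ₂₁ P) (c.Λ₂₂ P) (c.A₁ P) c.β₁₁
        (c.Λ₁ P) (c.Λ₁p P) (c.A₂₁ P) c.α₂₂ c.β₂₁ c.β₂₂ c.β₂₃) := by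
  have h₁ := P.σ₁_pos
  have h₁p := P.σ₁p_pos
  have h₂ := P.σ₂_pos
  have hv := P.σv_pos
  have hθp : 0 < P.θp := by unfold MarketParams.θp; positivity
  have hθ₂ : 0 < P.θ₂ := by unfold MarketParams.θ₂; positivity
  have hθε : 0 ≤ P.θε := by unfold MarketParams.θε; positivity
  have hΓ : 0 ≤ P.Γ := div_nonneg P.γ_nonneg (div_pos hv h₁).le
  constructor
  · rw [c.isMixedEquilibrium_iff hX, mixed_conditions_iff hθp hθ₂ hθε hΓ]
  · rw [c.isPureEquilibrium_iff hX, pure_conditions_iff hθp hθ₂ hθε hΓ]
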